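/- All monoids are commutative, written additively; $P^*$ denotes the units of $P$. A homomorphism $h:Q\to P$ is *local* if $h^{-1}(P^*)=Q^*$. A *locally monoidal space* is a topological space $X$ with a sheaf of monoids $\mathcal M_X$; a morphism is a continuous map $f:X\to Y$ with a map of sheaves $f^{-1}\mathcal M_Y\to\mathcal M_X$ whose stalk maps $\mathcal M_{Y,f(x)}\to\mathcal M_{X,x}$ are all local. A *face* of a monoid $P$ is a submonoid $F$ such that $p+p'\in F$ implies $p,p'\in F$. $\operatorname{Spec}P$ is the set of faces of $P$ with the topology generated by the sets $\{F: p\in F\}$, $p\in P$, and with the structure sheaf whose sections are the families of elements of the localizations $F^{-1}P$ that are locally of the form $p-q$ (so its stalk at $F$ is $F^{-1}P$); it is contravariantly functorial in $P$. An *(abstract) fan* is a locally monoidal space with an open cover by subspaces isomorphic to spectra of monoids; fans form a full subcategory of locally monoidal spaces. A fan is *toric* if it has an open cover by spectra of toric monoids, i.e. finitely generated monoids $P$ such that $P\to P^{\rm gp}$ is injective, $P$ is saturated in $P^{\rm gp}$, and $P^{\rm gp}$ is torsion-free. A *classical fan* with lattice $N$ (a finitely generated free abelian group) is a finite non-empty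 set $\Sigma$ of sharp rational cones in $N_{\mathbb R}=N\otimes\mathbb R$ (cones generated by finitely many elements of $N$ and containing no nonzero $v$ together with $-v$) such that every face of a cone of $\Sigma$ is in $\Sigma$ and no point of $N$ lies in the interior (the complement of the proper faces) of more than one cone of $\Sigma$. A morphism from $(N,\Sigma)$ to $(N',\Sigma')$ is a homomorphism $f:N\to N'$ such that $f_{\mathbb R}$ maps every $\sigma\in\Sigma$ into some $\sigma'\in\Sigma'$. To a classical fan $\Sigma$, with $M=\operatorname{Hom}(N,\mathbb Z)$, associate the space $\Sigma$, in which a subset is open iff it is closed under passing to faces, with the sheaf $\mathcal M_\Sigma$ whose stalk at $\sigma$ is $M\cap\sigma^\vee$ and whose generalization maps are the inclusions $M\cap\sigma^\vee\subseteq M\cap\tau^\vee$ for $\tau$ a face of $\sigma$. To a morphism $f$ associate the map that sends $\sigma$ to the smallest cone $\sigma'\in\Sigma'$ containing $f_{\mathbb R}(\sigma)$, with the stalk maps $M'\cap(\sigma')^\vee\to M\cap\sigma^\vee$, $m\mapsto m\circ f$. **Theorem.** Each $(\Sigma,\mathcal M_\Sigma)$ is an abstract fan, and the functor $\Sigma\mapsto(\Sigma,\mathcal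 M_\Sigma)$ from classical fans to abstract fans is fully faithful. An abstract fan $X$ lies in its essential image if and only if $X$ is toric and 1. the underlying topological space of $X$ is finite and irreducible (in particular non-empty); and 2. whenever $f,g:\operatorname{Spec}\mathbb N\to X$ are maps of fans whose restrictions along the map $\operatorname{Spec}\mathbb Z\to\operatorname{Spec}\mathbb N$ induced by $\mathbb N\subseteq\mathbb Z$ agree, we have $f=g$. -/

import Mathlib

universe u

noncomputable section

open CategoryTheory TopologicalSpace Opposite TensorProduct

/-! ### Colimits of commutative monoids (needed to speak of stalks) -/

namespace AddCommMonCat.Colimits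

variable {J : Type u} [Category.{u} J] (F : J ⥤ AddCommMonCat.{u})

/-- The relation on the direct sum identifying an element of `F j` with its image in `F k`. -/
inductive Rel : (DirectSum J fun j => F.obj j) → (DirectSum J fun j => F.obj j) → Prop
  | of {j k : J} (f : j ⟶ k) (x : F.obj j) [DecidableEq J] :
      Rel (DirectSum.of (fun j => F.obj j) k (F.map f x)) (DirectSum.of (fun j => F.obj j) j x)

open Classical in
/-- The colimit cocone. -/
def cocone : Limits.Cocone F where
  pt := AddCommMonCat.of (addConGen (Rel F)).Quotient
  ι :=
    { app j := AddCommMonCat.ofHom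
        ((addConGen (Rel F)).mk'.comp (DirectSum.of (fun j => F.obj j) j))
      naturality j k f := by
        ext x
        exact (AddCon.eq _).2 (AddConGen.Rel.of _ _ (Rel.of f x)) }

open Classical in
/-- The colimit cocone is a colimit. -/
def isColimit : Limits.IsColimit (cocone F) where
  desc s := AddCommMonCat.ofHom <|
    (addConGen (Rel F)).lift (DirectSum.toAddMonoid fun j => (s.ι.app j).hom) <| by
      refine AddCon.addConGen_le.2 ?_
      rintro _ _ ⟨f, x⟩
      refine (AddCon.ker_rel _).2 ?_
      rename_i j k i
      obtain rfl : i = (fun a b => Classical.propDecidable (a = b)) := Subsingleton.elim _ _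
      simp [DirectSum.toAddMonoid_of]
  fac s j := by
    ext x
    exact DirectSum.toAddMonoid_of (β := fun j => F.obj j) (γ := s.pt) (fun j => (s.ι.app j).hom) j x
  uniq s m h := by
    ext x
    induction x using AddCon.induction_on with
    | H x =>
      induction x using DirectSum.induction_on with
      | zero => exact (map_zero m.hom).trans (map_zero _).symm
      | of j x =>
        have h1 : m.hom ((addConGen (Rel F)).mk' (DirectSum.of (fun j => F.obj j) j x))
            = s.ι.app j x := congrArg (fun g => g.hom x) (h j)
        exact h1.trans (DirectSum.toAddMonoid_of (β := fun j => F.obj j) (γ := s.pt) (fun j => (s.ι.app j).hom) j x).symm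
      | add x y hx hy =>
        exact (map_add m.hom _ _).trans ((congrArg₂ (· + ·) hx hy).trans (map_add _ _ _).symm)

end AddCommMonCat.Colimits

instance AddCommMonCat.instHasColimits : Limits.HasColimits AddCommMonCat.{u} where
  has_colimits_of_shape _ _ :=
    { has_colimit F := ⟨⟨⟨AddCommMonCat.Colimits.cocone F, AddCommMonCat.Colimits.isColimit F⟩⟩⟩ }

/-! ### Locally monoidal spaces -/

/-- A homomorphism of monoids is local if only units map to units. -/
def AddMonoidHom.IsLocal {Q P : Type*} [AddCommMonoid Q] [AddCommMonoid P] (h : Q →+ P) : Prop :=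
  ∀ q : Q, IsAddUnit (h q) → IsAddUnit q

/-- A (locally) monoidal space: a topological space with a sheaf of commutative monoids. -/
structure LMS where
  /-- The underlying monoidal space. -/
  toSheafedSpace : AlgebraicGeometry.SheafedSpace.{u + 1, u, u} AddCommMonCat.{u}

namespace LMS

/-- The points of a locally monoidal space. -/
abbrev Pt (X : LMS.{u}) : Type u := X.toSheafedSpace.toPresheafedSpace.carrier

/-- The stalk of the structure sheaf. -/
abbrev stalk (X : LMS.{u}) (x : X.Pt) : AddCommMonCat.{u} :=
  X.toSheafedSpace.presheaf.stalk x

/-- A morphism of locally monoidal spaces: a morphism of monoidal spaces all of whose stalk maps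
are local. -/
@[ext]
structure Hom (X Y : LMS.{u}) where
  /-- The underlying morphism of monoidal spaces. -/
  toHom : X.toSheafedSpace ⟶ Y.toSheafedSpace
  isLocal : ∀ x : X.Pt, (toHom.hom.stalkMap x).hom.IsLocal

instance : Category LMS.{u} where
  Hom := Hom
  id X :=
    { toHom := 𝟙 _
      isLocal x := by
        have h := AlgebraicGeometry.PresheafedSpace.stalkMap.id
          X.toSheafedSpace.toPresheafedSpace x
        intro q hq
        erw [h] at hq
        exact hq }
  comp {X Y Z} f g :=
    { toHom := f.toHom ≫ g.toHom
      isLocal x := by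
        have h := AlgebraicGeometry.PresheafedSpace.stalkMap.comp f.toHom.hom g.toHom.hom x
        intro q hq
        erw [h] at hq
        exact g.isLocal _ q (f.isLocal x _ hq) }

/-- To check that stalk maps are local it suffices to look at sections near a point. -/
theorem isLocal_stalkMap {X Y : LMS.{u}} (f : X.toSheafedSpace ⟶ Y.toSheafedSpace)
    (H : ∀ (x : X.Pt) (U : Opens Y.Pt) (_ : f.hom.base x ∈ U)
      (s : Y.toSheafedSpace.presheaf.obj (op U)) (V : Opens X.Pt) (_ : x ∈ V)
      (i : V ⟶ (Opens.map f.hom.base).obj U),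
      IsAddUnit (X.toSheafedSpace.presheaf.map i.op (f.hom.c.app (op U) s)) →
      ∃ (W : Opens Y.Pt) (_ : f.hom.base x ∈ W) (j : W ⟶ U),
        IsAddUnit (Y.toSheafedSpace.presheaf.map j.op s))
    (x : X.Pt) : (f.hom.stalkMap x).hom.IsLocal := by
  intro q hq
  obtain ⟨U, hU, s, rfl⟩ := TopCat.Presheaf.exists_germ_eq _ q
  have e : (f.hom.stalkMap x).hom (Y.toSheafedSpace.presheaf.germ U (f.hom.base x) hU s)
      = X.toSheafedSpace.presheaf.germ ((Opens.map f.hom.base).obj U) x hU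
          (f.hom.c.app (op U) s) :=
    congrArg (fun g => g.hom s) (AlgebraicGeometry.PresheafedSpace.stalkMap_germ f.hom U x hU)
  erw [e] at hq
  obtain ⟨b, hb⟩ := hq.exists_neg
  obtain ⟨V, hV, t, rfl⟩ := TopCat.Presheaf.exists_germ_eq _ b
  let V₁ : Opens X.Pt := (Opens.map f.hom.base).obj U ⊓ V
  have hV₁ : x ∈ V₁ := ⟨hU, hV⟩
  let i₁ : V₁ ⟶ (Opens.map f.hom.base).obj U := Opens.infLELeft _ _
  let i₂ : V₁ ⟶ V := Opens.infLERight _ _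
  rw [← TopCat.Presheaf.germ_res_apply _ i₁ x hV₁, ← TopCat.Presheaf.germ_res_apply _ i₂ x hV₁] at hb
  have hb' : X.toSheafedSpace.presheaf.germ V₁ x hV₁
      (X.toSheafedSpace.presheaf.map i₁.op (f.hom.c.app (op U) s) +
        X.toSheafedSpace.presheaf.map i₂.op t) = X.toSheafedSpace.presheaf.germ V₁ x hV₁ 0 := by
    refine ((map_add (X.toSheafedSpace.presheaf.germ V₁ x hV₁).hom _ _).trans hb).trans
      (map_zero (X.toSheafedSpace.presheaf.germ V₁ x hV₁).hom).symm
  obtain ⟨W, hW, j₁, j₂, h⟩ := TopCat.Presheaf.germ_eq _ x hV₁ hV₁ _ _ hb'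
  obtain ⟨W', hW', k, hk⟩ := H x U hU s W hW (j₁ ≫ i₁) (by
    refine .of_add_eq_zero (X.toSheafedSpace.presheaf.map (j₁ ≫ i₂).op t) ?_
    have h0 := (map_add (X.toSheafedSpace.presheaf.map j₁.op).hom _ _).symm.trans
      (h.trans (map_zero (X.toSheafedSpace.presheaf.map j₂.op).hom))
    rw [op_comp, op_comp, Functor.map_comp, Functor.map_comp]
    exact h0)
  rw [← TopCat.Presheaf.germ_res_apply _ k (f.hom.base x) hW']
  exact hk.map (Y.toSheafedSpace.presheaf.germ W' (f.hom.base x) hW').hom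

/-- The open subspace on an open set `U`. -/
def restrict (X : LMS.{u}) (U : Opens X.Pt) : LMS.{u} :=
  ⟨X.toSheafedSpace.restrict U.isOpenEmbedding⟩

end LMS

/-! ### Sheaves of monoids of functions -/

section FunctionSheaf

open TopCat

variable {X : TopCat.{u}} {T : X → Type u} [∀ x, AddCommMonoid (T x)]

/-- A local predicate on dependent functions, closed under sums. -/
structure AddLocalPredicate {X : TopCat.{u}} (T : X → Type u) [∀ x, AddCommMonoid (T x)] extends
    LocalPredicate T where
  zero_mem : ∀ U : Opens X, pred (fun _ : U => 0)
  add_mem : ∀ {U : Opens X} (s t : ∀ x : U, T x), pred s → pred t → pred (fun x => s x + t x)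

/-- The monoid of sections over `U`. -/
def AddLocalPredicate.sections (P : AddLocalPredicate T) (U : Opens X) :
    AddSubmonoid (∀ x : U, T x) where
  carrier := {s | P.pred s}
  zero_mem' := P.zero_mem U
  add_mem' {s t} hs ht := P.add_mem s t hs ht

/-- The presheaf of monoids of the functions satisfying the predicate. -/
def AddLocalPredicate.presheaf (P : AddLocalPredicate T) : Presheaf AddCommMonCat.{u} X where
  obj U := AddCommMonCat.of (P.sections U.unop)
  map {U V} i := AddCommMonCat.ofHom
    { toFun s := ⟨fun x => s.1 ⟨x.1, i.unop.le x.2⟩, P.res i.unop s.1 s.2⟩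
      map_zero' := rfl
      map_add' _ _ := rfl }

theorem AddLocalPredicate.isSheaf (P : AddLocalPredicate T) : P.presheaf.IsSheaf := by
  rw [TopCat.Presheaf.isSheaf_iff_isSheaf_comp (CategoryTheory.forget AddCommMonCat.{u})]
  refine TopCat.Presheaf.isSheaf_of_iso ?_ (subsheafToTypes P.toLocalPredicate).2
  exact NatIso.ofComponents fun _ => Iso.refl _

/-- The monoidal space given by an additive local predicate. -/
def AddLocalPredicate.toLMS (P : AddLocalPredicate T) : LMS.{u} :=
  ⟨{ carrier := X, presheaf := P.presheaf, IsSheaf := P.isSheaf }⟩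

end FunctionSheaf

/-! ### The spectrum of a monoid -/

/-- A face of a commutative monoid. -/
@[ext]
structure MonoidFace (P : Type u) [AddCommMonoid P] extends AddSubmonoid P where
  mem_of_add_mem : ∀ {p q : P}, p + q ∈ toAddSubmonoid → p ∈ toAddSubmonoid ∧ q ∈ toAddSubmonoid

namespace MonoidFace

variable {P Q : Type u} [AddCommMonoid P] [AddCommMonoid Q]

/-- The set of faces containing `p`. -/
def basicOpen (p : P) : Set (MonoidFace P) := {F | p ∈ F.toAddSubmonoid}

/-- The Zariski topology, with basic open sets the `basicOpen p`. -/
instance : TopologicalSpace (MonoidFace P) :=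
  TopologicalSpace.generateFrom (Set.range basicOpen)

theorem isOpen_basicOpen (p : P) : IsOpen (basicOpen p) :=
  TopologicalSpace.isOpen_generateFrom_of_mem ⟨p, rfl⟩

/-- The preimage of a face. -/
def comap (h : Q →+ P) (F : MonoidFace P) : MonoidFace Q where
  toAddSubmonoid := F.toAddSubmonoid.comap h
  mem_of_add_mem {p q} hpq := F.mem_of_add_mem (p := h p) (q := h q) (by
    rw [← map_add]; exact hpq)

theorem continuous_comap (h : Q →+ P) : Continuous (comap h) := by
  refine continuous_generateFrom_iff.2 ?_
  rintro _ ⟨q, rfl⟩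
  exact isOpen_basicOpen (h q)

/-- The localization `F⁻¹P` of `P` at the face `F`. -/
abbrev Loc (F : MonoidFace P) : Type u := AddLocalization F.toAddSubmonoid

/-- The map of localizations `(h⁻¹F)⁻¹Q → F⁻¹P`. -/
def locMap (h : Q →+ P) (F : MonoidFace P) : (F.comap h).Loc →+ F.Loc :=
  (AddLocalization.addMonoidOf (F.comap h).toAddSubmonoid).map
    (g := h) (T := F.toAddSubmonoid) (fun y => y.2) (AddLocalization.addMonoidOf F.toAddSubmonoid)

theorem locMap_mk (h : Q →+ P) (F : MonoidFace P) (p : Q) (q : (F.comap h).toAddSubmonoid) :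
    locMap h F (AddLocalization.mk p q) = AddLocalization.mk (h p) ⟨h q, q.2⟩ := by
  rw [AddLocalization.mk_eq_addMonoidOf_mk'_apply, AddLocalization.mk_eq_addMonoidOf_mk'_apply]
  exact AddSubmonoid.LocalizationMap.map_mk' _ _ _ _

theorem mem_of_isAddUnit_mk (F : MonoidFace P) (p : P) (q : F.toAddSubmonoid)
    (h : IsAddUnit (AddLocalization.mk p q : F.Loc)) : p ∈ F.toAddSubmonoid := by
  obtain ⟨b, hb⟩ := h.exists_neg
  induction b using AddLocalization.induction_on with
  | H y =>
    rw [AddLocalization.mk_add, ← AddLocalization.mk_zero, AddLocalization.mk_eq_mk_iff,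
      AddLocalization.r_iff_exists] at hb
    obtain ⟨c, hc⟩ := hb
    have h1 : (c : P) + ((0 : F.toAddSubmonoid) + (p + y.1)) ∈ F.toAddSubmonoid := by
      rw [hc]
      exact add_mem c.2 (add_mem (q + y.2).2 (zero_mem _))
    exact (F.mem_of_add_mem (F.mem_of_add_mem (F.mem_of_add_mem h1).2).2).1

end MonoidFace

namespace LMS

open MonoidFace

variable {P Q : Type u} [AddCommMonoid P] [AddCommMonoid Q]

/-- A family of elements of the localizations is locally a fraction if near every point it has the
form `F ↦ p - q ∈ F⁻¹P` with `q` in all faces `F` of the neighbourhood. -/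
def locallyFraction (P : Type u) [AddCommMonoid P] :
    AddLocalPredicate (X := TopCat.of (MonoidFace P)) (fun F => MonoidFace.Loc F) where
  pred {U} s := ∀ x : U, ∃ (V : Opens (TopCat.of (MonoidFace P))) (_ : x.1 ∈ V) (i : V ⟶ U)
    (p q : P), ∀ y : V, ∃ hq : q ∈ y.1.toAddSubmonoid, s ⟨y.1, i.le y.2⟩ = AddLocalization.mk p ⟨q, hq⟩
  res {U V} i s hs x := by
    obtain ⟨W, hx, j, p, q, h⟩ := hs ⟨x.1, i.le x.2⟩
    exact ⟨W ⊓ U, ⟨hx, x.2⟩, Opens.infLERight _ _, p, q, fun y => h ⟨y.1, y.2.1⟩⟩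
  locality {U} s hs x := by
    obtain ⟨V, hx, i, h⟩ := hs x
    obtain ⟨W, hx', j, p, q, h'⟩ := h ⟨x.1, hx⟩
    exact ⟨W, hx', j ≫ i, p, q, h'⟩
  zero_mem U x := ⟨U, x.2, 𝟙 _, 0, 0, fun y => ⟨zero_mem _, AddLocalization.mk_zero.symm⟩⟩
  add_mem {U} s t hs ht x := by
    obtain ⟨V, hx, i, p, q, h⟩ := hs x
    obtain ⟨V', hx', i', p', q', h'⟩ := ht x
    refine ⟨V ⊓ V', ⟨hx, hx'⟩, Opens.infLELeft _ _ ≫ i, p + p', q + q', fun y => ?_⟩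
    obtain ⟨hq, e⟩ := h ⟨y.1, y.2.1⟩
    obtain ⟨hq', e'⟩ := h' ⟨y.1, y.2.2⟩
    exact ⟨add_mem hq hq', (congrArg₂ (· + ·) e e').trans (AddLocalization.mk_add _ _ _ _)⟩

/-- The locally monoidal space `Spec P`: its points are the faces of `P`, and its sections are the
families of elements of the localizations `F⁻¹P` that are locally fractions. -/
def Spec (P : Type u) [AddCommMonoid P] : LMS.{u} := (locallyFraction P).toLMS

/-- The morphism of monoidal spaces underlying `Spec h`. -/
def specMapAux (h : Q →+ P) : (Spec P).toSheafedSpace ⟶ (Spec Q).toSheafedSpace :=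
  InducedCategory.homMk
    { base := TopCat.ofHom ⟨comap h, continuous_comap h⟩
      c :=
        { app U := AddCommMonCat.ofHom
            { toFun s := ⟨fun F => locMap h F.1 (s.1 ⟨F.1.comap h, F.2⟩), fun x => by
                obtain ⟨V, hx, i, p, q, e⟩ := s.2 ⟨x.1.comap h, x.2⟩
                refine ⟨V.comap ⟨comap h, continuous_comap h⟩, hx, ⟨⟨fun y hy => i.le hy⟩⟩,
                  h p, h q, fun y => ?_⟩
                obtain ⟨hq, e'⟩ := e ⟨y.1.comap h, y.2⟩
                exact ⟨hq, (congrArg (locMap h y.1) e').trans (locMap_mk h y.1 p ⟨q, hq⟩)⟩⟩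
              map_zero' := Subtype.ext (funext fun F => map_zero (locMap h F.1))
              map_add' s t := Subtype.ext (funext fun F => map_add (locMap h F.1) _ _) }
          naturality U V i := by
            ext s
            rfl } }

/-- The morphism `Spec h : Spec P ⟶ Spec Q` induced by a homomorphism `h : Q → P`. -/
def specMap (h : Q →+ P) : Spec P ⟶ Spec Q where
  toHom := specMapAux h
  isLocal := isLocal_stalkMap (X := Spec P) (Y := Spec Q) (specMapAux h) <| by
    intro F U hU s V hV i hs
    obtain ⟨W, hW, j, p, q, e⟩ := s.2 ⟨comap h F, hU⟩
    obtain ⟨hq, e₀⟩ := e ⟨comap h F, hW⟩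
    have hu : IsAddUnit (locMap h F (s.1 ⟨comap h F, hU⟩)) :=
      hs.map (⟨⟨fun t => t.1 ⟨F, hV⟩, rfl⟩, fun _ _ => rfl⟩ :
        ((locallyFraction P).sections V) →+ F.Loc)
    have hp : h p ∈ F.toAddSubmonoid := by
      refine mem_of_isAddUnit_mk F (h p) ⟨h q, hq⟩ ?_
      rw [← locMap_mk h F p ⟨q, hq⟩, ← e₀]
      exact hu
    refine ⟨W ⊓ ⟨basicOpen p, isOpen_basicOpen p⟩, ⟨hW, hp⟩, Opens.infLELeft _ _ ≫ j, ?_⟩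
    let t : (locallyFraction Q).sections (W ⊓ ⟨basicOpen p, isOpen_basicOpen p⟩) :=
      ⟨fun G => AddLocalization.mk q ⟨p, G.2.2⟩,
        fun G => ⟨_, G.2, 𝟙 _, q, p, fun G' => ⟨G'.2.2, rfl⟩⟩⟩
    refine .of_add_eq_zero (M := (locallyFraction Q).sections _) t ?_
    refine Subtype.ext (funext fun G => ?_)
    obtain ⟨hq', e'⟩ := e ⟨G.1, G.2.1⟩
    refine (congrArg (· + (AddLocalization.mk q ⟨p, G.2.2⟩ : Loc G.1)) e').trans ?_
    rw [AddLocalization.mk_add]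
    rw [add_comm p q]
    exact AddLocalization.mk_self ((⟨q, hq'⟩ : G.1.toAddSubmonoid) + ⟨p, G.2.2⟩)

end LMS

/-! ### Cones and classical fans -/

namespace LatticeCone

variable {N N' N'' : Type u} [AddCommGroup N] [AddCommGroup N'] [AddCommGroup N'']

/-- The image `1 ⊗ n` of `n ∈ N` in `N ⊗ ℝ`. -/
abbrev toReal (n : N) : ℝ ⊗[ℤ] N := (1 : ℝ) ⊗ₜ[ℤ] n

/-- The real extension of a homomorphism. -/
abbrev mapReal (f : N →ₗ[ℤ] N') : ℝ ⊗[ℤ] N →ₗ[ℝ] ℝ ⊗[ℤ] N' := f.baseChange ℝ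

/-- The real linear functional on `N ⊗ ℝ` extending `m : N → ℤ`. -/
def evalReal (m : N →ₗ[ℤ] ℤ) : ℝ ⊗[ℤ] N →ₗ[ℝ] ℝ :=
  (AlgebraTensorModule.rid ℤ ℝ ℝ).toLinearMap ∘ₗ m.baseChange ℝ

theorem evalReal_toReal (m : N →ₗ[ℤ] ℤ) (n : N) : evalReal m (toReal n) = m n := by
  simp [evalReal, toReal]

theorem evalReal_comp (m : N' →ₗ[ℤ] ℤ) (f : N →ₗ[ℤ] N') (v : ℝ ⊗[ℤ] N) :
    evalReal (m ∘ₗ f) v = evalReal m (mapReal f v) := by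
  simp [evalReal, mapReal, LinearMap.baseChange_comp]

theorem evalReal_zero (v : ℝ ⊗[ℤ] N) : evalReal (0 : N →ₗ[ℤ] ℤ) v = 0 := by
  simp [evalReal]

theorem evalReal_add (m m' : N →ₗ[ℤ] ℤ) (v : ℝ ⊗[ℤ] N) :
    evalReal (m + m') v = evalReal m v + evalReal m' v := by
  simp [evalReal, LinearMap.baseChange_add]

/-- A cone is rational if it is generated by finitely many lattice points. -/
def IsRational (σ : PointedCone ℝ (ℝ ⊗[ℤ] N)) : Prop :=
  ∃ S : Finset N, σ = PointedCone.hull ℝ (toReal '' (S : Set N))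

/-- A cone is sharp if `0` is its only unit. -/
def IsSharp (σ : PointedCone ℝ (ℝ ⊗[ℤ] N)) : Prop :=
  ∀ v, v ∈ σ → -v ∈ σ → v = 0

/-- The interior of a cone: the complement of the proper faces. -/
def interior (σ : PointedCone ℝ (ℝ ⊗[ℤ] N)) : Set (ℝ ⊗[ℤ] N) :=
  {v | v ∈ σ ∧ ∀ τ : PointedCone ℝ (ℝ ⊗[ℤ] N), τ.IsFaceOf σ → τ ≠ σ → v ∉ τ}

/-- The monoid `M ∩ σ^∨` of integral functionals that are non-negative on `σ`. -/
def dualMonoid (σ : PointedCone ℝ (ℝ ⊗[ℤ] N)) : AddSubmonoid (N →ₗ[ℤ] ℤ) where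
  carrier := {m | ∀ v ∈ σ, 0 ≤ evalReal m v}
  zero_mem' v _ := (evalReal_zero v).ge
  add_mem' {m m'} hm hm' v hv := by
    rw [evalReal_add]
    exact add_nonneg (hm v hv) (hm' v hv)

end LatticeCone

open LatticeCone

/-- A classical fan: a lattice `N` and a finite non-empty set of sharp rational cones in `N ⊗ ℝ`,
closed under passage to faces, such that no lattice point is interior to two different cones. -/
structure ClassicalFan where
  /-- The lattice. -/
  N : Type u
  [addCommGroup : AddCommGroup N]
  [free : Module.Free ℤ N]
  [finite : Module.Finite ℤ N]
  /-- The cones. -/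
  cones : Set (PointedCone ℝ (ℝ ⊗[ℤ] N))
  cones_finite : cones.Finite
  cones_nonempty : cones.Nonempty
  rational : ∀ σ ∈ cones, IsRational σ
  sharp : ∀ σ ∈ cones, IsSharp σ
  face_mem : ∀ σ ∈ cones, ∀ τ : PointedCone ℝ (ℝ ⊗[ℤ] N), τ.IsFaceOf σ → τ ∈ cones
  eq_of_mem_interior : ∀ n : N, ∀ σ ∈ cones, ∀ τ ∈ cones,
    toReal n ∈ interior σ → toReal n ∈ interior τ → σ = τ

namespace ClassicalFan

attribute [instance] ClassicalFan.addCommGroup ClassicalFan.free ClassicalFan.finite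

/-- A morphism of classical fans: a map of lattices taking every cone into some cone. -/
@[ext]
structure Hom (S T : ClassicalFan.{u}) where
  /-- The map of lattices. -/
  toLin : S.N →ₗ[ℤ] T.N
  map_cone : ∀ σ ∈ S.cones, ∃ σ' ∈ T.cones, ∀ v ∈ σ, mapReal toLin v ∈ σ'

instance : Category ClassicalFan.{u} where
  Hom := Hom
  id S :=
    { toLin := LinearMap.id
      map_cone σ hσ := ⟨σ, hσ, fun v hv => by simpa [mapReal] using hv⟩ }
  comp f g :=
    { toLin := g.toLin ∘ₗ f.toLin
      map_cone σ hσ := by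
        obtain ⟨σ', h', e'⟩ := f.map_cone σ hσ
        obtain ⟨σ'', h'', e''⟩ := g.map_cone σ' h'
        refine ⟨σ'', h'', fun v hv => ?_⟩
        simpa [mapReal, LinearMap.baseChange_comp] using e'' _ (e' v hv) }

/-- The points of the space attached to a classical fan are its cones. -/
def Pt (S : ClassicalFan.{u}) : Type u := {σ : PointedCone ℝ (ℝ ⊗[ℤ] S.N) // σ ∈ S.cones}

/-- A set of cones is open if it is closed under passage to faces. -/
instance (S : ClassicalFan.{u}) : TopologicalSpace S.Pt where
  IsOpen U := ∀ σ ∈ U, ∀ τ : S.Pt, τ.1.IsFaceOf σ.1 → τ ∈ U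
  isOpen_univ _ _ _ _ := trivial
  isOpen_inter U V hU hV σ hσ τ h := ⟨hU σ hσ.1 τ h, hV σ hσ.2 τ h⟩
  isOpen_sUnion Us h σ := by
    rintro ⟨U, hU, hσ⟩ τ hτ
    exact ⟨U, hU, h U hU σ hσ τ hτ⟩

/-- The open set `[σ]` of all faces of `σ`. -/
def faces (S : ClassicalFan.{u}) (σ : S.Pt) : Opens (TopCat.of S.Pt) where
  carrier := {τ | τ.1.IsFaceOf σ.1}
  is_open' _ hτ _ hρ := hρ.trans hτ

/-- A family of elements of the monoids `M ∩ σ^∨`, for `σ` in an open set, is compatible if it is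
respected by the generalization maps, the inclusions `M ∩ σ^∨ ⊆ M ∩ τ^∨` for `τ` a face of `σ`. -/
def compatible (S : ClassicalFan.{u}) :
    AddLocalPredicate (X := TopCat.of S.Pt) (fun σ => dualMonoid σ.1) where
  pred {U} s := ∀ σ τ : U, τ.1.1.IsFaceOf σ.1.1 → (s τ : S.N →ₗ[ℤ] ℤ) = s σ
  res i s hs σ τ h := hs ⟨σ.1, i.le σ.2⟩ ⟨τ.1, i.le τ.2⟩ h
  locality {U} s hs σ τ h := by
    obtain ⟨V, hV, i, e⟩ := hs σ
    exact e ⟨σ.1, hV⟩ ⟨τ.1, V.2 σ.1 hV τ.1 h⟩ h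
  zero_mem _ _ _ _ := rfl
  add_mem s t hs ht σ τ h := congrArg₂ (· + ·) (hs σ τ h) (ht σ τ h)

/-- The locally monoidal space of a classical fan: the space of cones, with the sheaf whose stalk
at `σ` is `M ∩ σ^∨` and whose generalization maps are the inclusions. As the space is finite, a
section over an open set is a compatible family of elements of the stalks. -/
def toLMSObj (S : ClassicalFan.{u}) : LMS.{u} := S.compatible.toLMS

/-! #### The map on points -/

/-- Every point of a cone lies in the interior of a face of the cone. -/
theorem exists_face_interior (S : ClassicalFan.{u}) (x : ℝ ⊗[ℤ] S.N)
    (σ : PointedCone ℝ (ℝ ⊗[ℤ] S.N)) (hx : x ∈ σ) :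
    ∃ τ : PointedCone ℝ (ℝ ⊗[ℤ] S.N), τ.IsFaceOf σ ∧ x ∈ interior τ := by
  let F : Set (PointedCone ℝ (ℝ ⊗[ℤ] S.N)) := {τ | τ.IsFaceOf σ ∧ x ∈ τ}
  have hF : (σ ⊓ sInf F).IsFaceOf σ := PointedCone.IsFaceOf.sInf F fun f hf => hf.1
  have hxF : x ∈ σ ⊓ sInf F := ⟨hx, Submodule.mem_sInf.2 fun f hf => hf.2⟩
  refine ⟨_, hF, hxF, fun τ hτ hne hxτ => hne ?_⟩
  exact le_antisymm hτ.le (inf_le_right.trans (sInf_le ⟨hτ.trans hF, hxτ⟩))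

theorem exists_leastCone_face {S T : ClassicalFan.{u}} (f : S ⟶ T) (σ : S.Pt) :
    ∃ σ' : T.Pt, (∀ v ∈ σ.1, mapReal f.toLin v ∈ σ'.1) ∧
      ∀ ρ : T.Pt, (∀ v ∈ σ.1, mapReal f.toLin v ∈ ρ.1) → σ'.1.IsFaceOf ρ.1 := by
  obtain ⟨G, hG⟩ := S.rational σ.1 σ.2
  have hgen : ∀ g ∈ G, toReal g ∈ σ.1 := fun g hg => by
    rw [hG]
    exact PointedCone.subset_hull ⟨g, hg, rfl⟩
  let n : S.N := ∑ g ∈ G, g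
  have hn : toReal n = ∑ g : G, toReal g.1 := by
    rw [Finset.sum_coe_sort G (fun g => toReal g)]
    simp [n, toReal, TensorProduct.tmul_sum]
  have hnσ : toReal n ∈ σ.1 := by
    rw [hn]
    exact sum_mem fun g _ => hgen g.1 g.2
  have hfn : mapReal f.toLin (toReal n) = toReal (f.toLin n) := by simp [mapReal, toReal]
  -- a face of a cone containing the image of `σ` contains that image if it contains that of `n`
  have key : ∀ ρ τ : PointedCone ℝ (ℝ ⊗[ℤ] T.N), τ.IsFaceOf ρ →
      (∀ v ∈ σ.1, mapReal f.toLin v ∈ ρ) → toReal (f.toLin n) ∈ τ →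
      ∀ v ∈ σ.1, mapReal f.toLin v ∈ τ := by
    intro ρ τ hτ hρ hx
    have h1 : ∀ g : G, mapReal f.toLin (toReal g.1) ∈ τ := by
      refine hτ.mem_of_sum_mem (fun g => hρ _ (hgen g.1 g.2)) ?_
      rw [← map_sum, ← hn, hfn]
      exact hx
    have h2 : σ.1 ≤ τ.comap (mapReal f.toLin) := by
      rw [hG]
      refine Submodule.span_le.2 ?_
      rintro _ ⟨g, hg, rfl⟩
      exact h1 ⟨g, hg⟩
    exact fun v hv => h2 hv
  obtain ⟨ρ₀, hρ₀, e₀⟩ := f.map_cone σ.1 σ.2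
  obtain ⟨τ₀, hτ₀, hint₀⟩ := T.exists_face_interior (toReal (f.toLin n)) ρ₀ (hfn ▸ e₀ _ hnσ)
  refine ⟨⟨τ₀, T.face_mem _ hρ₀ _ hτ₀⟩, key ρ₀ τ₀ hτ₀ e₀ hint₀.1, fun ρ hρ => ?_⟩
  obtain ⟨τ, hτ, hint⟩ := T.exists_face_interior (toReal (f.toLin n)) ρ.1 (hfn ▸ hρ _ hnσ)
  have e : τ₀ = τ := T.eq_of_mem_interior (f.toLin n) τ₀ (T.face_mem _ hρ₀ _ hτ₀) τ
    (T.face_mem _ ρ.2 _ hτ) hint₀ hint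
  change τ₀.IsFaceOf ρ.1
  rw [e]
  exact hτ

theorem exists_leastCone {S T : ClassicalFan.{u}} (f : S ⟶ T) (σ : S.Pt) :
    ∃ σ' : T.Pt, (∀ v ∈ σ.1, mapReal f.toLin v ∈ σ'.1) ∧
      ∀ ρ : T.Pt, (∀ v ∈ σ.1, mapReal f.toLin v ∈ ρ.1) → σ'.1 ≤ ρ.1 := by
  obtain ⟨σ', h, h'⟩ := exists_leastCone_face f σ
  exact ⟨σ', h, fun ρ hρ => (h' ρ hρ).le⟩

/-- The smallest cone of `T` containing the image of `σ`. -/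
def leastCone {S T : ClassicalFan.{u}} (f : S ⟶ T) (σ : S.Pt) : T.Pt :=
  (exists_leastCone f σ).choose

theorem map_mem_leastCone {S T : ClassicalFan.{u}} (f : S ⟶ T) (σ : S.Pt) :
    ∀ v ∈ σ.1, mapReal f.toLin v ∈ (leastCone f σ).1 :=
  (exists_leastCone f σ).choose_spec.1

theorem leastCone_le {S T : ClassicalFan.{u}} (f : S ⟶ T) (σ : S.Pt) (ρ : T.Pt)
    (h : ∀ v ∈ σ.1, mapReal f.toLin v ∈ ρ.1) : (leastCone f σ).1 ≤ ρ.1 :=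
  (exists_leastCone f σ).choose_spec.2 ρ h

theorem leastCone_isFaceOf {S T : ClassicalFan.{u}} (f : S ⟶ T) (σ : S.Pt) (ρ : T.Pt)
    (h : ∀ v ∈ σ.1, mapReal f.toLin v ∈ ρ.1) : (leastCone f σ).1.IsFaceOf ρ.1 := by
  obtain ⟨σ', h₁, h₂⟩ := exists_leastCone_face f σ
  have e : (leastCone f σ).1 = σ'.1 :=
    le_antisymm (leastCone_le f σ σ' h₁) (h₂ _ (map_mem_leastCone f σ)).le
  rw [e]
  exact h₂ ρ h

theorem leastCone_mono {S T : ClassicalFan.{u}} (f : S ⟶ T) (σ τ : S.Pt)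
    (h : τ.1.IsFaceOf σ.1) : (leastCone f τ).1.IsFaceOf (leastCone f σ).1 :=
  leastCone_isFaceOf f τ _ fun v hv => map_mem_leastCone f σ v (h.le hv)

theorem leastCone_id (S : ClassicalFan.{u}) (σ : S.Pt) : leastCone (𝟙 S) σ = σ := by
  have hid : ∀ v, mapReal (Hom.toLin (𝟙 S)) v = v := fun v => by
    change (LinearMap.baseChange ℝ LinearMap.id) v = v
    simp
  refine Subtype.ext (le_antisymm (leastCone_le _ _ _ fun v hv => ?_) fun v hv => ?_)
  · rwa [hid]
  · simpa only [hid] using map_mem_leastCone (𝟙 S) σ v hv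

theorem mapReal_comp {S T R : ClassicalFan.{u}} (f : S ⟶ T) (g : T ⟶ R) (v : ℝ ⊗[ℤ] S.N) :
    mapReal (Hom.toLin (f ≫ g)) v = mapReal g.toLin (mapReal f.toLin v) := by
  change (LinearMap.baseChange ℝ (g.toLin ∘ₗ f.toLin)) v = _
  simp [LinearMap.baseChange_comp]

theorem leastCone_comp {S T R : ClassicalFan.{u}} (f : S ⟶ T) (g : T ⟶ R) (σ : S.Pt) :
    leastCone (f ≫ g) σ = leastCone g (leastCone f σ) := by
  have hface : (leastCone (f ≫ g) σ).1.IsFaceOf (leastCone g (leastCone f σ)).1 := by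
    refine leastCone_isFaceOf _ _ _ fun v hv => ?_
    rw [mapReal_comp]
    exact map_mem_leastCone g _ _ (map_mem_leastCone f σ v hv)
  refine Subtype.ext (le_antisymm hface.le (leastCone_le _ _ _ fun w hw => ?_))
  -- the preimage of a face is a face
  let ρ : PointedCone ℝ (ℝ ⊗[ℤ] T.N) :=
    (leastCone f σ).1 ⊓ (leastCone (f ≫ g) σ).1.comap (mapReal g.toLin)
  have hρ : ρ.IsFaceOf (leastCone f σ).1 :=
    { le := inf_le_left
      mem_of_smul_add_mem := by
        intro x y a hx hy ha h
        refine ⟨hx, hface.mem_of_smul_add_mem (map_mem_leastCone g _ _ hx)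
          (map_mem_leastCone g _ _ hy) ha ?_⟩
        have := h.2
        simpa using this }
  have hle : (leastCone f σ).1 ≤ ρ :=
    leastCone_le f σ ⟨ρ, T.face_mem _ (leastCone f σ).2 _ hρ⟩ fun v hv =>
      ⟨map_mem_leastCone f σ v hv, by
        have := map_mem_leastCone (f ≫ g) σ v hv
        rwa [mapReal_comp] at this⟩
  exact (hle hw).2

theorem continuous_leastCone {S T : ClassicalFan.{u}} (f : S ⟶ T) :
    Continuous (leastCone f) :=
  ⟨fun U hU σ hσ τ h => hU _ hσ _ (leastCone_mono f σ τ h)⟩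

/-! #### The functor -/

/-- The dual map `M' ∩ (σ')^∨ → M ∩ σ^∨` of a morphism, for `σ'` the smallest cone containing the
image of `σ`. -/
def dualMap {S T : ClassicalFan.{u}} (f : S ⟶ T) (σ : S.Pt) :
    dualMonoid (leastCone f σ).1 →+ dualMonoid σ.1 where
  toFun m := ⟨m.1 ∘ₗ f.toLin, fun v hv => by
    rw [evalReal_comp]
    exact m.2 _ (map_mem_leastCone f σ v hv)⟩
  map_zero' := rfl
  map_add' _ _ := rfl

/-- The morphism of monoidal spaces attached to a morphism of classical fans. -/
def mapAux {S T : ClassicalFan.{u}} (f : S ⟶ T) :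
    S.toLMSObj.toSheafedSpace ⟶ T.toLMSObj.toSheafedSpace :=
  InducedCategory.homMk
    { base := TopCat.ofHom ⟨leastCone f, continuous_leastCone f⟩
      c :=
        { app U := AddCommMonCat.ofHom
            { toFun s := ⟨fun σ => dualMap f σ.1 (s.1 ⟨leastCone f σ.1, σ.2⟩), fun σ τ h =>
                congrArg (· ∘ₗ f.toLin) (s.2 ⟨leastCone f σ.1, σ.2⟩ ⟨leastCone f τ.1, τ.2⟩
                  (leastCone_mono f σ.1 τ.1 h))⟩
              map_zero' := rfl
              map_add' _ _ := rfl }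
          naturality U V i := by
            ext s
            rfl } }

/-- The morphism of locally monoidal spaces attached to a morphism of classical fans. -/
def toLMSMap {S T : ClassicalFan.{u}} (f : S ⟶ T) : S.toLMSObj ⟶ T.toLMSObj where
  toHom := mapAux f
  isLocal := LMS.isLocal_stalkMap (X := S.toLMSObj) (Y := T.toLMSObj) (mapAux f) <| by
    intro σ U hU s _ hV i hs
    let σ' : T.Pt := leastCone f σ
    let m : dualMonoid σ'.1 := s.1 ⟨σ', hU⟩
    have hu : IsAddUnit (dualMap f σ m) :=
      hs.map (⟨⟨fun t => t.1 ⟨σ, hV⟩, rfl⟩, fun _ _ => rfl⟩ :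
        (S.compatible.sections _) →+ dualMonoid σ.1)
    obtain ⟨b, hb⟩ := hu.exists_neg
    have hzero : ∀ v ∈ σ.1, evalReal m.1 (mapReal f.toLin v) = 0 := by
      intro v hv
      have h1 : evalReal (m.1 ∘ₗ f.toLin + b.1) v = 0 := by
        rw [show m.1 ∘ₗ f.toLin + b.1 = 0 from congrArg Subtype.val hb, evalReal_zero]
      rw [evalReal_add, evalReal_comp] at h1
      have h2 := b.2 v hv
      have h3 := m.2 _ (map_mem_leastCone f σ v hv)
      linarith
    let ρ : PointedCone ℝ (ℝ ⊗[ℤ] T.N) :=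
      σ'.1 ⊓ PointedCone.ofSubmodule (LinearMap.ker (evalReal m.1))
    have hρ : ρ.IsFaceOf σ'.1 :=
      { le := inf_le_left
        mem_of_smul_add_mem := by
          intro x y a hx hy ha h
          have h0 : evalReal m.1 (a • x + y) = 0 := h.2
          rw [map_add, map_smul, smul_eq_mul] at h0
          have hx' := m.2 x hx
          have hy' := m.2 y hy
          refine ⟨hx, show evalReal m.1 x = 0 from ?_⟩
          have : a * evalReal m.1 x = 0 := by
            have := mul_nonneg ha.le hx'
            linarith
          exact (mul_eq_zero.1 this).resolve_left ha.ne' }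
    have hle : σ'.1 ≤ ρ :=
      leastCone_le f σ ⟨ρ, T.face_mem _ σ'.2 _ hρ⟩ fun v hv =>
        ⟨map_mem_leastCone f σ v hv, hzero v hv⟩
    have hneg : ∀ v ∈ σ'.1, evalReal (-m.1) v = 0 := by
      intro v hv
      have h0 : evalReal m.1 v = 0 := (hle hv).2
      have h1 : evalReal (m.1 + -m.1) v = 0 := by rw [add_neg_cancel, evalReal_zero]
      rw [evalReal_add, h0, zero_add] at h1
      exact h1
    have hWU : T.faces σ' ≤ U := fun τ hτ => U.2 σ' hU τ hτ
    refine ⟨T.faces σ', PointedCone.IsFaceOf.refl _, homOfLE hWU, ?_⟩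
    let t : T.compatible.sections (T.faces σ') :=
      ⟨fun τ => ⟨-m.1, fun v hv => (hneg v (τ.2.le hv)).ge⟩, fun _ _ _ => rfl⟩
    refine .of_add_eq_zero (M := T.compatible.sections _) t ?_
    refine Subtype.ext (funext fun τ => Subtype.ext ?_)
    have h1 : (s.1 ⟨τ.1, hWU τ.2⟩).1 = m.1 := s.2 ⟨σ', hU⟩ ⟨τ.1, hWU τ.2⟩ τ.2
    exact (congrArg (· + -m.1) h1).trans (add_neg_cancel m.1)

/-- The functor from classical fans to locally monoidal spaces. -/
def toLMS : ClassicalFan.{u} ⥤ LMS.{u} where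
  obj S := S.toLMSObj
  map f := toLMSMap f
  map_id S := by
    have hpt : TopCat.ofHom ⟨leastCone (𝟙 S), continuous_leastCone (𝟙 S)⟩ = 𝟙 (TopCat.of S.Pt) :=
      TopCat.hom_ext (ContinuousMap.ext (leastCone_id S))
    refine LMS.Hom.ext (AlgebraicGeometry.SheafedSpace.ext _ _ hpt ?_)
    ext U s
    refine Subtype.ext (funext fun σ => Subtype.ext ?_)
    have key : ∀ (a b : S.Pt) (_ : a = b) (ha : a ∈ U) (hb : b ∈ U),
        (s.1 ⟨a, ha⟩).1 = (s.1 ⟨b, hb⟩).1 := by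
      rintro a _ rfl _ _
      rfl
    exact key _ _ (leastCone_id S σ.1) _ _
  map_comp {S T R} f g := by
    have hpt : TopCat.ofHom ⟨leastCone (f ≫ g), continuous_leastCone (f ≫ g)⟩ =
        TopCat.ofHom ⟨leastCone f, continuous_leastCone f⟩ ≫
          TopCat.ofHom ⟨leastCone g, continuous_leastCone g⟩ :=
      TopCat.hom_ext (ContinuousMap.ext (leastCone_comp f g))
    refine LMS.Hom.ext (AlgebraicGeometry.SheafedSpace.ext _ _ hpt ?_)
    ext U s
    refine Subtype.ext (funext fun σ => Subtype.ext ?_)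
    have key : ∀ (a b : R.Pt) (_ : a = b) (ha : a ∈ U) (hb : b ∈ U),
        (s.1 ⟨a, ha⟩).1 = (s.1 ⟨b, hb⟩).1 := by
      rintro a _ rfl _ _
      rfl
    exact congrArg (· ∘ₗ (g.toLin ∘ₗ f.toLin)) (key _ _ (leastCone_comp f g σ.1) _ _)

end ClassicalFan

/-! ### Abstract fans -/

/-- A monoid is toric if it is finitely generated, integral, saturated and torsion-free, the last
three being conditions on the map from `P` to its group completion. -/
def IsToricMonoid (P : Type u) [AddCommMonoid P] : Prop :=
  AddMonoid.FG P ∧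
  Function.Injective (Algebra.GrothendieckAddGroup.of (M := P)) ∧
  (∀ (x : Algebra.GrothendieckAddGroup P) (n : ℕ), 0 < n →
    n • x ∈ Set.range (Algebra.GrothendieckAddGroup.of (M := P)) →
      x ∈ Set.range (Algebra.GrothendieckAddGroup.of (M := P))) ∧
  ∀ (x : Algebra.GrothendieckAddGroup P) (n : ℕ), 0 < n → n • x = 0 → x = 0

namespace LMS

/-- An abstract fan: a locally monoidal space covered by open subspaces isomorphic to spectra of
monoids. -/
def IsFan : ObjectProperty LMS.{u} := fun X =>
  ∀ x : X.Pt, ∃ U : Opens X.Pt, x ∈ U ∧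
    ∃ (P : Type u) (_ : AddCommMonoid P), Nonempty (X.restrict U ≅ Spec P)

/-- A toric fan: a locally monoidal space covered by open subspaces isomorphic to spectra of toric
monoids. -/
def IsToric (X : LMS.{u}) : Prop :=
  ∀ x : X.Pt, ∃ U : Opens X.Pt, x ∈ U ∧
    ∃ (P : Type u) (_ : AddCommMonoid P), IsToricMonoid P ∧ Nonempty (X.restrict U ≅ Spec P)

/-- The inclusion `ℕ → ℤ` (in the universe `u`). -/
def natToInt : ULift.{u} ℕ →+ ULift.{u} ℤ :=
  AddEquiv.ulift.symm.toAddMonoidHom.comp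
    ((Nat.castAddMonoidHom ℤ).comp AddEquiv.ulift.toAddMonoidHom)

/-- Two morphisms `Spec ℕ ⟶ X` with the same restriction to `Spec ℤ` are equal. -/
def IsValuativelySeparated (X : LMS.{u}) : Prop :=
  ∀ f g : Spec (ULift.{u} ℕ) ⟶ X, specMap natToInt ≫ f = specMap natToInt ≫ g → f = g

end LMS

/-- The category of abstract fans, a full subcategory of locally monoidal spaces. -/
abbrev AbstractFan := LMS.IsFan.{u}.FullSubcategory

end

/-! Everything rests on the duality between rational cones in `N ⊗ ℝ` and finitely generated
saturated submonoids of `M = Hom(N, ℤ)`, which comes from Fourier–Motzkin elimination and Gordan's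
lemma. For such a submonoid `P` with dual cone `σ`, a face `F` of `P` corresponds to the face of `σ`
on which `F` vanishes, inclusions are reversed, and the localization `F⁻¹P`, seen in `M` as `P - F`,
is the dual monoid of that face (`dualMonoid_faceCone`, `isFaceOf_faceCone_iff`). Hence `Spec (M ∩
σ^∨)` is an open subspace of `Σ`, namely the set of faces of `σ` (`isOpenImmersion_chart`), and `Σ`
is a toric fan.

Full faithfulness: the zero cone is the generic point of `Σ`, its stalk is the group `M`, and all
stalks lie inside it. Locality sends the zero cone to the zero cone, so a morphism induces a
homomorphism `M' → M`, hence by double duality a map `N → N'`. The remaining stalk maps are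
restrictions of `M' → M`, and locality again forces the image of `σ` to be the smallest cone
containing the image of `σ` under `N → N'` (`pt_eq_of_isFaceOf`).

Essential image: an irreducible toric fan `X` has a generic point `η` whose stalk is a lattice,
which may be written as the dual of a lattice `N`. Each stalk embeds in it, so each point `x` has a
cone `ptCone` in `N ⊗ ℝ`. Inside one chart these cones behave as they should by the duality above.
What can fail globally is that cones of different points overlap. A morphism `Spec ℕ → X` whose
generic point goes to `η` has an underlying lattice point `n`, lying in the interior of the cone of
the image of the closed point; its restriction to `Spec ℤ` remembers only `n`. Conversely every
interior lattice point of the cone of `x` arises in this way (`IsLatticeChart.exists_nat_hom`). So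
condition 2 says that no lattice point is interior to the cones of two points. This makes `ptCone`
injective, the cones form a classical fan, and the stalk embeddings assemble to an isomorphism from
its space to `X`. -/

noncomputable section

open TensorProduct LatticeCone

namespace LatticeCone

/-! ### Real extensions of integral functionals and dual cones -/

section Eval

variable {N : Type u} [AddCommGroup N]

/-- The extension of integral functionals to real functionals, as a homomorphism. -/
def evalRealHom (N : Type u) [AddCommGroup N] : (N →ₗ[ℤ] ℤ) →+ (ℝ ⊗[ℤ] N →ₗ[ℝ] ℝ) where
  toFun := evalReal
  map_zero' := LinearMap.ext evalReal_zero
  map_add' m m' := LinearMap.ext (evalReal_add m m')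

theorem evalReal_neg (m : N →ₗ[ℤ] ℤ) (v : ℝ ⊗[ℤ] N) : evalReal (-m) v = -evalReal m v :=
  congrArg (fun f => f v) (map_neg (evalRealHom N) m)

theorem evalReal_sub (m m' : N →ₗ[ℤ] ℤ) (v : ℝ ⊗[ℤ] N) :
    evalReal (m - m') v = evalReal m v - evalReal m' v :=
  congrArg (fun f => f v) (map_sub (evalRealHom N) m m')

theorem evalReal_nsmul (n : ℕ) (m : N →ₗ[ℤ] ℤ) (v : ℝ ⊗[ℤ] N) :
    evalReal (n • m) v = n • evalReal m v :=
  congrArg (fun f => f v) (map_nsmul (evalRealHom N) n m)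

/-- The cone on which all functionals of a set are non-negative. -/
def dualCone (I : Set (N →ₗ[ℤ] ℤ)) : PointedCone ℝ (ℝ ⊗[ℤ] N) where
  carrier := {v | ∀ m ∈ I, 0 ≤ evalReal m v}
  zero_mem' m _ := (map_zero (evalReal m)).ge
  add_mem' {v w} hv hw m hm := by
    rw [map_add]
    exact add_nonneg (hv m hm) (hw m hm)
  smul_mem' c v hv m hm := by
    have : evalReal m (c • v) = c.1 * evalReal m v := map_smul (evalReal m) c.1 v
    rw [this]
    exact mul_nonneg c.2 (hv m hm)

theorem mem_dualCone {I : Set (N →ₗ[ℤ] ℤ)} {v : ℝ ⊗[ℤ] N} :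
    v ∈ dualCone I ↔ ∀ m ∈ I, 0 ≤ evalReal m v := Iff.rfl

theorem dualCone_anti {I J : Set (N →ₗ[ℤ] ℤ)} (h : I ⊆ J) : dualCone J ≤ dualCone I :=
  fun _ hv m hm => hv m (h hm)

theorem dualCone_closure (I : Set (N →ₗ[ℤ] ℤ)) :
    dualCone (AddSubmonoid.closure I : Set (N →ₗ[ℤ] ℤ)) = dualCone I := by
  refine le_antisymm (dualCone_anti AddSubmonoid.subset_closure) fun v hv m hm => ?_
  induction hm using AddSubmonoid.closure_induction with
  | mem m h => exact hv m h
  | zero => exact (evalReal_zero v).ge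
  | add m m' _ _ h h' =>
    rw [evalReal_add]
    exact add_nonneg h h'

theorem toReal_mem_dualCone {I : Set (N →ₗ[ℤ] ℤ)} {n : N} :
    toReal n ∈ dualCone I ↔ ∀ m ∈ I, 0 ≤ m n := by
  simp only [mem_dualCone, evalReal_toReal, Int.cast_nonneg_iff]

theorem mem_dualMonoid_hull {S : Set N} {m : N →ₗ[ℤ] ℤ} :
    m ∈ dualMonoid (PointedCone.hull ℝ (toReal '' S)) ↔ ∀ s ∈ S, 0 ≤ m s := by
  constructor
  · intro h s hs
    have := h _ (PointedCone.subset_hull ⟨s, hs, rfl⟩)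
    rwa [evalReal_toReal, Int.cast_nonneg_iff] at this
  · intro h
    have : PointedCone.hull ℝ (toReal '' S) ≤ dualCone {m} := by
      refine Submodule.span_le.2 ?_
      rintro _ ⟨s, hs, rfl⟩
      refine toReal_mem_dualCone.2 ?_
      rintro _ rfl
      exact h s hs
    exact fun v hv => this hv m rfl

theorem toReal_add (a b : N) : toReal (a + b) = toReal a + toReal b := tmul_add _ _ _

theorem toReal_zsmul (c : ℤ) (a : N) : toReal (c • a) = (c : ℝ) • toReal a := by
  rw [toReal, ← TensorProduct.smul_tmul, smul_tmul', zsmul_eq_mul, smul_eq_mul]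

theorem toReal_sub (a b : N) : toReal (a - b) = toReal a - toReal b := tmul_sub _ _ _

theorem toReal_sum {ι : Type*} (s : Finset ι) (f : ι → N) :
    toReal (∑ i ∈ s, f i) = ∑ i ∈ s, toReal (f i) := tmul_sum _ _ _

theorem dualMonoid_saturated (σ : PointedCone ℝ (ℝ ⊗[ℤ] N)) (m : N →ₗ[ℤ] ℤ) (n : ℕ) (hn : 0 < n)
    (h : n • m ∈ dualMonoid σ) : m ∈ dualMonoid σ := by
  intro v hv
  have := h v hv
  rw [evalReal_nsmul, nsmul_eq_mul] at this
  exact nonneg_of_mul_nonneg_right this (by positivity)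

end Eval

/-! ### Duality of rational cones and finitely generated saturated monoids -/

section Duality

variable {N : Type u} [AddCommGroup N]

/-- The coordinates of `N ⊗ ℝ` with respect to a basis of `N` are themselves extensions of integral
functionals. -/
theorem eq_zero_of_evalReal [Module.Free ℤ N] (v : ℝ ⊗[ℤ] N) (h : ∀ m : N →ₗ[ℤ] ℤ, evalReal m v = 0) : v = 0 := by
  let b := Module.Free.chooseBasis ℤ N
  refine (b.baseChange ℝ).ext_elem fun i => ?_
  have key : (b.baseChange ℝ).coord i = evalReal (b.coord i) := by
    refine (b.baseChange ℝ).ext fun j => ?_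
    simp [Module.Basis.baseChange_apply, evalReal, Finsupp.single_apply]
  have := h (b.coord i)
  rw [← key] at this
  simpa using this

/-- The new generators are the old ones with `m s ≥ 0` and, for each pair `m s > 0 > m t`, the
positive combination `m s • t - m t • s` on the hyperplane `m = 0`. A vector of the old cone is `x +
y` with `x` from the non-negative and `y` from the negative generators, and `m x • (x + y) = (m x •
y - m y • x) + (m x + m y) • x`. -/
theorem hull_inf_halfspace (S : Finset N) (m : N →ₗ[ℤ] ℤ) :
    IsRational (PointedCone.hull ℝ (toReal '' (S : Set N)) ⊓ dualCone {m}) := by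
  classical
  let S₁ := S.filter fun s => 0 ≤ m s
  let S₂ := (S ×ˢ S).filter fun p => 0 < m p.1 ∧ m p.2 < 0
  let S₃ := S.filter fun s => m s < 0
  let T := S₁ ∪ S₂.image fun p => m p.1 • p.2 - m p.2 • p.1
  have hm1 : ∀ {v}, v ∈ dualCone {m} ↔ 0 ≤ evalReal m v := by simp [mem_dualCone]
  refine ⟨T, le_antisymm ?_ (Submodule.span_le.2 ?_)⟩
  · rintro v ⟨hv, hmv⟩
    rw [SetLike.mem_coe, hm1] at hmv
    have hS : PointedCone.hull ℝ (toReal '' (S : Set N)) =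
        PointedCone.hull ℝ (toReal '' (S₁ : Set N)) ⊔ PointedCone.hull ℝ (toReal '' (S₃ : Set N)) := by
      rw [PointedCone.hull, PointedCone.hull, PointedCone.hull, ← Submodule.span_union, ← Set.image_union]
      congr 2
      ext s
      have := le_or_gt 0 (m s)
      simp only [S₁, S₃, Finset.coe_filter, Set.mem_union, Set.mem_ofPred_eq, Finset.mem_coe]
      tauto
    have hv' : v ∈ PointedCone.hull ℝ (toReal '' (S₁ : Set N)) ⊔
      PointedCone.hull ℝ (toReal '' (S₃ : Set N)) := hS ▸ hv
    obtain ⟨x, hx, y, hy, rfl⟩ := Submodule.mem_sup.1 hv'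
    have hxT : ∀ x ∈ PointedCone.hull ℝ (toReal '' (S₁ : Set N)),
        x ∈ PointedCone.hull ℝ (toReal '' (T : Set N)) := fun x hx =>
      Submodule.span_mono (Set.image_mono (by simp [T])) hx
    -- If `y = 0` there is nothing to cut off. Otherwise `m y < 0 ≤ m (x + y)` gives `m x > 0`, and
    -- one may divide by `m x` at the end.
    have hy0 : y = 0 ∨ evalReal m y < 0 := by
      clear hmv hv hv'
      induction hy using Submodule.span_induction with
      | mem x h =>
        obtain ⟨s, hs, rfl⟩ := h
        right
        rw [evalReal_toReal]
        exact_mod_cast (Finset.mem_filter.1 hs).2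
      | zero => exact Or.inl rfl
      | add a b _ _ ha hb =>
        rw [map_add]
        rcases ha with rfl | ha <;> rcases hb with rfl | hb
        · simp
        · simp [hb]
        · simp [ha]
        · right; linarith
      | smul c a _ ha =>
        have e : evalReal m (c • a) = c.1 * evalReal m a := map_smul (evalReal m) c.1 a
        rcases ha with rfl | ha
        · simp
        · rcases c.2.eq_or_lt with h | h
          · left
            have : c = 0 := Subtype.ext h.symm
            rw [this, zero_smul]
          · right
            rw [e]
            exact mul_neg_of_pos_of_neg h ha
    have hx0 : 0 ≤ evalReal m x := by
      refine (mem_dualMonoid_hull (m := m)).2 ?_ x hx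
      intro s hs
      exact (Finset.mem_filter.1 hs).2
    -- The expression is bilinear in `x` and `y`, so it is enough to treat generators.
    have hcomb : evalReal m x • y - evalReal m y • x ∈ PointedCone.hull ℝ (toReal '' (T : Set N)) := by
      clear hmv hv hv' hy0 hx0
      induction hx using Submodule.span_induction with
      | zero => simp
      | add a b _ _ ha hb =>
        have : evalReal m (a + b) • y - evalReal m y • (a + b) =
            (evalReal m a • y - evalReal m y • a) + (evalReal m b • y - evalReal m y • b) := by
          rw [map_add]; module
        rw [this]
        exact add_mem ha hb
      | smul c a _ ha =>
        have e : evalReal m (c • a) = c.1 * evalReal m a := map_smul (evalReal m) c.1 a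
        have : evalReal m (c • a) • y - evalReal m y • (c • a) =
            c • (evalReal m a • y - evalReal m y • a) := by
          rw [e, ← Nonneg.coe_smul, ← Nonneg.coe_smul]; module
        rw [this]
        exact Submodule.smul_mem _ _ ha
      | mem x h =>
        obtain ⟨s, hs, rfl⟩ := h
        induction hy using Submodule.span_induction with
        | zero => simp
        | add a b _ _ ha hb =>
          have : evalReal m (toReal s) • (a + b) - evalReal m (a + b) • toReal s =
            (evalReal m (toReal s) • a - evalReal m a • toReal s) +
              (evalReal m (toReal s) • b - evalReal m b • toReal s) := by
            rw [map_add]; module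
          rw [this]
          exact add_mem ha hb
        | smul c a _ ha =>
          have e : evalReal m (c • a) = c.1 * evalReal m a := map_smul (evalReal m) c.1 a
          have : evalReal m (toReal s) • (c • a) - evalReal m (c • a) • toReal s =
            c • (evalReal m (toReal s) • a - evalReal m a • toReal s) := by
            rw [e, ← Nonneg.coe_smul, ← Nonneg.coe_smul]; module
          rw [this]
          exact Submodule.smul_mem _ _ ha
        | mem y h =>
          obtain ⟨t, ht, rfl⟩ := h
          rw [evalReal_toReal, evalReal_toReal]
          have hs' := Finset.mem_filter.1 hs
          have ht' := Finset.mem_filter.1 ht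
          rcases hs'.2.eq_or_lt with h | h
          · rw [← h, Int.cast_zero, zero_smul, zero_sub, ← neg_smul]
            refine PointedCone.smul_mem _ ?_ (hxT _ (PointedCone.subset_hull ⟨s, hs, rfl⟩))
            have := ht'.2
            rw [neg_nonneg]
            exact_mod_cast this.le
          · refine PointedCone.subset_hull ⟨m s • t - m t • s, ?_, ?_⟩
            · simp only [T, S₂, Finset.coe_union, Finset.coe_image]
              exact Or.inr ⟨(s, t), Finset.mem_filter.2
                ⟨Finset.mem_product.2 ⟨hs'.1, ht'.1⟩, h, ht'.2⟩, rfl⟩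
            · rw [toReal_sub, toReal_zsmul, toReal_zsmul]
    rcases hy0 with rfl | hy0
    · rw [add_zero]
      exact hxT x hx
    · rw [map_add] at hmv
      have hpos : 0 < evalReal m x := by linarith
      have : x + y = (evalReal m x)⁻¹ • ((evalReal m x • y - evalReal m y • x) +
          (evalReal m x + evalReal m y) • x) := by
        have : (evalReal m x • y - evalReal m y • x) +
          (evalReal m x + evalReal m y) • x = evalReal m x • (x + y) := by module
        rw [this, inv_smul_smul₀ hpos.ne']
      rw [this]
      exact PointedCone.smul_mem _ (inv_nonneg.2 hpos.le)
        (add_mem hcomb (PointedCone.smul_mem _ hmv (hxT x hx)))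
  · rintro _ ⟨s, hs, rfl⟩
    simp only [T, Finset.coe_union, Finset.coe_image] at hs
    rcases hs with hs | ⟨⟨s, t⟩, h, rfl⟩
    · have := Finset.mem_filter.1 hs
      exact ⟨PointedCone.subset_hull ⟨s, this.1, rfl⟩, toReal_mem_dualCone.2 (by simpa using this.2)⟩
    · obtain ⟨h1, h2, h3⟩ := Finset.mem_filter.1 h
      obtain ⟨hs, ht⟩ := Finset.mem_product.1 h1
      dsimp only at h2 h3 hs ht ⊢
      refine ⟨?_, toReal_mem_dualCone.2 ?_⟩
      · rw [toReal_sub, toReal_zsmul, toReal_zsmul, sub_eq_add_neg, ← neg_smul]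
        refine add_mem (PointedCone.smul_mem _ (by exact_mod_cast h2.le)
          (PointedCone.subset_hull ⟨t, ht, rfl⟩)) (PointedCone.smul_mem _ ?_
          (PointedCone.subset_hull ⟨s, hs, rfl⟩))
        rw [neg_nonneg]
        exact_mod_cast h3.le
      · rintro _ rfl
        simp [mul_comm]

variable [Module.Free ℤ N] [Module.Finite ℤ N]

theorem isRational_top : IsRational (⊤ : PointedCone ℝ (ℝ ⊗[ℤ] N)) := by
  classical
  let b := Module.Free.chooseBasis ℤ N
  refine ⟨Finset.univ.image b ∪ Finset.univ.image (fun i => -b i), (top_le_iff.1 ?_).symm⟩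
  intro v _
  rw [← (b.baseChange ℝ).sum_repr v]
  refine sum_mem fun i _ => ?_
  obtain h | h := le_total 0 ((b.baseChange ℝ).repr v i)
  · refine PointedCone.smul_mem _ h (PointedCone.subset_hull ⟨b i, by simp, ?_⟩)
    simp [Module.Basis.baseChange_apply]
  · rw [← neg_smul_neg]
    refine PointedCone.smul_mem _ (neg_nonneg.2 h) (PointedCone.subset_hull ⟨-b i, by simp, ?_⟩)
    simp [Module.Basis.baseChange_apply, toReal, tmul_neg]

/-- A cone defined by finitely many integral inequalities is rational. -/
theorem isRational_dualCone {I : Set (N →ₗ[ℤ] ℤ)} (hI : I.Finite) : IsRational (dualCone I) := by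
  induction I, hI using Set.Finite.induction_on with
  | empty =>
    have : dualCone (∅ : Set (N →ₗ[ℤ] ℤ)) = ⊤ := top_le_iff.1 fun v _ m hm => hm.elim
    rw [this]
    exact isRational_top
  | @insert m I _ _ ih =>
    obtain ⟨S, hS⟩ := ih
    have : dualCone (insert m I) = dualCone I ⊓ dualCone {m} := by
      ext v
      simp [mem_dualCone, and_comm]
    rw [this, hS]
    exact hull_inf_halfspace S m

/-- Fourier–Motzkin elimination: up to saturation, a finitely generated submonoid of a lattice is
defined by finitely many inequalities. -/
theorem exists_finite_inequalities {A : Type u} [AddCommGroup A] [Module.Free ℤ A]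
    [Module.Finite ℤ A] {T : Set A} (hT : T.Finite) :
    ∃ I : Set (A →ₗ[ℤ] ℤ), I.Finite ∧
      ∀ a, (∀ f ∈ I, 0 ≤ f a) ↔ ∃ c : ℕ, 0 < c ∧ c • a ∈ AddSubmonoid.closure T := by
  induction T, hT using Set.Finite.induction_on with
  | empty =>
    let b := Module.Free.chooseBasis ℤ A
    refine ⟨Set.range b.coord ∪ Set.range (fun i => -b.coord i),
      (Set.finite_range _).union (Set.finite_range _), fun a => ?_⟩
    constructor
    · intro h
      refine ⟨1, one_pos, ?_⟩
      have : a = 0 := b.ext_elem fun i => by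
        have h1 := h (b.coord i) (Or.inl ⟨i, rfl⟩)
        have h2 := h (-b.coord i) (Or.inr ⟨i, rfl⟩)
        simp at h1 h2 ⊢
        omega
      simp [this]
    · rintro ⟨c, hc, h⟩ f _
      simp only [AddSubmonoid.closure_empty, AddSubmonoid.mem_bot] at h
      have : c • f a = 0 := by rw [← map_nsmul, h, map_zero]
      have : f a = 0 := by simpa [hc.ne'] using this
      exact this.ge
  | @insert t T _ hT ih =>
    obtain ⟨I, hI, h⟩ := ih
    -- One elimination step: inequalities non-negative at `t` survive, and each pair `f t > 0 > g t`
    -- contributes the positive combination of `f` and `g` that vanishes at `t`.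
    refine ⟨{f ∈ I | 0 ≤ f t} ∪ Set.image2 (fun f g => f t • g - g t • f) {f ∈ I | 0 < f t}
      {g ∈ I | g t < 0}, (hI.subset (Set.sep_subset _ _)).union
        ((hI.subset (Set.sep_subset _ _)).image2 _ (hI.subset (Set.sep_subset _ _))), fun a => ?_⟩
    have hins : ∀ x, x ∈ AddSubmonoid.closure (insert t T) ↔
        ∃ k : ℕ, ∃ y ∈ AddSubmonoid.closure T, k • t + y = x := by
      intro x
      rw [Set.insert_eq, AddSubmonoid.closure_union, AddSubmonoid.mem_sup]
      simp only [AddSubmonoid.mem_closure_singleton]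
      constructor
      · rintro ⟨_, ⟨k, rfl⟩, z, hz, e⟩
        exact ⟨k, z, hz, e⟩
      · rintro ⟨k, z, hz, e⟩
        exact ⟨_, ⟨k, rfl⟩, z, hz, e⟩
    constructor
    · intro ha
      -- One looks for a rational `k / n ≥ 0` such that `a - (k / n) t` satisfies the old
      -- inequalities. Those with `g t < 0` bound `k / n` below by `g a / g t`, those with `f t > 0`
      -- bound it above by `f a / f t`, and the combined inequalities say that these bounds are
      -- compatible. So take the largest lower bound, attained at `g₀`, if it is positive, and `0`
      -- otherwise.
      obtain ⟨n, k, hn, hk⟩ : ∃ n k : ℕ, 0 < n ∧ ∀ g ∈ I, 0 ≤ g (n • a - k • t) := by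
        have h1 : ∀ f ∈ I, 0 ≤ f t → 0 ≤ f a := fun f hf hft => ha f (Or.inl ⟨hf, hft⟩)
        have h2 : ∀ f ∈ I, 0 < f t → ∀ g ∈ I, g t < 0 → g t * f a ≤ f t * g a :=
          fun f hf hft g hg hgt => by
            have := ha _ (Or.inr ⟨f, ⟨hf, hft⟩, g, ⟨hg, hgt⟩, rfl⟩)
            simpa using this
        rcases ({g ∈ I | g t < 0}).eq_empty_or_nonempty with he | hne
        · refine ⟨1, 0, one_pos, fun g hg => ?_⟩
          have : 0 ≤ g t := by
            by_contra hc
            exact (he ▸ (⟨hg, not_le.1 hc⟩ : g ∈ {g ∈ I | g t < 0}) : g ∈ (∅ : Set _))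
          simpa using h1 g hg this
        · obtain ⟨g₀, ⟨hg₀, hg₀t⟩, hmax⟩ := Set.exists_max_image _
            (fun g : A →ₗ[ℤ] ℤ => (g a : ℚ) / g t) (hI.subset (Set.sep_subset _ _)) hne
          have hmax' : ∀ g ∈ I, g t < 0 → g a * g₀ t ≤ g₀ a * g t := by
            intro g hg hgt
            have h3 := hmax g ⟨hg, hgt⟩
            have a1 : (g t : ℚ) < 0 := by exact_mod_cast hgt
            have a2 : (g₀ t : ℚ) < 0 := by exact_mod_cast hg₀t
            rw [← neg_div_neg_eq, ← neg_div_neg_eq (g₀ a : ℚ), div_le_div_iff₀ (by linarith) (by linarith)] at h3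
            have : (g a * g₀ t : ℚ) ≤ g₀ a * g t := by linarith
            exact_mod_cast this
          rcases le_or_gt 0 (g₀ a) with hpos | hneg
          · refine ⟨1, 0, one_pos, fun g hg => ?_⟩
            rcases le_or_gt 0 (g t) with h0 | h0
            · simpa using h1 g hg h0
            · have := hmax' g hg h0
              have : 0 ≤ g a := by
                by_contra hc
                linarith [mul_pos_of_neg_of_neg (not_le.1 hc) hg₀t,
                  mul_nonpos_of_nonneg_of_nonpos hpos h0.le]
              simpa using this
          · obtain ⟨n, hn⟩ := Int.eq_ofNat_of_zero_le (neg_nonneg.2 hg₀t.le)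
            obtain ⟨k, hk⟩ := Int.eq_ofNat_of_zero_le (neg_nonneg.2 hneg.le)
            refine ⟨n, k, by omega, fun g hg => ?_⟩
            rw [map_sub, map_nsmul, map_nsmul, nsmul_eq_mul, nsmul_eq_mul]
            rw [← hn, ← hk]
            rcases lt_trichotomy (g t) 0 with h0 | h0 | h0
            · have := hmax' g hg h0
              linarith
            · have := h1 g hg h0.ge
              rw [h0]
              nlinarith
            · have := h2 g hg h0 g₀ hg₀ hg₀t
              linarith
      obtain ⟨c, hc, hmem⟩ := (h _).1 hk
      refine ⟨c * n, by positivity, (hins _).2 ⟨c * k, _, hmem, ?_⟩⟩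
      simp only [smul_sub, mul_smul]
      abel
    · rintro ⟨c, hc, hmem⟩
      obtain ⟨k, y, hy, e⟩ := (hins _).1 hmem
      have hy' := (h y).2 ⟨1, one_pos, by simpa using hy⟩
      have key : ∀ f : A →ₗ[ℤ] ℤ, 0 ≤ f t → 0 ≤ f y → 0 ≤ f a := by
        intro f h1 h2
        have := congrArg f e
        rw [map_add, map_nsmul, map_nsmul, nsmul_eq_mul, nsmul_eq_mul] at this
        have h3 : 0 ≤ (c : ℤ) * f a := by
          rw [← this]
          positivity
        exact nonneg_of_mul_nonneg_right h3 (by positivity)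
      rintro f (⟨hf, hft⟩ | ⟨f, ⟨hf, hft⟩, g, ⟨hg, hgt⟩, rfl⟩)
      · exact key f hft (hy' f hf)
      · refine key _ (by simp [mul_comm]) ?_
        have h1 := hy' f hf
        have h2 := hy' g hg
        simp only [LinearMap.sub_apply, LinearMap.smul_apply, smul_eq_mul]
        nlinarith

/-- A finitely generated saturated monoid of functionals is determined by its dual cone. -/
theorem dualMonoid_dualCone {Q : AddSubmonoid (N →ₗ[ℤ] ℤ)} (hQ : Q.FG)
    (hsat : ∀ (m : N →ₗ[ℤ] ℤ) (n : ℕ), 0 < n → n • m ∈ Q → m ∈ Q) :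
    dualMonoid (dualCone (Q : Set (N →ₗ[ℤ] ℤ))) = Q := by
  refine le_antisymm (fun m hm => ?_) fun m hm v hv => hv m hm
  obtain ⟨T, hT, hTfin⟩ := (AddSubmonoid.fg_iff Q).1 hQ
  obtain ⟨I, _, h⟩ := exists_finite_inequalities hTfin
  rw [hT] at h
  -- Functionals on the dual lattice are evaluations at points of `N`; the inequalities that define
  -- `Q` up to saturation are therefore lattice points of the dual cone of `Q`.
  obtain ⟨c, hc, hcm⟩ := (h m).1 fun f hf => by
    obtain ⟨n, rfl⟩ := (Module.evalEquiv ℤ N).surjective f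
    have : toReal n ∈ dualCone (Q : Set (N →ₗ[ℤ] ℤ)) := toReal_mem_dualCone.2 fun q hq =>
      (h q).2 ⟨1, one_pos, by simpa using hq⟩ _ hf
    have := hm _ this
    rwa [evalReal_toReal, Int.cast_nonneg_iff] at this
  exact hsat m c hc hcm

/-- A rational cone is defined by finitely many integral inequalities. -/
theorem IsRational.exists_eq_dualCone {σ : PointedCone ℝ (ℝ ⊗[ℤ] N)} (hσ : IsRational σ) :
    ∃ I : Set (N →ₗ[ℤ] ℤ), I.Finite ∧ σ = dualCone I := by
  obtain ⟨S, rfl⟩ := hσ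
  obtain ⟨I, hI, h⟩ := exists_finite_inequalities S.finite_toSet
  refine ⟨I, hI, le_antisymm (Submodule.span_le.2 ?_) ?_⟩
  · rintro _ ⟨s, hs, rfl⟩
    exact toReal_mem_dualCone.2
      ((h s).2 ⟨1, one_pos, by simpa using AddSubmonoid.subset_closure hs⟩)
  -- The inequalities are known to describe lattice points only. But the cone they define is
  -- rational, so it suffices to treat its lattice generators, a positive multiple of each of which
  -- is a sum of elements of `S`.
  · obtain ⟨K, hK⟩ := isRational_dualCone hI
    rw [hK]
    refine Submodule.span_le.2 ?_
    rintro _ ⟨k, hk, rfl⟩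
    have hkI : toReal k ∈ dualCone I := hK ▸ PointedCone.subset_hull ⟨k, hk, rfl⟩
    obtain ⟨c, hc, hck⟩ := (h k).1 (toReal_mem_dualCone.1 hkI)
    have hmem : toReal (c • k) ∈ PointedCone.hull ℝ (toReal '' (S : Set N)) := by
      generalize c • k = x at hck
      induction hck using AddSubmonoid.closure_induction with
      | mem x hx => exact PointedCone.subset_hull ⟨x, hx, rfl⟩
      | zero => simp [toReal]
      | add x y _ _ hx hy =>
        rw [toReal_add]
        exact add_mem hx hy
    rw [← natCast_zsmul, toReal_zsmul] at hmem
    exact (PointedCone.smul_mem_iff _ (by positivity)).1 hmem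

theorem IsRational.dualCone_dualMonoid {σ : PointedCone ℝ (ℝ ⊗[ℤ] N)} (hσ : IsRational σ) :
    dualCone (dualMonoid σ : Set (N →ₗ[ℤ] ℤ)) = σ := by
  obtain ⟨I, _, rfl⟩ := hσ.exists_eq_dualCone
  exact le_antisymm (dualCone_anti fun m hm v hv => hv m hm) fun v hv m hm => hm v hv

/-- Gordan's lemma. -/
theorem IsRational.dualMonoid_fg {σ : PointedCone ℝ (ℝ ⊗[ℤ] N)} (hσ : IsRational σ) :
    (dualMonoid σ).FG := by
  classical
  obtain ⟨S, rfl⟩ := hσ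
  let b := Module.Free.chooseBasis ℤ N
  let ι := Module.Free.ChooseBasisIndex ℤ N
  -- The dual monoid is the image of an equalizer of two maps out of some `ℕ^r`. Two natural numbers
  -- per coordinate encode an integer as their difference, and one further variable for each
  -- generator `s` records the value `m s`, which must thus be a natural number.
  let φ : ((ι ⊕ ι) ⊕ S → ℕ) →+ (N →ₗ[ℤ] ℤ) :=
    { toFun a := ∑ i, ((a (.inl (.inl i)) : ℤ) - a (.inl (.inr i))) • b.coord i
      map_zero' := by simp
      map_add' x y := by
        rw [← Finset.sum_add_distrib]
        refine Finset.sum_congr rfl fun i _ => ?_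
        rw [← add_smul]
        congr 1
        simp only [Pi.add_apply, Nat.cast_add]
        ring }
  let f : ((ι ⊕ ι) ⊕ S → ℕ) →+ (S → ℤ) :=
    { toFun a s := φ a s
      map_zero' := by ext s; simp
      map_add' x y := by ext s; simp }
  let g : ((ι ⊕ ι) ⊕ S → ℕ) →+ (S → ℤ) :=
    { toFun a s := a (.inr s)
      map_zero' := by ext s; simp
      map_add' x y := by ext s; simp }
  have h : dualMonoid (PointedCone.hull ℝ (toReal '' (S : Set N))) = (f.eqLocusM g).map φ := by
    ext m
    rw [mem_dualMonoid_hull]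
    constructor
    · intro hm
      let a : (ι ⊕ ι) ⊕ S → ℕ := Sum.elim
        (Sum.elim (fun i => (m (b i)).toNat) (fun i => (-m (b i)).toNat)) (fun s => (m s.1).toNat)
      have ha : φ a = m := by
        refine b.ext fun j => ?_
        simp only [φ, a, AddMonoidHom.coe_mk, ZeroHom.coe_mk, LinearMap.sum_apply, LinearMap.smul_apply,
          Sum.elim_inl, Sum.elim_inr]
        rw [Finset.sum_eq_single j]
        · simp
        · intro i _ hij
          simp [hij.symm]
        · simp
      refine ⟨a, ?_, ha⟩
      change f a = g a
      ext s
      change φ a s = _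
      rw [ha]
      exact (Int.toNat_of_nonneg (hm s s.2)).symm
    · rintro ⟨a, ha, rfl⟩ s hs
      have := congrFun (show f a = g a from ha) ⟨s, hs⟩
      change φ a s = _ at this
      rw [this]
      exact Int.natCast_nonneg _
  rw [h]
  exact (AddSubmonoid.fg_eqLocusM f g).map φ

end Duality

end LatticeCone

end

noncomputable section

open TensorProduct LatticeCone

namespace LatticeCone

/-! ### Faces of monoids and faces of cones -/

section Faces

variable {N : Type u} [AddCommGroup N]

/-- A face of a submonoid of an abelian group. -/
structure IsSubmonoidFace {A : Type u} [AddCommGroup A] (F Q : AddSubmonoid A) : Prop where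
  le : F ≤ Q
  mem_of_add_mem : ∀ {p q : A}, p ∈ Q → q ∈ Q → p + q ∈ F → p ∈ F

/-- The submonoid `Q - F` of differences. -/
def differences {A : Type u} [AddCommGroup A] (Q F : AddSubmonoid A) : AddSubmonoid A where
  carrier := {d | ∃ q ∈ F, d + q ∈ Q}
  zero_mem' := ⟨0, F.zero_mem, by simp⟩
  add_mem' := by
    rintro a b ⟨p, hp, hp'⟩ ⟨q, hq, hq'⟩
    refine ⟨p + q, add_mem hp hq, ?_⟩
    rw [add_add_add_comm]
    exact add_mem hp' hq'

theorem le_differences {A : Type u} [AddCommGroup A] (Q F : AddSubmonoid A) :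
    Q ≤ differences Q F := fun d hd => ⟨0, F.zero_mem, by simpa using hd⟩

/-- A face contains the summands of its elements, so it is generated by those generators of `Q` that
it contains. -/
theorem IsSubmonoidFace.exists_closure {A : Type u} [AddCommGroup A] {Q F : AddSubmonoid A}
    (hF : IsSubmonoidFace F Q) (hQ : Q.FG) :
    ∃ I J : Set A, I.Finite ∧ J ⊆ I ∧ AddSubmonoid.closure I = Q ∧ AddSubmonoid.closure J = F := by
  obtain ⟨I, rfl, hI⟩ := (AddSubmonoid.fg_iff Q).1 hQ
  refine ⟨I, I ∩ F, hI, Set.inter_subset_left, rfl,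
    le_antisymm (AddSubmonoid.closure_le.2 Set.inter_subset_right) fun p hp => ?_⟩
  have key : ∀ p ∈ AddSubmonoid.closure I, p ∈ F → p ∈ AddSubmonoid.closure (I ∩ F) := by
    intro p hp
    induction hp using AddSubmonoid.closure_induction with
    | mem x h => exact fun hx => AddSubmonoid.subset_closure ⟨h, hx⟩
    | zero => exact fun _ => zero_mem _
    | add x y hx hy ihx ihy =>
      exact fun h => add_mem (ihx (hF.mem_of_add_mem hx hy h))
        (ihy (hF.mem_of_add_mem hy hx (by rwa [add_comm])))
  exact key p (hF.le hp) hp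

theorem IsSubmonoidFace.differences_fg {A : Type u} [AddCommGroup A] {Q F : AddSubmonoid A}
    (hF : IsSubmonoidFace F Q) (hQ : Q.FG) : (differences Q F).FG := by
  obtain ⟨I, J, hI, hJI, rfl, rfl⟩ := hF.exists_closure hQ
  refine (AddSubmonoid.fg_iff _).2 ⟨I ∪ -J, ?_, hI.union (hI.subset hJI).neg⟩
  refine le_antisymm (AddSubmonoid.closure_le.2 ?_) ?_
  · rintro x (hx | hx)
    · exact le_differences _ _ (AddSubmonoid.subset_closure hx)
    · exact ⟨-x, AddSubmonoid.subset_closure hx, by simp⟩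
  · rintro d ⟨q, hq, hd⟩
    have h1 : -q ∈ AddSubmonoid.closure (I ∪ -J) := by
      rw [← AddSubmonoid.mem_neg, ← AddSubmonoid.closure_neg, Set.union_neg, neg_neg]
      exact AddSubmonoid.closure_mono Set.subset_union_right hq
    have h2 := add_mem (AddSubmonoid.closure_mono (t := I ∪ -J) Set.subset_union_left hd) h1
    simpa using h2

/-- If `n • m + q ∈ Q` with `q ∈ F`, then `n • (m + q) = (n • m + q) + (n - 1) • q` lies in `Q`, so
`m + q ∈ Q` with the same denominator `q`. -/
theorem IsSubmonoidFace.differences_saturated {A : Type u} [AddCommGroup A] {Q F : AddSubmonoid A}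
    (hF : IsSubmonoidFace F Q)
    (hsat : ∀ (m : A) (n : ℕ), 0 < n → n • m ∈ Q → m ∈ Q) (m : A) (n : ℕ) (hn : 0 < n)
    (h : n • m ∈ differences Q F) : m ∈ differences Q F := by
  obtain ⟨q, hq, hd⟩ := h
  refine ⟨q, hq, hsat _ n hn ?_⟩
  obtain ⟨k, rfl⟩ := Nat.exists_eq_succ_of_ne_zero hn.ne'
  have : (k + 1) • (m + q) = ((k + 1) • m + q) + k • q := by
    rw [smul_add, succ_nsmul q k]; abel
  rw [Nat.succ_eq_add_one, this]
  exact add_mem hd (nsmul_mem (hF.le hq) k)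

/-- As `Q - F` contains both `F` and `-F`, being non-negative on it forces vanishing on `F`. This is
how localization of monoids becomes passage to a face of the cone. -/
theorem mem_dualCone_differences {Q F : AddSubmonoid (N →ₗ[ℤ] ℤ)} (hF : F ≤ Q) {v : ℝ ⊗[ℤ] N} :
    v ∈ dualCone (differences Q F : Set (N →ₗ[ℤ] ℤ)) ↔
      v ∈ dualCone (Q : Set (N →ₗ[ℤ] ℤ)) ∧ ∀ m ∈ F, evalReal m v = 0 := by
  constructor
  · refine fun h => ⟨dualCone_anti (le_differences Q F) h, fun m hm => le_antisymm ?_ ?_⟩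
    · have := h (-m) ⟨m, hm, by simp⟩
      rwa [evalReal_neg, neg_nonneg] at this
    · exact h m (le_differences Q F (hF hm))
  · rintro ⟨h1, h2⟩ d ⟨q, hq, hd⟩
    have := h1 _ hd
    rwa [evalReal_add, h2 q hq, add_zero] at this

theorem isFaceOf_dualCone_differences {Q F : AddSubmonoid (N →ₗ[ℤ] ℤ)} (hF : F ≤ Q) :
    (dualCone (differences Q F : Set (N →ₗ[ℤ] ℤ))).IsFaceOf (dualCone (Q : Set (N →ₗ[ℤ] ℤ))) where
  le := dualCone_anti (le_differences Q F)
  mem_of_smul_add_mem := by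
    intro x y a hx hy ha h
    rw [mem_dualCone_differences hF] at h ⊢
    refine ⟨hx, fun m hm => ?_⟩
    have h0 := h.2 m hm
    rw [map_add, map_smul, smul_eq_mul] at h0
    have h1 := hx m (hF hm)
    have h2 := hy m (hF hm)
    have : a * evalReal m x = 0 := by
      have := mul_nonneg ha.le h1
      linarith
    exact (mul_eq_zero.1 this).resolve_left ha.ne'

/-- The functionals of `Q` vanishing on `τ`. -/
def vanishing (Q : AddSubmonoid (N →ₗ[ℤ] ℤ)) (τ : PointedCone ℝ (ℝ ⊗[ℤ] N)) :
    AddSubmonoid (N →ₗ[ℤ] ℤ) where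
  carrier := {m | m ∈ Q ∧ ∀ v ∈ τ, evalReal m v = 0}
  zero_mem' := ⟨zero_mem _, fun v _ => evalReal_zero v⟩
  add_mem' h h' := ⟨add_mem h.1 h'.1, fun v hv => by
    rw [evalReal_add, h.2 v hv, h'.2 v hv, add_zero]⟩

theorem vanishing_isSubmonoidFace (Q : AddSubmonoid (N →ₗ[ℤ] ℤ)) {τ : PointedCone ℝ (ℝ ⊗[ℤ] N)}
    (hτ : τ ≤ dualCone (Q : Set (N →ₗ[ℤ] ℤ))) : IsSubmonoidFace (vanishing Q τ) Q where
  le _ h := h.1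
  mem_of_add_mem {p q} hp hq h := ⟨hp, fun v hv => by
    have h0 := h.2 v hv
    rw [evalReal_add] at h0
    have h1 := hτ hv p hp
    have h2 := hτ hv q hq
    linarith⟩

/-- A face of a rational cone is generated by the generators it contains. -/
theorem IsFaceOf.eq_hull {S : Set N} {τ : PointedCone ℝ (ℝ ⊗[ℤ] N)}
    (hτ : τ.IsFaceOf (PointedCone.hull ℝ (toReal '' S))) :
    τ = PointedCone.hull ℝ (toReal '' {s ∈ S | toReal s ∈ τ}) := by
  refine le_antisymm (fun v hv => ?_) (Submodule.span_le.2 ?_)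
  · have key : ∀ v ∈ PointedCone.hull ℝ (toReal '' S), v ∈ τ →
        v ∈ PointedCone.hull ℝ (toReal '' {s ∈ S | toReal s ∈ τ}) := by
      intro v hv
      induction hv using Submodule.span_induction with
      | mem x h =>
        obtain ⟨s, hs, rfl⟩ := h
        exact fun h => PointedCone.subset_hull ⟨s, ⟨hs, h⟩, rfl⟩
      | zero => exact fun _ => zero_mem _
      | add x y hx hy ihx ihy =>
        exact fun h => add_mem (ihx (hτ.mem_of_add_mem_left hx hy h))
          (ihy (hτ.mem_of_add_mem_right hx hy h))
      | smul c x hx ih =>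
        intro h
        rcases c.2.eq_or_lt with h0 | h0
        · have : c = 0 := Subtype.ext h0.symm
          rw [this, zero_smul]
          exact zero_mem _
        · exact Submodule.smul_mem _ c (ih ((PointedCone.smul_mem_iff τ h0).1 h))
    exact key v (hτ.le hv) hv
  · rintro _ ⟨s, hs, rfl⟩
    exact hs.2

theorem IsRational.of_isFaceOf {σ τ : PointedCone ℝ (ℝ ⊗[ℤ] N)} (hσ : IsRational σ)
    (hτ : τ.IsFaceOf σ) : IsRational τ := by
  classical
  obtain ⟨S, rfl⟩ := hσ
  refine ⟨S.filter fun s => toReal s ∈ τ, ?_⟩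
  have := IsFaceOf.eq_hull hτ
  simpa using this

theorem IsSharp.mono {σ τ : PointedCone ℝ (ℝ ⊗[ℤ] N)} (hσ : IsSharp σ) (h : τ ≤ σ) : IsSharp τ :=
  fun v hv hv' => hσ v (h hv) (h hv')

/-- A functional that is non-negative on a cone and vanishes at an interior point vanishes on the
cone. -/
theorem evalReal_eq_zero_of_mem_interior {τ : PointedCone ℝ (ℝ ⊗[ℤ] N)} {x : ℝ ⊗[ℤ] N}
    (hx : x ∈ interior τ) {m : N →ₗ[ℤ] ℤ} (hm : ∀ v ∈ τ, 0 ≤ evalReal m v)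
    (hmx : evalReal m x = 0) : ∀ v ∈ τ, evalReal m v = 0 := by
  -- Since `m ≥ 0` on `τ`, this is the zero locus of `m` in `τ`. It is a face through the interior
  -- point `x`, hence all of `τ`.
  let ρ : PointedCone ℝ (ℝ ⊗[ℤ] N) := τ ⊓ dualCone {-m}
  have hρ : ρ.IsFaceOf τ :=
    { le := inf_le_left
      mem_of_smul_add_mem := by
        intro x y a hx hy ha h
        refine ⟨hx, ?_⟩
        have h0 := h.2 (-m) rfl
        have h1 := hm x hx
        have h2 := hm y hy
        rintro _ rfl
        rw [evalReal_neg, map_add, map_smul, smul_eq_mul] at h0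
        rw [evalReal_neg, neg_nonneg]
        by_contra hc
        have := mul_pos ha (not_le.1 hc)
        linarith }
  have hρτ : ρ = τ := by
    by_contra hne
    refine hx.2 ρ hρ hne ⟨hx.1, ?_⟩
    rintro _ rfl
    rw [evalReal_neg, hmx, neg_zero]
  intro w hw
  have h1 := hm w hw
  have h2 := (hρτ.ge hw).2 (-m) rfl
  rw [evalReal_neg] at h2
  linarith

/-- A rational cone contains a lattice point that lies in no proper face. -/
theorem IsRational.exists_toReal_mem_interior {σ : PointedCone ℝ (ℝ ⊗[ℤ] N)} (hσ : IsRational σ) :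
    ∃ n : N, toReal n ∈ interior σ := by
  obtain ⟨S, rfl⟩ := hσ
  have hS : ∀ s ∈ S, toReal s ∈ PointedCone.hull ℝ (toReal '' (S : Set N)) := fun s hs =>
    PointedCone.subset_hull ⟨s, hs, rfl⟩
  -- A face containing the sum of the generators contains each of them, so it is the whole cone.
  refine ⟨∑ s ∈ S, s, ?_, fun τ hτ hne hmem => hne (le_antisymm hτ.le (Submodule.span_le.2 ?_))⟩
  · rw [toReal_sum]
    exact sum_mem hS
  · rintro _ ⟨s, hs, rfl⟩
    rw [toReal_sum, ← Finset.sum_coe_sort S (fun s => toReal s)] at hmem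
    exact hτ.mem_of_sum_mem (f := fun i : S => toReal i.1) (fun i => hS i.1 i.2) hmem ⟨s, hs⟩

/-- If `v` and `-v` lie in the cone, every element of `Q` vanishes at `v`, and so does every
functional, being a difference of two of them. -/
theorem isSharp_dualCone [Module.Free ℤ N] {Q : AddSubmonoid (N →ₗ[ℤ] ℤ)}
    (hgen : ∀ d : N →ₗ[ℤ] ℤ, ∃ p ∈ Q, ∃ q ∈ Q, d = p - q) :
    IsSharp (dualCone (Q : Set (N →ₗ[ℤ] ℤ))) := by
  intro v hv hv'
  have h0 : ∀ p ∈ Q, evalReal p v = 0 := fun p hp => by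
    have h1 := hv p hp
    have h2 := hv' p hp
    rw [map_neg] at h2
    linarith
  refine eq_zero_of_evalReal v fun d => ?_
  obtain ⟨p, hp, q, hq, rfl⟩ := hgen d
  rw [evalReal_sub, h0 p hp, h0 q hq, sub_zero]

variable [Module.Free ℤ N] [Module.Finite ℤ N]

theorem isRational_dualCone_of_fg {Q : AddSubmonoid (N →ₗ[ℤ] ℤ)} (hQ : Q.FG) :
    IsRational (dualCone (Q : Set (N →ₗ[ℤ] ℤ))) := by
  obtain ⟨I, rfl, hI⟩ := (AddSubmonoid.fg_iff Q).1 hQ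
  rw [dualCone_closure]
  exact isRational_dualCone hI

/-- Every face of the dual cone of `Q` is cut out by the functionals of `Q` vanishing on it. -/
theorem eq_dualCone_differences {Q : AddSubmonoid (N →ₗ[ℤ] ℤ)} (hQ : Q.FG)
    {τ : PointedCone ℝ (ℝ ⊗[ℤ] N)} (hτ : τ.IsFaceOf (dualCone (Q : Set (N →ₗ[ℤ] ℤ)))) :
    τ = dualCone (differences Q (vanishing Q τ) : Set (N →ₗ[ℤ] ℤ)) := by
  have hF := vanishing_isSubmonoidFace Q hτ.le
  refine le_antisymm (fun v hv => ?_) fun v hv => ?_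
  · rw [mem_dualCone_differences hF.le]
    exact ⟨hτ.le hv, fun m hm => hm.2 v hv⟩
  · obtain ⟨hvσ, hv⟩ := (mem_dualCone_differences hF.le).1 hv
    -- Let `n` be an interior lattice point of `τ`. A generator of `Q` that vanishes at `n` vanishes
    -- on `τ` and hence at `v`; the others are at least `1` at `n`. So `k • n - v` lies in the big
    -- cone for large `k`, and since `v + (k • n - v) = k • n` is in the face `τ`, so is `v`.
    obtain ⟨n, hn⟩ := ((isRational_dualCone_of_fg hQ).of_isFaceOf hτ).exists_toReal_mem_interior
    obtain ⟨I, rfl, hI⟩ := (AddSubmonoid.fg_iff Q).1 hQ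
    have hIQ : I ⊆ AddSubmonoid.closure I := AddSubmonoid.subset_closure
    have hvan : ∀ m ∈ I, m n = 0 → evalReal m v = 0 := by
      intro m hm hmn
      refine hv m ⟨hIQ hm, ?_⟩
      exact evalReal_eq_zero_of_mem_interior hn (fun v hv => hτ.le hv m (hIQ hm))
        (by rw [evalReal_toReal, hmn, Int.cast_zero])
    obtain ⟨k, hk⟩ : ∃ k : ℕ, ∀ m ∈ I, evalReal m v ≤ k := by
      obtain ⟨b, hb⟩ := (hI.image fun m => evalReal m v).bddAbove
      obtain ⟨k, hk⟩ := exists_nat_ge b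
      exact ⟨k, fun m hm => (hb ⟨m, hm, rfl⟩).trans hk⟩
    have hmem : (k : ℝ) • toReal n - v ∈ dualCone (AddSubmonoid.closure I : Set (N →ₗ[ℤ] ℤ)) := by
      rw [dualCone_closure]
      intro m hm
      rw [map_sub, map_smul, evalReal_toReal, smul_eq_mul, sub_nonneg]
      have h0 : 0 ≤ m n := by
        have := hτ.le hn.1 m (hIQ hm)
        rwa [evalReal_toReal, Int.cast_nonneg_iff] at this
      rcases h0.eq_or_lt with h | h
      · rw [hvan m hm h.symm, ← h]
        simp
      · refine (hk m hm).trans (le_mul_of_one_le_right (by positivity) ?_)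
        exact_mod_cast h
    refine hτ.mem_of_add_mem_left hvσ hmem ?_
    rw [add_sub_cancel]
    exact PointedCone.smul_mem _ (by positivity) hn.1

variable {Q F G : AddSubmonoid (N →ₗ[ℤ] ℤ)}

theorem dualMonoid_dualCone_differences (hQ : Q.FG)
    (hsat : ∀ (m : N →ₗ[ℤ] ℤ) (n : ℕ), 0 < n → n • m ∈ Q → m ∈ Q) (hF : IsSubmonoidFace F Q) :
    dualMonoid (dualCone (differences Q F : Set (N →ₗ[ℤ] ℤ))) = differences Q F :=
  dualMonoid_dualCone (hF.differences_fg hQ) (hF.differences_saturated hsat)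

/-- If `m ∈ Q` vanishes on the cone of `F`, then `-m` lies in the dual monoid of that cone, which is
`Q - F`. So `q - m ∈ Q` for some `q ∈ F`, and `m + (q - m) = q` puts the summand `m` in the face
`F`. Thus `F` is recovered from its cone. -/
theorem vanishing_dualCone_differences (hQ : Q.FG)
    (hsat : ∀ (m : N →ₗ[ℤ] ℤ) (n : ℕ), 0 < n → n • m ∈ Q → m ∈ Q) (hF : IsSubmonoidFace F Q) :
    vanishing Q (dualCone (differences Q F : Set (N →ₗ[ℤ] ℤ))) = F := by
  refine le_antisymm ?_ fun m hm =>
    ⟨hF.le hm, fun v hv => ((mem_dualCone_differences hF.le).1 hv).2 m hm⟩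
  rintro m ⟨hm, h⟩
  have : -m ∈ differences Q F := by
    rw [← dualMonoid_dualCone_differences hQ hsat hF]
    intro v hv
    rw [evalReal_neg, h v hv, neg_zero]
  obtain ⟨q, hq, hmq⟩ := this
  refine hF.mem_of_add_mem hm hmq ?_
  simpa using hq

theorem dualCone_differences_le_iff (hQ : Q.FG)
    (hsat : ∀ (m : N →ₗ[ℤ] ℤ) (n : ℕ), 0 < n → n • m ∈ Q → m ∈ Q) (hF : IsSubmonoidFace F Q)
    (hG : IsSubmonoidFace G Q) :
    dualCone (differences Q G : Set (N →ₗ[ℤ] ℤ)) ≤ dualCone (differences Q F : Set (N →ₗ[ℤ] ℤ)) ↔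
      F ≤ G := by
  constructor
  · intro h
    rw [← vanishing_dualCone_differences hQ hsat hF, ← vanishing_dualCone_differences hQ hsat hG]
    exact fun m hm => ⟨hm.1, fun v hv => hm.2 v (h hv)⟩
  · rintro h
    refine dualCone_anti ?_
    rintro d ⟨q, hq, hd⟩
    exact ⟨q, h hq, hd⟩

theorem mem_of_mem_interior (hQ : Q.FG)
    (hsat : ∀ (m : N →ₗ[ℤ] ℤ) (n : ℕ), 0 < n → n • m ∈ Q → m ∈ Q) (hF : IsSubmonoidFace F Q) {n : N}
    (hn : toReal n ∈ interior (dualCone (differences Q F : Set (N →ₗ[ℤ] ℤ)))) {m : N →ₗ[ℤ] ℤ}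
    (hm : m ∈ Q) (hmn : m n = 0) : m ∈ F := by
  rw [← vanishing_dualCone_differences hQ hsat hF]
  refine ⟨hm, evalReal_eq_zero_of_mem_interior hn
    (fun v hv => ((mem_dualCone_differences hF.le).1 hv).1 m hm) ?_⟩
  rw [evalReal_toReal, hmn, Int.cast_zero]

/-- A proper face of a rational cone is cut out by a functional that is not identically zero. -/
theorem IsRational.exists_mem_dualMonoid_of_isFaceOf {σ τ : PointedCone ℝ (ℝ ⊗[ℤ] N)}
    (hσ : IsRational σ) (hτ : τ.IsFaceOf σ) (hne : τ ≠ σ) :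
    ∃ m ∈ dualMonoid σ, (∀ v ∈ τ, evalReal m v = 0) ∧ ∃ v ∈ σ, evalReal m v ≠ 0 := by
  by_contra! h
  have hd := hσ.dualCone_dualMonoid
  have hτ' : τ.IsFaceOf (dualCone (dualMonoid σ : Set (N →ₗ[ℤ] ℤ))) := by rwa [hd]
  refine hne (le_antisymm hτ.le fun v hv => ?_)
  rw [eq_dualCone_differences hσ.dualMonoid_fg hτ',
    mem_dualCone_differences (vanishing_isSubmonoidFace _ hτ'.le).le, hd]
  exact ⟨hv, fun m hm => h m hm.1 hm.2 v hv⟩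

end Faces

end LatticeCone

end

noncomputable section

open CategoryTheory TopologicalSpace Opposite AlgebraicGeometry

/-! ### Stalks, morphisms and open immersions of locally monoidal spaces -/

namespace LMS

variable {X Y Z : LMS.{u}}

/-- The map of points underlying a morphism. -/
def Hom.pt (f : X ⟶ Y) : X.Pt → Y.Pt := f.toHom.hom.base

theorem Hom.continuous_pt (f : X ⟶ Y) : Continuous (Hom.pt f) := f.toHom.hom.base.hom.continuous

/-- The germ of a section at a point. -/
def germ (X : LMS.{u}) (U : Opens X.Pt) (x : X.Pt) (hx : x ∈ U) :
    X.toSheafedSpace.presheaf.obj (op U) →+ X.stalk x :=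
  (X.toSheafedSpace.presheaf.germ U x hx).hom

theorem exists_germ_eq (x : X.Pt) (t : X.stalk x) : ∃ U hx s, X.germ U x hx s = t :=
  TopCat.Presheaf.exists_germ_eq _ t

theorem exists_germ_eq₂ (x : X.Pt) (t t' : X.stalk x) :
    ∃ U hx s s', X.germ U x hx s = t ∧ X.germ U x hx s' = t' := by
  obtain ⟨U, hU, s, rfl⟩ := exists_germ_eq x t
  obtain ⟨V, hV, s', rfl⟩ := exists_germ_eq x t'
  exact ⟨U ⊓ V, ⟨hU, hV⟩, X.toSheafedSpace.presheaf.map (Opens.infLELeft U V).op s,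
    X.toSheafedSpace.presheaf.map (Opens.infLERight U V).op s',
    TopCat.Presheaf.germ_res_apply X.toSheafedSpace.presheaf _ _ _ _,
    TopCat.Presheaf.germ_res_apply X.toSheafedSpace.presheaf _ _ _ _⟩

theorem exists_map_eq_of_germ_eq {x : X.Pt} {U V : Opens X.Pt} {hU : x ∈ U} {hV : x ∈ V} {s t}
    (h : X.germ U x hU s = X.germ V x hV t) :
    ∃ (W : Opens X.Pt) (_ : x ∈ W) (i : W ⟶ U) (j : W ⟶ V),
      X.toSheafedSpace.presheaf.map i.op s = X.toSheafedSpace.presheaf.map j.op t :=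
  TopCat.Presheaf.germ_eq X.toSheafedSpace.presheaf x hU hV s t h

/-- The map of stalks attached to a specialization. -/
def generalize (X : LMS.{u}) {x y : X.Pt} (h : x ⤳ y) : X.stalk y →+ X.stalk x :=
  (X.toSheafedSpace.presheaf.stalkSpecializes h).hom

theorem generalize_germ {x y : X.Pt} (h : x ⤳ y) (U : Opens X.Pt) (hy : y ∈ U) (s) :
    X.generalize h (X.germ U y hy s) = X.germ U x (h.mem_open U.isOpen hy) s :=
  congrArg (fun g => g.hom s) (TopCat.Presheaf.germ_stalkSpecializes X.toSheafedSpace.presheaf hy h)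

theorem generalize_refl {x : X.Pt} (h : x ⤳ x) (t : X.stalk x) : X.generalize h t = t :=
  congrArg (fun g => g.hom t) (TopCat.Presheaf.stalkSpecializes_refl X.toSheafedSpace.presheaf x)

theorem generalize_generalize {x y z : X.Pt} (h : x ⤳ y) (h' : y ⤳ z) (t : X.stalk z) :
    X.generalize h (X.generalize h' t) = X.generalize (h.trans h') t :=
  congrArg (fun g => g.hom t)
    (TopCat.Presheaf.stalkSpecializes_comp X.toSheafedSpace.presheaf h h')

/-- The map of stalks of a morphism, as a homomorphism of monoids. -/
def Hom.onStalk (f : X ⟶ Y) (x : X.Pt) : Y.stalk (Hom.pt f x) →+ X.stalk x :=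
  (f.toHom.hom.stalkMap x).hom

theorem Hom.isLocal_onStalk (f : X ⟶ Y) (x : X.Pt) : (Hom.onStalk f x).IsLocal := f.isLocal x

theorem Hom.onStalk_germ (f : X ⟶ Y) (U : Opens Y.Pt) (x : X.Pt) (hx : Hom.pt f x ∈ U) (s) :
    Hom.onStalk f x (Y.germ U (Hom.pt f x) hx s) =
      X.germ ((Opens.map f.toHom.hom.base).obj U) x hx (f.toHom.hom.c.app (op U) s) :=
  congrArg (fun g => g.hom s) (PresheafedSpace.stalkMap_germ f.toHom.hom U x hx)

theorem Hom.onStalk_generalize (f : X ⟶ Y) {x y : X.Pt} (h : x ⤳ y) (t : Y.stalk (Hom.pt f y)) :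
    Hom.onStalk f x (Y.generalize (h.map (Hom.continuous_pt f)) t) =
      X.generalize h (Hom.onStalk f y t) :=
  congrArg (fun g => g.hom t) (PresheafedSpace.stalkMap.stalkSpecializes_stalkMap f.toHom.hom h)

theorem Hom.pt_comp (f : X ⟶ Y) (g : Y ⟶ Z) (x : X.Pt) :
    Hom.pt (f ≫ g) x = Hom.pt g (Hom.pt f x) := rfl

theorem Hom.onStalk_comp (f : X ⟶ Y) (g : Y ⟶ Z) (x : X.Pt) (t : Z.stalk (Hom.pt g (Hom.pt f x))) :
    Hom.onStalk (f ≫ g) x t = Hom.onStalk f x (Hom.onStalk g (Hom.pt f x) t) :=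
  congrArg (fun g => g.hom t) (PresheafedSpace.stalkMap.comp f.toHom.hom g.toHom.hom x)

/-- The two stalk maps start from stalks at points that are only propositionally equal.
Generalization along the trivial specialization serves as the transport between them, which avoids
casts. -/
theorem hom_ext {f g : X ⟶ Y} (h : ∀ x, Hom.pt f x = Hom.pt g x)
    (h' : ∀ x t, Hom.onStalk f x t =
      Hom.onStalk g x (Y.generalize (specializes_of_eq (h x).symm) t)) : f = g := by
  refine Hom.ext (SheafedSpace.hom_stalk_ext _ _ (TopCat.hom_ext (ContinuousMap.ext h)) fun x => ?_)
  refine AddCommMonCat.hom_ext (AddMonoidHom.ext fun t => ?_)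
  exact h' x t

theorem onStalk_eq_of_eq {f g : X ⟶ Y} (e : f = g) (x : X.Pt) (h : Hom.pt g x ⤳ Hom.pt f x) (t) :
    Hom.onStalk f x t = Hom.onStalk g x (Y.generalize h t) := by
  subst e
  rw [generalize_refl]

/-- An open immersion of locally monoidal spaces. -/
def IsOpenImmersion (f : X ⟶ Y) : Prop := SheafedSpace.IsOpenImmersion f.toHom

theorem IsOpenImmersion.isOpenEmbedding {f : X ⟶ Y} (hf : IsOpenImmersion f) :
    Topology.IsOpenEmbedding (Hom.pt f) :=
  PresheafedSpace.IsOpenImmersion.base_open (f := f.toHom.hom) (self := hf)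

theorem IsOpenImmersion.bijective_onStalk {f : X ⟶ Y} (hf : IsOpenImmersion f) (x : X.Pt) :
    Function.Bijective (Hom.onStalk f x) := by
  have h1 : PresheafedSpace.IsOpenImmersion f.toHom.hom := hf
  have := ConcreteCategory.bijective_of_isIso (f.toHom.hom.stalkMap x)
  exact this

theorem IsOpenImmersion.of_bijective {f : X ⟶ Y} (hf : Topology.IsOpenEmbedding (Hom.pt f))
    (h : ∀ x, Function.Bijective (Hom.onStalk f x)) : IsOpenImmersion f := by
  have : ∀ x, IsIso (f.toHom.hom.stalkMap x) := fun x => by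
    have := h x
    rw [ConcreteCategory.isIso_iff_bijective]
    exact this
  exact SheafedSpace.IsOpenImmersion.of_stalk_iso f.toHom hf

theorem isLocal_of_bijective {M M' : Type*} [AddCommMonoid M] [AddCommMonoid M'] {h : M →+ M'}
    (hh : Function.Bijective h) : h.IsLocal := by
  intro q hq
  have := hq.map (AddEquiv.ofBijective h hh).symm
  rwa [show h q = AddEquiv.ofBijective h hh q from rfl, AddEquiv.symm_apply_apply] at this

/-- An isomorphism of the underlying monoidal spaces is an isomorphism. -/
def isoOfSheafedSpaceIso (e : X.toSheafedSpace ≅ Y.toSheafedSpace) : X ≅ Y where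
  hom :=
    { toHom := e.hom
      isLocal x := isLocal_of_bijective (ConcreteCategory.bijective_of_isIso (e.hom.hom.stalkMap x)) }
  inv :=
    { toHom := e.inv
      isLocal x := isLocal_of_bijective (ConcreteCategory.bijective_of_isIso (e.inv.hom.stalkMap x)) }
  hom_inv_id := Hom.ext e.hom_inv_id
  inv_hom_id := Hom.ext e.inv_hom_id

/-- The isomorphism of monoidal spaces underlying an isomorphism. -/
def sheafedSpaceIso (e : X ≅ Y) : X.toSheafedSpace ≅ Y.toSheafedSpace where
  hom := e.hom.toHom
  inv := e.inv.toHom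
  hom_inv_id := congrArg Hom.toHom e.hom_inv_id
  inv_hom_id := congrArg Hom.toHom e.inv_hom_id

theorem IsOpenImmersion.of_iso (e : X ≅ Y) : IsOpenImmersion e.hom :=
  PresheafedSpace.IsOpenImmersion.ofIso
    ((SheafedSpace.forgetToPresheafedSpace).mapIso (sheafedSpaceIso e))

theorem IsOpenImmersion.comp {f : X ⟶ Y} {g : Y ⟶ Z} (hf : IsOpenImmersion f)
    (hg : IsOpenImmersion g) : IsOpenImmersion (f ≫ g) := by
  have h1 : PresheafedSpace.IsOpenImmersion f.toHom.hom := hf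
  have h2 : PresheafedSpace.IsOpenImmersion g.toHom.hom := hg
  exact PresheafedSpace.IsOpenImmersion.comp f.toHom.hom g.toHom.hom

/-- A surjective open immersion is an isomorphism. -/
theorem IsOpenImmersion.nonempty_iso {f : X ⟶ Y} (hf : IsOpenImmersion f)
    (hs : Function.Surjective (Hom.pt f)) : Nonempty (X ≅ Y) := by
  have h1 : SheafedSpace.IsOpenImmersion f.toHom := hf
  have h2 : Epi f.toHom.hom.base := (TopCat.epi_iff_surjective _).2 hs
  have : IsIso f.toHom := SheafedSpace.IsOpenImmersion.to_iso f.toHom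
  exact ⟨isoOfSheafedSpaceIso (asIso f.toHom)⟩

/-- The inclusion of an open subspace. -/
def ofRestrict (X : LMS.{u}) (U : Opens X.Pt) : X.restrict U ⟶ X where
  toHom := X.toSheafedSpace.ofRestrict U.isOpenEmbedding
  isLocal x := by
    have : IsIso ((X.toSheafedSpace.ofRestrict U.isOpenEmbedding).hom.stalkMap x) :=
      PresheafedSpace.ofRestrict_stalkMap_isIso X.toSheafedSpace.toPresheafedSpace
        U.isOpenEmbedding x
    exact isLocal_of_bijective (ConcreteCategory.bijective_of_isIso
      ((X.toSheafedSpace.ofRestrict U.isOpenEmbedding).hom.stalkMap x))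

theorem isOpenImmersion_ofRestrict (X : LMS.{u}) (U : Opens X.Pt) :
    IsOpenImmersion (X.ofRestrict U) :=
  PresheafedSpace.IsOpenImmersion.ofRestrict _ U.isOpenEmbedding

/-- A point has an open neighbourhood isomorphic to `Y` if and only if it lies in the image of an
open immersion from `Y`. -/
theorem exists_restrict_iso_iff {x : X.Pt} :
    (∃ U : Opens X.Pt, x ∈ U ∧ Nonempty (X.restrict U ≅ Y)) ↔
      ∃ j : Y ⟶ X, IsOpenImmersion j ∧ x ∈ Set.range (Hom.pt j) := by
  constructor
  · rintro ⟨U, hx, ⟨e⟩⟩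
    refine ⟨e.inv ≫ X.ofRestrict U,
      (IsOpenImmersion.of_iso e.symm).comp (isOpenImmersion_ofRestrict X U),
      Hom.pt e.hom ⟨x, hx⟩, ?_⟩
    have h := congrArg (fun f : X.restrict U ⟶ X.restrict U => (Hom.pt f (⟨x, hx⟩ : U) : U))
      e.hom_inv_id
    exact congrArg Subtype.val h
  · rintro ⟨j, hj, hx⟩
    refine ⟨⟨Set.range (Hom.pt j), hj.isOpenEmbedding.isOpen_range⟩, hx, ?_⟩
    have h1 : PresheafedSpace.IsOpenImmersion j.toHom.hom := hj
    have h2 : PresheafedSpace.IsOpenImmersion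
        (X.ofRestrict ⟨Set.range (Hom.pt j), hj.isOpenEmbedding.isOpen_range⟩).toHom.hom :=
      isOpenImmersion_ofRestrict X _
    refine ⟨isoOfSheafedSpaceIso (SheafedSpace.isoMk
      (PresheafedSpace.IsOpenImmersion.isoOfRangeEq
        (X.ofRestrict ⟨Set.range (Hom.pt j), hj.isOpenEmbedding.isOpen_range⟩).toHom.hom
        j.toHom.hom ?_))⟩
    exact Subtype.range_coe

end LMS

/-! ### Stalks of sheaves of functions -/

namespace AddLocalPredicate

open LMS

variable {X : TopCat.{u}} {T : X → Type u} [∀ x, AddCommMonoid (T x)]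

/-- A local predicate for which the germ of a section is determined by its value at the point, and
every value is attained. -/
structure IsGermDetermined (A : AddLocalPredicate T) : Prop where
  exists_section : ∀ (x : X) (t : T x), ∃ (U : Opens X) (hx : x ∈ U) (s : A.sections U),
    s.1 ⟨x, hx⟩ = t
  eq_near : ∀ {U : Opens X} (s t : A.sections U) (x : U), s.1 x = t.1 x →
    ∃ (V : Opens X) (_ : x.1 ∈ V) (i : V ⟶ U), ∀ y : V, s.1 ⟨y.1, i.le y.2⟩ = t.1 ⟨y.1, i.le y.2⟩

variable {A : AddLocalPredicate T}

theorem IsGermDetermined.germ_eq_iff (hA : A.IsGermDetermined) {x : X} {U V : Opens X} (hU : x ∈ U)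
    (hV : x ∈ V) (s : A.sections U) (t : A.sections V) :
    A.toLMS.germ U x hU s = A.toLMS.germ V x hV t ↔ s.1 ⟨x, hU⟩ = t.1 ⟨x, hV⟩ := by
  constructor
  · intro h
    obtain ⟨W, hW, i, j, e⟩ := exists_map_eq_of_germ_eq h
    exact congrFun (congrArg Subtype.val e) ⟨x, hW⟩
  · intro h
    let s' : A.sections (U ⊓ V) := A.presheaf.map (Opens.infLELeft U V).op s
    let t' : A.sections (U ⊓ V) := A.presheaf.map (Opens.infLERight U V).op t
    obtain ⟨W, hW, i, e⟩ := hA.eq_near s' t' ⟨x, hU, hV⟩ h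
    refine TopCat.Presheaf.germ_ext A.presheaf W hW (i ≫ Opens.infLELeft U V)
      (i ≫ Opens.infLERight U V) ?_
    exact Subtype.ext (funext e)

theorem IsGermDetermined.exists_value (hA : A.IsGermDetermined) {x : X} (t : A.toLMS.stalk x) :
    ∃ v : T x, ∀ (U : Opens X) (hx : x ∈ U) (s : A.sections U),
      A.toLMS.germ U x hx s = t → s.1 ⟨x, hx⟩ = v := by
  obtain ⟨U, hx, s, rfl⟩ := exists_germ_eq (X := A.toLMS) x t
  exact ⟨(show A.sections U from s).1 ⟨x, hx⟩, fun V hV s' h => (hA.germ_eq_iff hV hx s' s).1 h⟩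

/-- Evaluation of a germ at the point. -/
def IsGermDetermined.value (hA : A.IsGermDetermined) {x : X} (t : A.toLMS.stalk x) : T x :=
  (hA.exists_value t).choose

theorem IsGermDetermined.value_germ (hA : A.IsGermDetermined) {U : Opens X} {x : X}
    (hx : x ∈ U) (s : A.sections U) : hA.value (A.toLMS.germ U x hx s) = s.1 ⟨x, hx⟩ :=
  ((hA.exists_value _).choose_spec U hx s rfl).symm

theorem IsGermDetermined.value_bijective (hA : A.IsGermDetermined) (x : X) :
    Function.Bijective (hA.value (x := x)) := by
  constructor
  · intro t t' h
    obtain ⟨U, hU, s, rfl⟩ := exists_germ_eq (X := A.toLMS) x t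
    obtain ⟨V, hV, s', rfl⟩ := exists_germ_eq (X := A.toLMS) x t'
    rw [hA.value_germ hU s, hA.value_germ hV s'] at h
    exact (hA.germ_eq_iff hU hV s s').2 h
  · intro t
    obtain ⟨U, hx, s, rfl⟩ := hA.exists_section x t
    exact ⟨A.toLMS.germ U x hx s, hA.value_germ hx s⟩

/-- Evaluation at a point identifies the stalk with the monoid of values. -/
def IsGermDetermined.stalkEquiv (hA : A.IsGermDetermined) (x : X) : A.toLMS.stalk x ≃+ T x :=
  AddEquiv.mk' (Equiv.ofBijective _ (hA.value_bijective x)) fun t t' => by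
    obtain ⟨U, hU, s, s', rfl, rfl⟩ := exists_germ_eq₂ (X := A.toLMS) x t t'
    rw [← map_add]
    exact (hA.value_germ hU _).trans (congrArg₂ (· + ·) (hA.value_germ hU s)
      (hA.value_germ hU s')).symm

theorem IsGermDetermined.stalkEquiv_germ (hA : A.IsGermDetermined) {U : Opens X} {x : X}
    (hx : x ∈ U) (s : A.sections U) : hA.stalkEquiv x (A.toLMS.germ U x hx s) = s.1 ⟨x, hx⟩ :=
  hA.value_germ hx s

/-- Equality of values at `y` already makes `t` the germ of `s`, and generalizing a germ to `x` is
evaluating the same section at `x`. -/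
theorem IsGermDetermined.stalkEquiv_generalize (hA : A.IsGermDetermined) {U : Opens X} {x y : X}
    (h : x ⤳ y) (hy : y ∈ U) (s : A.sections U) {t : A.toLMS.stalk y}
    (ht : hA.stalkEquiv y t = s.1 ⟨y, hy⟩) :
    hA.stalkEquiv x (A.toLMS.generalize h t) = s.1 ⟨x, h.mem_open U.isOpen hy⟩ := by
  rw [← hA.stalkEquiv_germ hy s] at ht
  rw [(hA.stalkEquiv y).injective ht]
  exact (congrArg _ (generalize_germ (X := A.toLMS) h U hy s)).trans (hA.stalkEquiv_germ _ s)

variable {Y : LMS.{u}}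

/-- A continuous map and maps on stalks taking germs of sections to sections define a morphism of
monoidal spaces. -/
def homOfStalksAux (A : AddLocalPredicate T) (φ : C(X, Y.Pt)) (f : ∀ a, Y.stalk (φ a) →+ T a)
    (hs : ∀ (U : Opens Y.Pt) (s), A.pred (U := U.comap φ) fun a => f a (Y.germ U (φ a) a.2 s)) :
    A.toLMS.toSheafedSpace ⟶ Y.toSheafedSpace :=
  InducedCategory.homMk
    { base := TopCat.ofHom φ
      c :=
        { app U := AddCommMonCat.ofHom
            { toFun s := ⟨fun a => f a (Y.germ U.unop (φ a) a.2 s), hs U.unop s⟩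
              map_zero' := Subtype.ext (funext fun a =>
                (congrArg (f a) (map_zero (Y.germ U.unop (φ a) a.2))).trans (map_zero (f a)))
              map_add' s t := Subtype.ext (funext fun a =>
                (congrArg (f a) (map_add (Y.germ U.unop (φ a) a.2) s t)).trans
                  (map_add (f a) _ _)) }
          naturality U V i := by
            ext s
            refine Subtype.ext (funext fun a => congrArg (f a) ?_)
            exact TopCat.Presheaf.germ_res_apply Y.toSheafedSpace.presheaf i.unop (φ a) _ _ } }

theorem IsGermDetermined.stalkEquiv_homOfStalksAux (hA : A.IsGermDetermined) (φ : C(X, Y.Pt))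
    (f : ∀ a, Y.stalk (φ a) →+ T a)
    (hs : ∀ (U : Opens Y.Pt) (s), A.pred (U := U.comap φ) fun a => f a (Y.germ U (φ a) a.2 s))
    (a : X) (t : Y.stalk (φ a)) :
    hA.stalkEquiv a (((homOfStalksAux A φ f hs).hom.stalkMap a).hom t) = f a t := by
  obtain ⟨U, hU, s, rfl⟩ := exists_germ_eq (X := Y) (φ a) t
  have e := congrArg (fun g => g.hom s)
    (PresheafedSpace.stalkMap_germ (homOfStalksAux A φ f hs).hom U a hU)
  exact (congrArg _ e).trans (hA.stalkEquiv_germ _ _)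

/-- A continuous map and local maps on stalks taking germs of sections to sections define a
morphism of locally monoidal spaces. -/
def homOfStalks (hA : A.IsGermDetermined) (φ : C(X, Y.Pt))
    (f : ∀ a, Y.stalk (φ a) →+ T a) (hf : ∀ a, (f a).IsLocal)
    (hs : ∀ (U : Opens Y.Pt) (s), A.pred (U := U.comap φ) fun a => f a (Y.germ U (φ a) a.2 s)) :
    A.toLMS ⟶ Y where
  toHom := homOfStalksAux A φ f hs
  isLocal := fun (a : X) t ht =>
    hf a t (hA.stalkEquiv_homOfStalksAux φ f hs a t ▸ ht.map (hA.stalkEquiv a))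

theorem stalkEquiv_onStalk_homOfStalks (hA : A.IsGermDetermined) (φ : C(X, Y.Pt))
    (f : ∀ a, Y.stalk (φ a) →+ T a) (hf : ∀ a, (f a).IsLocal)
    (hs : ∀ (U : Opens Y.Pt) (s), A.pred (U := U.comap φ) fun a => f a (Y.germ U (φ a) a.2 s))
    (a : X) (t : Y.stalk (φ a)) :
    hA.stalkEquiv a (Hom.onStalk (homOfStalks hA φ f hf hs) a t) = f a t :=
  hA.stalkEquiv_homOfStalksAux φ f hs a t

end AddLocalPredicate

end

noncomputable section

open CategoryTheory TopologicalSpace Opposite TensorProduct LMS LatticeCone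

/-! ### Topology and stalks of spectra -/

namespace MonoidFace

variable {P Q : Type u} [AddCommMonoid P] [AddCommMonoid Q]

instance : PartialOrder (MonoidFace P) where
  le F G := F.toAddSubmonoid ≤ G.toAddSubmonoid
  le_refl F := le_refl F.toAddSubmonoid
  le_trans F G H h h' := h.trans h'
  le_antisymm F G h h' := MonoidFace.ext (Set.Subset.antisymm h h')

/-- A larger face lies in more basic open sets, so it is a generalization: the top face is the
generic point. -/
theorem specializes_iff {F G : MonoidFace P} : G ⤳ F ↔ F ≤ G := by
  constructor
  · intro h p hp
    exact h.mem_open (isOpen_basicOpen p) hp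
  · intro h
    rw [Specializes, nhds_generateFrom, nhds_generateFrom]
    refine biInf_mono ?_
    rintro _ ⟨hF, p, rfl⟩
    exact ⟨h hF, p, rfl⟩

instance : T0Space (MonoidFace P) where
  t0 _ _ h := le_antisymm (specializes_iff.1 h.specializes') (specializes_iff.1 h.specializes)

/-- The face consisting of all elements. -/
instance : OrderTop (MonoidFace P) where
  top := { toAddSubmonoid := ⊤, mem_of_add_mem := fun _ => ⟨trivial, trivial⟩ }
  le_top _ _ _ := trivial

theorem mem_top (p : P) : p ∈ (⊤ : MonoidFace P).toAddSubmonoid := trivial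

/-- A face of a finitely generated monoid is generated by the finitely many generators it contains,
so containing it is a finite intersection of basic open conditions. Hence every point has a smallest
neighbourhood. -/
theorem isOpen_Ici (hP : AddMonoid.FG P) (F : MonoidFace P) : IsOpen (Set.Ici F) := by
  obtain ⟨I, hI, hfin⟩ := AddMonoid.fg_iff.1 hP
  have hF : F.toAddSubmonoid ≤ AddSubmonoid.closure (I ∩ F.toAddSubmonoid) := by
    have key : ∀ p ∈ AddSubmonoid.closure I, p ∈ F.toAddSubmonoid →
        p ∈ AddSubmonoid.closure (I ∩ F.toAddSubmonoid) := by
      intro p hp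
      induction hp using AddSubmonoid.closure_induction with
      | mem x h => exact fun hx => AddSubmonoid.subset_closure ⟨h, hx⟩
      | zero => exact fun _ => zero_mem _
      | add x y hx hy ihx ihy =>
        exact fun h => add_mem (ihx (F.mem_of_add_mem h).1) (ihy (F.mem_of_add_mem h).2)
    exact fun p hp => key p (hI ▸ AddSubmonoid.mem_top p) hp
  have : Set.Ici F = ⋂ p ∈ I ∩ F.toAddSubmonoid, basicOpen p := by
    ext G
    simp only [Set.mem_Ici, Set.mem_iInter]
    exact ⟨fun h p hp => h hp.2, fun h => hF.trans (AddSubmonoid.closure_le.2 h)⟩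
  rw [this]
  exact (hfin.subset Set.inter_subset_left).isOpen_biInter fun p _ => isOpen_basicOpen p

end MonoidFace

namespace LMS

open MonoidFace

variable {P Q : Type u} [AddCommMonoid P] [AddCommMonoid Q]

/-- The section `p - q` of the structure sheaf of `Spec P` over an open set of faces that
contain `q`. -/
def fractionSection (p q : P) (U : Opens (TopCat.of (MonoidFace P)))
    (hU : ∀ F ∈ U, q ∈ F.toAddSubmonoid) : (locallyFraction P).sections U :=
  ⟨fun F => AddLocalization.mk p ⟨q, hU F.1 F.2⟩, fun F => ⟨U, F.2, 𝟙 _, p, q, fun G =>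
    ⟨hU G.1 G.2, rfl⟩⟩⟩

/-- An equality of two fractions at `F` is witnessed by one element `c ∈ F`, and it persists on the
neighbourhood of all faces containing `c`. -/
theorem isGermDetermined_locallyFraction (P : Type u) [AddCommMonoid P] :
    (locallyFraction P).IsGermDetermined where
  exists_section F t := by
    induction t using AddLocalization.induction_on with
    | H y =>
      exact ⟨⟨basicOpen y.2.1, isOpen_basicOpen _⟩, y.2.2, fractionSection y.1 y.2.1 _ fun _ h => h,
        rfl⟩
  eq_near {U} s t F h := by
    obtain ⟨V, hV, i, p, q, e⟩ := s.2 F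
    obtain ⟨V', hV', i', p', q', e'⟩ := t.2 F
    obtain ⟨hq, e₀⟩ := e ⟨F.1, hV⟩
    obtain ⟨hq', e₀'⟩ := e' ⟨F.1, hV'⟩
    have h' : (AddLocalization.mk p ⟨q, hq⟩ : F.1.Loc) = AddLocalization.mk p' ⟨q', hq'⟩ :=
      e₀.symm.trans (h.trans e₀')
    rw [AddLocalization.mk_eq_mk_iff, AddLocalization.r_iff_exists] at h'
    obtain ⟨c, hc⟩ := h'
    refine ⟨V ⊓ V' ⊓ ⟨basicOpen c.1, isOpen_basicOpen _⟩, ⟨⟨hV, hV'⟩, c.2⟩,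
      Opens.infLELeft _ _ ≫ Opens.infLELeft _ _ ≫ i, fun G => ?_⟩
    obtain ⟨hG, e₁⟩ := e ⟨G.1, G.2.1.1⟩
    obtain ⟨hG', e₁'⟩ := e' ⟨G.1, G.2.1.2⟩
    refine e₁.trans (Eq.trans ?_ e₁'.symm)
    rw [AddLocalization.mk_eq_mk_iff, AddLocalization.r_iff_exists]
    exact ⟨⟨c.1, G.2.2⟩, hc⟩

/-- The stalk of `Spec P` at a face `F` is the localization `F⁻¹P`. -/
def specStalk (F : MonoidFace P) : (Spec P).stalk F ≃+ F.Loc :=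
  (isGermDetermined_locallyFraction P).stalkEquiv F

theorem specStalk_generalize {F G : MonoidFace P} (h : G ⤳ F) {t : (Spec P).stalk F} {p : P}
    {q : F.toAddSubmonoid} (ht : specStalk F t = AddLocalization.mk p q) :
    specStalk G ((Spec P).generalize h t) =
      AddLocalization.mk p ⟨q.1, specializes_iff.1 h q.2⟩ :=
  (isGermDetermined_locallyFraction P).stalkEquiv_generalize h (U := ⟨basicOpen q.1,
    isOpen_basicOpen _⟩) q.2 (fractionSection p q.1 _ fun _ h => h) ht

theorem specStalk_onStalk_specMap (h : Q →+ P) (F : MonoidFace P)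
    (t : (Spec Q).stalk (F.comap h)) :
    specStalk F (Hom.onStalk (specMap h) F t) = locMap h F (specStalk (F.comap h) t) := by
  obtain ⟨U, hU, s, rfl⟩ := exists_germ_eq (X := Spec Q) (F.comap h) t
  refine (congrArg _ (Hom.onStalk_germ (specMap h) U F hU s)).trans ?_
  refine ((isGermDetermined_locallyFraction P).stalkEquiv_germ _ _).trans ?_
  exact congrArg (locMap h F)
    ((isGermDetermined_locallyFraction Q).stalkEquiv_germ (U := U) hU s).symm

end LMS

/-! ### Topology and stalks of the space of a classical fan -/

namespace ClassicalFan

variable (S : ClassicalFan.{u})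

/-- The section over the faces of `σ` with value `m` at `σ`. -/
def facesSection (σ : S.Pt) (m : dualMonoid σ.1) : S.compatible.sections (S.faces σ) :=
  ⟨fun τ => ⟨m.1, fun v hv => m.2 v (τ.2.le hv)⟩, fun _ _ _ => rfl⟩

/-- The faces of `σ` form its smallest neighbourhood, and there a compatible family is one and the
same functional at every point. -/
theorem isGermDetermined_compatible : S.compatible.IsGermDetermined where
  exists_section σ m := ⟨S.faces σ, PointedCone.IsFaceOf.refl _, S.facesSection σ m, rfl⟩
  eq_near {U} s t σ h := by
    have hU : S.faces σ.1 ≤ U := fun τ hτ => U.2 σ.1 σ.2 τ hτ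
    refine ⟨S.faces σ.1, PointedCone.IsFaceOf.refl _, homOfLE hU, fun τ => Subtype.ext ?_⟩
    exact (s.2 σ ⟨τ.1, hU τ.2⟩ τ.2).trans ((congrArg Subtype.val h).trans
      (t.2 σ ⟨τ.1, hU τ.2⟩ τ.2).symm)

variable {S}

theorem specializes_iff {σ τ : S.Pt} : τ ⤳ σ ↔ τ.1.IsFaceOf σ.1 := by
  rw [specializes_iff_forall_open]
  exact ⟨fun h => h (S.faces σ) (S.faces σ).2 (PointedCone.IsFaceOf.refl _),
    fun h U hU hσ => hU σ hσ τ h⟩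

/-- The stalk of the structure sheaf of a fan at a cone `σ` is `M ∩ σ^∨`. -/
def stalkEquiv (σ : S.Pt) : S.toLMSObj.stalk σ ≃+ dualMonoid σ.1 :=
  S.isGermDetermined_compatible.stalkEquiv σ

theorem stalkEquiv_generalize {σ τ : S.Pt} (h : τ ⤳ σ) (t : S.toLMSObj.stalk σ) :
    (stalkEquiv τ (S.toLMSObj.generalize h t)).1 = (stalkEquiv σ t).1 :=
  congrArg Subtype.val (S.isGermDetermined_compatible.stalkEquiv_generalize h
    (U := S.faces σ) (PointedCone.IsFaceOf.refl _) (S.facesSection σ (stalkEquiv σ t)) rfl)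

variable {T : ClassicalFan.{u}}

theorem stalkEquiv_onStalk_toLMSMap (f : S ⟶ T) (σ : S.Pt)
    (t : T.toLMSObj.stalk (leastCone f σ)) :
    stalkEquiv σ (Hom.onStalk (toLMSMap f) σ t) = dualMap f σ (stalkEquiv (leastCone f σ) t) := by
  obtain ⟨U, hU, s, rfl⟩ := exists_germ_eq (X := T.toLMSObj) (leastCone f σ) t
  refine (congrArg _ (LMS.Hom.onStalk_germ (toLMSMap f) U σ hU s)).trans ?_
  refine (S.isGermDetermined_compatible.stalkEquiv_germ _ _).trans ?_
  exact congrArg (dualMap f σ)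
    (T.isGermDetermined_compatible.stalkEquiv_germ (U := U) hU s).symm

end ClassicalFan

end

noncomputable section

open CategoryTheory TopologicalSpace Opposite TensorProduct LMS LatticeCone

/-! ### Localizations inside a group and the cone of a face -/

namespace MonoidFace

section LocHom

variable {P : Type u} [AddCommMonoid P] {A : Type u} [AddCommGroup A] (ι : P →+ A)

theorem isSubmonoidFace_map (hι : Function.Injective ι) (F : MonoidFace P) :
    IsSubmonoidFace (F.toAddSubmonoid.map ι) (AddMonoidHom.mrange ι) where
  le := by
    rintro _ ⟨p, _, rfl⟩
    exact ⟨p, rfl⟩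
  mem_of_add_mem := by
    rintro _ _ ⟨p, rfl⟩ ⟨q, rfl⟩ ⟨r, hr, e⟩
    rw [← map_add] at e
    rw [hι e] at hr
    exact ⟨p, (F.mem_of_add_mem hr).1, rfl⟩

theorem exists_map_eq {F' : AddSubmonoid A} (hF : IsSubmonoidFace F' (AddMonoidHom.mrange ι)) :
    ∃ F : MonoidFace P, F.toAddSubmonoid.map ι = F' := by
  refine ⟨{ toAddSubmonoid := F'.comap ι, mem_of_add_mem := fun {p q} h => ?_ }, ?_⟩
  · have h' : ι p + ι q ∈ F' := by rw [← map_add]; exact h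
    exact ⟨hF.mem_of_add_mem ⟨p, rfl⟩ ⟨q, rfl⟩ h',
      hF.mem_of_add_mem ⟨q, rfl⟩ ⟨p, rfl⟩ (by rwa [add_comm])⟩
  · exact AddSubmonoid.map_comap_eq_self hF.le

theorem map_le_map_iff (hι : Function.Injective ι) {F G : MonoidFace P} :
    F.toAddSubmonoid.map ι ≤ G.toAddSubmonoid.map ι ↔ F ≤ G := by
  refine ⟨fun h p hp => ?_, ?_⟩
  swap
  · rintro h _ ⟨p, hp, rfl⟩
    exact ⟨p, h hp, rfl⟩
  obtain ⟨q, hq, e⟩ := h ⟨p, hp, rfl⟩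
  exact hι e ▸ hq

/-- The extension of a homomorphism to a group to a localization. -/
def locHom (F : MonoidFace P) : F.Loc →+ A :=
  (AddLocalization.addMonoidOf F.toAddSubmonoid).lift (g := ι) fun _ => AddGroup.isAddUnit _

theorem locHom_mk (F : MonoidFace P) (p : P) (q : F.toAddSubmonoid) :
    locHom ι F (AddLocalization.mk p q) = ι p - ι q := by
  have h : ∀ p, locHom ι F (AddLocalization.mk p 0) = ι p := fun p => by
    rw [AddLocalization.mk_zero_eq_addMonoidOf_mk]
    exact (AddLocalization.addMonoidOf F.toAddSubmonoid).lift_eq _ p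
  have e : (AddLocalization.mk p q : F.Loc) + AddLocalization.mk q.1 0 = AddLocalization.mk p 0 := by
    rw [AddLocalization.mk_add, AddLocalization.mk_eq_mk_iff, AddLocalization.r_iff_exists]
    exact ⟨0, by simp [add_comm]⟩
  rw [eq_sub_iff_add_eq, ← h q.1, ← map_add, e, h]

theorem locHom_injective (hι : Function.Injective ι) (F : MonoidFace P) :
    Function.Injective (locHom ι F) := by
  intro x y h
  induction x using AddLocalization.induction_on with
  | H x =>
    induction y using AddLocalization.induction_on with
    | H y =>
      rw [locHom_mk, locHom_mk, sub_eq_sub_iff_add_eq_add, ← map_add, ← map_add] at h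
      rw [AddLocalization.mk_eq_mk_iff, AddLocalization.r_iff_exists]
      exact ⟨0, by simpa [add_comm] using hι h⟩

theorem mrange_locHom (F : MonoidFace P) : AddMonoidHom.mrange (locHom ι F) =
    differences (AddMonoidHom.mrange ι) (F.toAddSubmonoid.map ι) := by
  ext d
  constructor
  · rintro ⟨x, rfl⟩
    induction x using AddLocalization.induction_on with
    | H x =>
      rw [locHom_mk]
      exact ⟨ι x.2, ⟨x.2, x.2.2, rfl⟩, x.1, by simp⟩
  · rintro ⟨_, ⟨q, hq, rfl⟩, p, hp⟩
    refine ⟨AddLocalization.mk p ⟨q, hq⟩, ?_⟩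
    rw [locHom_mk, hp, add_sub_cancel_right]

end LocHom

section FaceCone

variable {P : Type u} [AddCommMonoid P] {N : Type u} [AddCommGroup N]
  (ι : P →+ (N →ₗ[ℤ] ℤ))

/-- The cone of `v ∈ N ⊗ ℝ` that are non-negative on `P` and zero on the face `F`. -/
def faceCone (F : MonoidFace P) : PointedCone ℝ (ℝ ⊗[ℤ] N) :=
  dualCone (AddMonoidHom.mrange (locHom ι F) : Set (N →ₗ[ℤ] ℤ))

theorem faceCone_eq (F : MonoidFace P) : faceCone ι F =
    dualCone (differences (AddMonoidHom.mrange ι) (F.toAddSubmonoid.map ι) :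
      Set (N →ₗ[ℤ] ℤ)) := by
  rw [faceCone, mrange_locHom]

variable {ι}

theorem isFaceOf_faceCone (hι : Function.Injective ι) (F : MonoidFace P) :
    (faceCone ι F).IsFaceOf (dualCone (AddMonoidHom.mrange ι : Set (N →ₗ[ℤ] ℤ))) := by
  rw [faceCone_eq]
  exact isFaceOf_dualCone_differences (isSubmonoidFace_map ι hι F).le

theorem mrange_fg (hP : AddMonoid.FG P) : (AddMonoidHom.mrange ι).FG := by
  rw [AddMonoidHom.mrange_eq_map]
  exact hP.fg_top.map ι

variable [Module.Free ℤ N] [Module.Finite ℤ N]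

theorem isRational_faceCone (hι : Function.Injective ι) (hP : AddMonoid.FG P) (F : MonoidFace P) :
    IsRational (faceCone ι F) := by
  rw [faceCone_eq]
  exact isRational_dualCone_of_fg ((isSubmonoidFace_map ι hι F).differences_fg (mrange_fg hP))

/-- The face in question consists of the elements of `P` that vanish on `τ`. -/
theorem exists_eq_faceCone (hP : AddMonoid.FG P)
    {τ : PointedCone ℝ (ℝ ⊗[ℤ] N)}
    (hτ : τ.IsFaceOf (dualCone (AddMonoidHom.mrange ι : Set (N →ₗ[ℤ] ℤ)))) :
    ∃ F : MonoidFace P, faceCone ι F = τ := by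
  obtain ⟨F, hF⟩ := exists_map_eq ι (vanishing_isSubmonoidFace _ hτ.le)
  exact ⟨F, by rw [faceCone_eq, hF, ← eq_dualCone_differences (mrange_fg hP) hτ]⟩

/-- Localization preserves finite generation and saturation, so `F⁻¹P` is equal to its double dual.
-/
theorem dualMonoid_faceCone (hι : Function.Injective ι) (hP : AddMonoid.FG P)
    (hsat : ∀ (m : N →ₗ[ℤ] ℤ) (n : ℕ), 0 < n →
      n • m ∈ AddMonoidHom.mrange ι → m ∈ AddMonoidHom.mrange ι) (F : MonoidFace P) :
    dualMonoid (faceCone ι F) = AddMonoidHom.mrange (locHom ι F) := by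
  rw [faceCone_eq, dualMonoid_dualCone_differences (mrange_fg hP) hsat (isSubmonoidFace_map ι hι F),
    mrange_locHom]

theorem faceCone_le_iff (hι : Function.Injective ι) (hP : AddMonoid.FG P)
    (hsat : ∀ (m : N →ₗ[ℤ] ℤ) (n : ℕ), 0 < n →
      n • m ∈ AddMonoidHom.mrange ι → m ∈ AddMonoidHom.mrange ι) {F G : MonoidFace P} :
    faceCone ι G ≤ faceCone ι F ↔ F ≤ G := by
  rw [faceCone_eq, faceCone_eq, dualCone_differences_le_iff (mrange_fg hP) hsat
    (isSubmonoidFace_map ι hι F) (isSubmonoidFace_map ι hι G), map_le_map_iff ι hι]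

theorem isFaceOf_faceCone_iff (hι : Function.Injective ι) (hP : AddMonoid.FG P)
    (hsat : ∀ (m : N →ₗ[ℤ] ℤ) (n : ℕ), 0 < n →
      n • m ∈ AddMonoidHom.mrange ι → m ∈ AddMonoidHom.mrange ι) {F G : MonoidFace P} :
    (faceCone ι G).IsFaceOf (faceCone ι F) ↔ F ≤ G := by
  rw [PointedCone.IsFaceOf.isFaceOf_iff_le (isFaceOf_faceCone hι G) (isFaceOf_faceCone hι F),
    faceCone_le_iff hι hP hsat]

theorem mem_of_mem_interior_faceCone (hι : Function.Injective ι) (hP : AddMonoid.FG P)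
    (hsat : ∀ (m : N →ₗ[ℤ] ℤ) (n : ℕ), 0 < n →
      n • m ∈ AddMonoidHom.mrange ι → m ∈ AddMonoidHom.mrange ι) {F : MonoidFace P} {n : N}
    (hn : toReal n ∈ interior (faceCone ι F)) {p : P} (hp : ι p n = 0) :
    p ∈ F.toAddSubmonoid := by
  rw [faceCone_eq] at hn
  obtain ⟨q, hq, e⟩ := mem_of_mem_interior (mrange_fg hP) hsat (isSubmonoidFace_map ι hι F) hn
    (m := ι p) ⟨p, rfl⟩ hp
  exact hι e ▸ hq

/-- The localization at a face `F` consists of the functionals that are non-negative on the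
cone of `F`. -/
def locEquiv (hι : Function.Injective ι) (hP : AddMonoid.FG P)
    (hsat : ∀ (m : N →ₗ[ℤ] ℤ) (n : ℕ), 0 < n →
      n • m ∈ AddMonoidHom.mrange ι → m ∈ AddMonoidHom.mrange ι) (F : MonoidFace P) :
    F.Loc ≃+ dualMonoid (faceCone ι F) :=
  (AddEquiv.ofBijective (locHom ι F).mrangeRestrict
    ⟨fun _ _ h => locHom_injective ι hι F (congrArg Subtype.val h),
      (locHom ι F).mrangeRestrict_surjective⟩).trans (AddEquiv.addSubmonoidCongr (dualMonoid_faceCone hι hP hsat F).symm)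

end FaceCone

end MonoidFace

/-! ### Charts of the space of a classical fan -/

namespace ClassicalFan

open MonoidFace

variable {S : ClassicalFan.{u}} (σ : S.Pt)

theorem isRational (σ : S.Pt) : IsRational σ.1 := S.rational σ.1 σ.2

theorem mrange_subtype_dualMonoid :
    AddMonoidHom.mrange (dualMonoid σ.1).subtype = dualMonoid σ.1 :=
  AddSubmonoid.mrange_subtype _

theorem dualMonoid_fg : AddMonoid.FG (dualMonoid σ.1) :=
  (AddMonoid.fg_iff_addSubmonoid_fg _).2 (isRational σ).dualMonoid_fg

theorem mrange_subtype_saturated (m : S.N →ₗ[ℤ] ℤ) (n : ℕ) (hn : 0 < n)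
    (h : n • m ∈ AddMonoidHom.mrange (dualMonoid σ.1).subtype) :
    m ∈ AddMonoidHom.mrange (dualMonoid σ.1).subtype := by
  rw [mrange_subtype_dualMonoid] at h ⊢
  exact dualMonoid_saturated _ m n hn h

theorem dualCone_mrange_subtype :
    dualCone (AddMonoidHom.mrange (dualMonoid σ.1).subtype : Set (S.N →ₗ[ℤ] ℤ)) = σ.1 := by
  rw [mrange_subtype_dualMonoid, (isRational σ).dualCone_dualMonoid]

theorem isFaceOf_subtype (F : MonoidFace (dualMonoid σ.1)) :
    (faceCone (dualMonoid σ.1).subtype F).IsFaceOf σ.1 := by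
  have := isFaceOf_faceCone (ι := (dualMonoid σ.1).subtype) Subtype.val_injective F
  rwa [dualCone_mrange_subtype σ] at this

/-- The cone of a face of the monoid `M ∩ σ^∨`. -/
def chartPt (F : MonoidFace (dualMonoid σ.1)) : S.Pt :=
  ⟨faceCone (dualMonoid σ.1).subtype F, S.face_mem σ.1 σ.2 _ (isFaceOf_subtype σ F)⟩

theorem chartPt_isFaceOf_iff {F G : MonoidFace (dualMonoid σ.1)} :
    (chartPt σ G).1.IsFaceOf (chartPt σ F).1 ↔ F ≤ G :=
  isFaceOf_faceCone_iff Subtype.val_injective (dualMonoid_fg σ) (mrange_subtype_saturated σ)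

theorem exists_chartPt_eq {τ : S.Pt} (hτ : τ.1.IsFaceOf σ.1) : ∃ F, chartPt σ F = τ := by
  rw [← dualCone_mrange_subtype σ] at hτ
  obtain ⟨F, hF⟩ := exists_eq_faceCone (dualMonoid_fg σ) hτ
  exact ⟨F, Subtype.ext hF⟩

theorem chartPt_isFaceOf (F : MonoidFace (dualMonoid σ.1)) : (chartPt σ F).1.IsFaceOf σ.1 :=
  isFaceOf_subtype σ F

theorem continuous_chartPt : Continuous (chartPt σ) := by
  refine ⟨fun U hU => isOpen_iff_forall_mem_open.2 fun F hF => ?_⟩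
  exact ⟨Set.Ici F, fun G hG => hU _ hF _ ((chartPt_isFaceOf_iff σ).2 hG),
    isOpen_Ici (dualMonoid_fg σ) F, Set.self_mem_Ici⟩

/-- The image of an open set is open because a face of the cone of `F` is a face of `σ`, hence the
cone of some `G ≥ F`, and `G` is a generalization of `F`. -/
theorem isOpenEmbedding_chartPt : Topology.IsOpenEmbedding (chartPt σ) := by
  refine .of_continuous_injective_isOpenMap (continuous_chartPt σ) (fun F G h => ?_)
    fun V hV τ hτ ρ hρ => ?_
  · exact le_antisymm ((chartPt_isFaceOf_iff σ).1 (h ▸ PointedCone.IsFaceOf.refl _))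
      ((chartPt_isFaceOf_iff σ).1 (h ▸ PointedCone.IsFaceOf.refl _))
  · obtain ⟨F, hF, rfl⟩ := hτ
    obtain ⟨G, rfl⟩ := exists_chartPt_eq σ (hρ.trans (chartPt_isFaceOf σ F))
    exact ⟨G, (MonoidFace.specializes_iff.2 ((chartPt_isFaceOf_iff σ).1 hρ)).mem_open hV hF, rfl⟩

/-- The stalks of `Spec (M ∩ σ^∨)`. -/
def chartLocEquiv (F : MonoidFace (dualMonoid σ.1)) : F.Loc ≃+ dualMonoid (chartPt σ F).1 :=
  locEquiv Subtype.val_injective (dualMonoid_fg σ) (mrange_subtype_saturated σ) F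

/-- The maps of stalks of the open immersion from `Spec (M ∩ σ^∨)`. -/
def chartStalk (F : MonoidFace (dualMonoid σ.1)) : S.toLMSObj.stalk (chartPt σ F) ≃+ F.Loc :=
  (stalkEquiv (chartPt σ F)).trans (chartLocEquiv σ F).symm

/-- On the smallest neighbourhood `Set.Ici F` a section of the sheaf of the fan is a constant
functional, so a fraction `p - q` that represents it at `F` represents it at every `G ≥ F`. -/
theorem locallyFraction_chartStalk (U : Opens S.Pt) (s : S.compatible.sections U) :
    (locallyFraction (dualMonoid σ.1)).pred (U := U.comap ⟨chartPt σ, continuous_chartPt σ⟩)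
      fun F => chartStalk σ F.1 (S.toLMSObj.germ U (chartPt σ F.1) F.2 s) := by
  intro F
  have hval : ∀ (G : MonoidFace (dualMonoid σ.1)) (hG : chartPt σ G ∈ U),
      chartStalk σ G (S.toLMSObj.germ U (chartPt σ G) hG s) =
        (chartLocEquiv σ G).symm (s.1 ⟨chartPt σ G, hG⟩) := fun G hG =>
    congrArg (chartLocEquiv σ G).symm (S.isGermDetermined_compatible.stalkEquiv_germ hG s)
  obtain ⟨⟨p, q⟩, hpq⟩ : ∃ y : _ × F.1.toAddSubmonoid, AddLocalization.mk y.1 y.2 =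
      (chartLocEquiv σ F.1).symm (s.1 ⟨chartPt σ F.1, F.2⟩) := by
    generalize (chartLocEquiv σ F.1).symm (s.1 ⟨chartPt σ F.1, F.2⟩) = x
    induction x using AddLocalization.induction_on with
    | H y => exact ⟨y, rfl⟩
  have hU : ∀ G, F.1 ≤ G → chartPt σ G ∈ U := fun G hG =>
    U.2 _ F.2 _ ((chartPt_isFaceOf_iff σ).2 hG)
  refine ⟨⟨Set.Ici F.1, isOpen_Ici (dualMonoid_fg σ) F.1⟩, Set.self_mem_Ici, homOfLE hU, p, q.1,
    fun G => ⟨G.2 q.2, ?_⟩⟩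
  refine (hval G.1 (hU _ G.2)).trans ((AddEquiv.symm_apply_eq _).2 (Subtype.ext ?_))
  have h1 := congrArg Subtype.val ((AddEquiv.eq_symm_apply _).1 hpq)
  refine (s.2 ⟨_, F.2⟩ ⟨_, hU _ G.2⟩ ((chartPt_isFaceOf_iff σ).2 G.2)).trans (h1.symm.trans ?_)
  exact (locHom_mk _ F.1 p q).trans (locHom_mk _ G.1 p ⟨q.1, G.2 q.2⟩).symm

/-- The open immersion `Spec (M ∩ σ^∨) ⟶ Σ`. -/
def chart : Spec (dualMonoid σ.1) ⟶ S.toLMSObj :=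
  AddLocalPredicate.homOfStalks (Y := S.toLMSObj) (isGermDetermined_locallyFraction _)
    ⟨chartPt σ, continuous_chartPt σ⟩ (fun F => (chartStalk σ F).toAddMonoidHom)
    (fun F => isLocal_of_bijective (chartStalk σ F).bijective) (locallyFraction_chartStalk σ)

theorem isOpenImmersion_chart : IsOpenImmersion (chart σ) := by
  refine .of_bijective (isOpenEmbedding_chartPt σ) fun F => ?_
  have h : ∀ t, specStalk F (LMS.Hom.onStalk (chart σ) F t) = chartStalk σ F t :=
    AddLocalPredicate.stalkEquiv_onStalk_homOfStalks (Y := S.toLMSObj)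
      (isGermDetermined_locallyFraction _) _ _ _ _ F
  have h' : ⇑(LMS.Hom.onStalk (chart σ) F) = (specStalk F).symm ∘ chartStalk σ F :=
    funext fun t => (AddEquiv.eq_symm_apply _).2 (h t)
  rw [h']
  exact (specStalk F).symm.bijective.comp (chartStalk σ F).bijective

theorem mem_range_chart : σ ∈ Set.range (LMS.Hom.pt (chart σ)) :=
  exists_chartPt_eq σ (PointedCone.IsFaceOf.refl _)

end ClassicalFan

/-! ### Toric monoids -/

/-- A saturated finitely generated submonoid of a torsion-free group is toric. -/
theorem isToricMonoid_of_injective {P : Type u} [AddCommMonoid P] {A : Type u} [AddCommGroup A]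
    (htf : ∀ (a : A) (n : ℕ), 0 < n → n • a = 0 → a = 0) (ι : P →+ A) (hι : Function.Injective ι)
    (hP : AddMonoid.FG P)
    (hsat : ∀ (a : A) (n : ℕ), 0 < n → n • a ∈ AddMonoidHom.mrange ι → a ∈ AddMonoidHom.mrange ι) :
    IsToricMonoid P := by
  let L : Algebra.GrothendieckAddGroup P →+ A := Algebra.GrothendieckAddGroup.lift ι
  have hof : ∀ p, L (Algebra.GrothendieckAddGroup.of p) = ι p := fun p =>
    (AddLocalization.addMonoidOf (⊤ : AddSubmonoid P)).lift_eq _ p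
  -- The Grothendieck group is by definition the localization at the top face, and there `L` is
  -- `locHom`.
  have hL : Function.Injective L := MonoidFace.locHom_injective ι hι ⊤
  refine ⟨hP, fun p q h => hι ?_, fun x n hn => ?_, fun x n hn h => ?_⟩
  · rw [← hof, ← hof, h]
  · rintro ⟨p, hp⟩
    obtain ⟨q, hq⟩ := hsat (L x) n hn ⟨p, by rw [← hof, hp, map_nsmul]⟩
    exact ⟨q, hL ((hof q).trans hq)⟩
  · refine hL ?_
    rw [map_zero]
    exact htf _ n hn (by rw [← map_nsmul, h, map_zero])

end

noncomputable section

open CategoryTheory TopologicalSpace Opposite TensorProduct LMS LatticeCone MonoidFace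

/-! ### Fans and toric fans in terms of charts, and invariance under isomorphism -/

namespace LMS

theorem isFan_iff {X : LMS.{u}} : LMS.IsFan X ↔ ∀ x : X.Pt, ∃ (P : Type u) (_ : AddCommMonoid P)
    (j : Spec P ⟶ X), IsOpenImmersion j ∧ x ∈ Set.range (Hom.pt j) := by
  refine forall_congr' fun x => ⟨?_, ?_⟩
  · rintro ⟨U, hx, P, i, h⟩
    exact ⟨P, i, exists_restrict_iso_iff.1 ⟨U, hx, h⟩⟩
  · rintro ⟨P, i, h⟩
    obtain ⟨U, hx, h⟩ := exists_restrict_iso_iff.2 h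
    exact ⟨U, hx, P, i, h⟩

theorem isToric_iff {X : LMS.{u}} : X.IsToric ↔ ∀ x : X.Pt, ∃ (P : Type u) (_ : AddCommMonoid P)
    (j : Spec P ⟶ X), IsToricMonoid P ∧ IsOpenImmersion j ∧ x ∈ Set.range (Hom.pt j) := by
  refine forall_congr' fun x => ⟨?_, ?_⟩
  · rintro ⟨U, hx, P, i, hP, h⟩
    obtain ⟨j, hj⟩ := exists_restrict_iso_iff.1 ⟨U, hx, h⟩
    exact ⟨P, i, j, hP, hj⟩
  · rintro ⟨P, i, j, hP, h⟩
    obtain ⟨U, hx, h⟩ := exists_restrict_iso_iff.2 ⟨j, h⟩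
    exact ⟨U, hx, P, i, hP, h⟩

theorem IsToric.isFan {X : LMS.{u}} (h : X.IsToric) : LMS.IsFan X := fun x => by
  obtain ⟨U, hx, P, i, _, e⟩ := h x
  exact ⟨U, hx, P, i, e⟩

theorem IsToric.of_iso {X Y : LMS.{u}} (e : X ≅ Y) (h : X.IsToric) : Y.IsToric := by
  rw [isToric_iff] at h ⊢
  intro y
  obtain ⟨P, i, j, hP, hj, F, hF⟩ := h (Hom.pt e.inv y)
  refine ⟨P, i, j ≫ e.hom, hP, hj.comp (.of_iso e), F, ?_⟩
  rw [Hom.pt_comp, hF, ← Hom.pt_comp, e.inv_hom_id]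
  rfl

/-- The homeomorphism underlying an isomorphism. -/
def homeomorphOfIso {X Y : LMS.{u}} (e : X ≅ Y) : X.Pt ≃ₜ Y.Pt where
  toFun := Hom.pt e.hom
  invFun := Hom.pt e.inv
  left_inv x := by rw [← Hom.pt_comp, e.hom_inv_id]; rfl
  right_inv x := by rw [← Hom.pt_comp, e.inv_hom_id]; rfl
  continuous_toFun := Hom.continuous_pt _
  continuous_invFun := Hom.continuous_pt _

theorem IsValuativelySeparated.of_iso {X Y : LMS.{u}} (e : X ≅ Y) (h : X.IsValuativelySeparated) :
    Y.IsValuativelySeparated := by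
  intro f g hfg
  have := h (f ≫ e.inv) (g ≫ e.inv) (by rw [← Category.assoc, hfg, Category.assoc])
  exact (cancel_mono e.inv).1 this

/-! ### Morphisms from the spectrum of the natural numbers -/

/-- The generic point of `Spec ℕ`. -/
def natGeneric : MonoidFace (ULift.{u} ℕ) := (⊤ : MonoidFace (ULift.{u} ℤ)).comap natToInt

theorem natGeneric_specializes (F : MonoidFace (ULift.{u} ℕ)) : natGeneric ⤳ F :=
  MonoidFace.specializes_iff.2 fun _ _ => trivial

theorem natToInt_injective : Function.Injective natToInt.{u} := by
  intro a b h
  have : (a.down : ℤ) = b.down := congrArg ULift.down h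
  exact ULift.ext _ _ (by exact_mod_cast this)

theorem natToInt_nonneg (a : ULift.{u} ℕ) : 0 ≤ (natToInt a).down := Int.natCast_nonneg a.down

/-- `Spec ℕ` has only two points: a face containing some `k + 1` contains its summand `1`, hence
everything. -/
theorem eq_natGeneric_or (F : MonoidFace (ULift.{u} ℕ)) :
    F = natGeneric ∨ ∀ p ∈ F.toAddSubmonoid, p = 0 := by
  by_cases h : ∀ p ∈ F.toAddSubmonoid, p = 0
  · exact Or.inr h
  · push Not at h
    obtain ⟨⟨p⟩, hp, hp0⟩ := h
    left
    refine le_antisymm (fun _ _ => trivial) fun q _ => ?_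
    have hp1 : p ≠ 0 := fun h => hp0 (by rw [h]; rfl)
    obtain ⟨k, rfl⟩ := Nat.exists_eq_succ_of_ne_zero hp1
    have h1 : (⟨1⟩ : ULift.{u} ℕ) ∈ F.toAddSubmonoid := by
      refine (F.mem_of_add_mem (p := ⟨k⟩) ?_).2
      exact hp
    have : q = q.down • (⟨1⟩ : ULift.{u} ℕ) := ULift.ext _ _ (by simp)
    rw [this]
    exact nsmul_mem h1 _

variable {X : LMS.{u}}

/-- The action of a morphism `Spec ℕ ⟶ X` on a stalk, with values in `ℤ`. -/
def natStalk (f : Spec (ULift.{u} ℕ) ⟶ X) (F : MonoidFace (ULift.{u} ℕ)) :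
    X.stalk (Hom.pt f F) →+ ULift.{u} ℤ :=
  (locHom natToInt F).comp ((specStalk F).toAddMonoidHom.comp (Hom.onStalk f F))

/-- Generalization keeps the fraction `p - q`, and its integer value does not depend on the face. So
the values at the generic point determine those at the closed point. -/
theorem natStalk_generalize (f : Spec (ULift.{u} ℕ) ⟶ X) {F G : MonoidFace (ULift.{u} ℕ)}
    (h : G ⤳ F) (t : X.stalk (Hom.pt f F)) :
    natStalk f G (X.generalize (h.map (Hom.continuous_pt f)) t) = natStalk f F t := by
  change locHom natToInt G (specStalk G (Hom.onStalk f G _)) =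
    locHom natToInt F (specStalk F (Hom.onStalk f F t))
  refine (congrArg (fun x => locHom natToInt G (specStalk G x))
    (Hom.onStalk_generalize f h t)).trans ?_
  obtain ⟨⟨p, q⟩, hpq⟩ : ∃ y : _ × F.toAddSubmonoid, specStalk F (Hom.onStalk f F t) =
      AddLocalization.mk y.1 y.2 := by
    generalize specStalk F (Hom.onStalk f F t) = x
    induction x using AddLocalization.induction_on with
    | H y => exact ⟨y, rfl⟩
  rw [hpq]
  refine (congrArg (locHom natToInt G) (specStalk_generalize h hpq)).trans ?_
  rw [locHom_mk, locHom_mk]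

theorem natStalk_injective_left (f : Spec (ULift.{u} ℕ) ⟶ X) (F : MonoidFace (ULift.{u} ℕ))
    {t : X.stalk (Hom.pt f F)} {s : (Spec (ULift.{u} ℕ)).stalk F}
    (h : natStalk f F t = locHom natToInt F (specStalk F s)) : Hom.onStalk f F t = s :=
  (specStalk F).injective (locHom_injective natToInt natToInt_injective F h)

theorem locHom_specStalk_onStalk_natToInt (s : (Spec (ULift.{u} ℕ)).stalk natGeneric) :
    locHom (AddMonoidHom.id _) (⊤ : MonoidFace (ULift.{u} ℤ))
        (specStalk (⊤ : MonoidFace (ULift.{u} ℤ))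
          (Hom.onStalk (specMap natToInt) (⊤ : MonoidFace (ULift.{u} ℤ)) s)) =
      locHom natToInt natGeneric (specStalk natGeneric s) := by
  have key : ∀ x : (natGeneric.{u}).Loc,
      locHom (AddMonoidHom.id _) ⊤ (locMap natToInt (⊤ : MonoidFace (ULift.{u} ℤ)) x) =
        locHom natToInt natGeneric x := by
    intro x
    induction x using AddLocalization.induction_on with
    | H y =>
      rw [locHom_mk]
      exact (congrArg _ (locMap_mk natToInt (⊤ : MonoidFace (ULift.{u} ℤ)) y.1 y.2)).trans
        (locHom_mk _ _ _ _)
  exact (congrArg _ (specStalk_onStalk_specMap natToInt (⊤ : MonoidFace (ULift.{u} ℤ)) s)).trans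
    (key _)

/-- The generic stalk of `Spec ℕ` and the stalk of `Spec ℤ` are both `ℤ`, so the restriction of `f`
to `Spec ℤ` carries the same information as `natStalk f` at the generic point. -/
theorem locHom_specStalk_onStalk_comp (f : Spec (ULift.{u} ℕ) ⟶ X)
    (t : X.stalk (Hom.pt f natGeneric)) :
    locHom (AddMonoidHom.id _) (⊤ : MonoidFace (ULift.{u} ℤ))
        (specStalk (⊤ : MonoidFace (ULift.{u} ℤ))
          (Hom.onStalk (specMap natToInt ≫ f) (⊤ : MonoidFace (ULift.{u} ℤ)) t)) =
      natStalk f natGeneric t :=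
  (congrArg (fun x => locHom (AddMonoidHom.id _) (⊤ : MonoidFace (ULift.{u} ℤ))
    (specStalk (⊤ : MonoidFace (ULift.{u} ℤ)) x)) (Hom.onStalk_comp _ _ _ _)).trans
    (locHom_specStalk_onStalk_natToInt _)

theorem natStalk_natGeneric_eq {f g : Spec (ULift.{u} ℕ) ⟶ X}
    (h : specMap natToInt ≫ f = specMap natToInt ≫ g)
    (hpt : Hom.pt g natGeneric ⤳ Hom.pt f natGeneric) (t : X.stalk (Hom.pt f natGeneric)) :
    natStalk f natGeneric t = natStalk g natGeneric (X.generalize hpt t) := by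
  rw [← locHom_specStalk_onStalk_comp, ← locHom_specStalk_onStalk_comp]
  exact congrArg (fun x => locHom (AddMonoidHom.id _) (⊤ : MonoidFace (ULift.{u} ℤ))
    (specStalk (⊤ : MonoidFace (ULift.{u} ℤ)) x))
    (onStalk_eq_of_eq h (⊤ : MonoidFace (ULift.{u} ℤ)) hpt t)

theorem eq_top_of_addGroup {A : Type u} [AddCommGroup A] (F : MonoidFace A) : F = ⊤ :=
  le_antisymm le_top fun a _ => (F.mem_of_add_mem (p := a) (q := -a) (by
    rw [add_neg_cancel]
    exact F.zero_mem)).1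

/-- Two morphisms `Spec ℕ ⟶ X` agreeing at the generic point have the same restriction to
`Spec ℤ`. -/
theorem specMap_comp_eq {f g : Spec (ULift.{u} ℕ) ⟶ X}
    (hpt : Hom.pt f natGeneric = Hom.pt g natGeneric)
    (h : ∀ t, natStalk f natGeneric t =
      natStalk g natGeneric (X.generalize (specializes_of_eq hpt.symm) t)) :
    specMap natToInt ≫ f = specMap natToInt ≫ g := by
  have hpt' : ∀ F : MonoidFace (ULift.{u} ℤ),
      Hom.pt (specMap natToInt ≫ f) F = Hom.pt (specMap natToInt ≫ g) F := by
    intro F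
    obtain rfl := eq_top_of_addGroup F
    exact hpt
  refine hom_ext hpt' fun F t => ?_
  obtain rfl := eq_top_of_addGroup F
  refine (specStalk (⊤ : MonoidFace (ULift.{u} ℤ))).injective
    (locHom_injective (AddMonoidHom.id _) Function.injective_id _ ?_)
  exact (locHom_specStalk_onStalk_comp f t).trans
    ((h t).trans (locHom_specStalk_onStalk_comp g _).symm)

theorem pt_natGeneric_eq {f g : Spec (ULift.{u} ℕ) ⟶ X}
    (h : specMap natToInt ≫ f = specMap natToInt ≫ g) :
    Hom.pt f natGeneric = Hom.pt g natGeneric :=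
  congrArg (fun k : Spec (ULift.{u} ℤ) ⟶ X => Hom.pt k (⊤ : MonoidFace (ULift.{u} ℤ))) h

/-- Two morphisms `Spec ℕ ⟶ X` with the same restriction to `Spec ℤ` are equal if they agree on
points. -/
theorem eq_of_specMap_comp_eq {f g : Spec (ULift.{u} ℕ) ⟶ X}
    (h : specMap natToInt ≫ f = specMap natToInt ≫ g) (hpt : ∀ F, Hom.pt f F = Hom.pt g F) :
    f = g := by
  refine hom_ext hpt fun F t => natStalk_injective_left f F ?_
  change _ = natStalk g F _
  -- Both sides are computed at the generic point, where the restrictions to `Spec ℤ` can be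
  -- compared.
  rw [← natStalk_generalize f (natGeneric_specializes F),
    ← natStalk_generalize g (natGeneric_specializes F),
    natStalk_natGeneric_eq h (specializes_of_eq (pt_natGeneric_eq h).symm), generalize_generalize,
    generalize_generalize]

theorem isAddUnit_of_natGeneric (t : (Spec (ULift.{u} ℕ)).stalk natGeneric) : IsAddUnit t := by
  obtain ⟨x, rfl⟩ := (specStalk natGeneric).symm.surjective t
  refine IsAddUnit.map (specStalk natGeneric).symm ?_
  induction x using AddLocalization.induction_on with
  | H y =>
    refine .of_add_eq_zero (AddLocalization.mk y.2.1 ⟨y.1, trivial⟩) ?_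
    rw [AddLocalization.mk_add, ← AddLocalization.mk_zero, AddLocalization.mk_eq_mk_iff,
      AddLocalization.r_iff_exists]
    exact ⟨0, by simp [add_comm]⟩

/-- At the closed point the only denominator is `0`, so the stalk takes values in `ℕ`. -/
theorem natStalk_nonneg (f : Spec (ULift.{u} ℕ) ⟶ X) {F : MonoidFace (ULift.{u} ℕ)}
    (hF : ∀ p ∈ F.toAddSubmonoid, p = 0) (t : X.stalk (Hom.pt f F)) :
    0 ≤ (natStalk f F t).down := by
  change 0 ≤ (locHom natToInt F (specStalk F (Hom.onStalk f F t))).down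
  generalize specStalk F (Hom.onStalk f F t) = x
  induction x using AddLocalization.induction_on with
  | H y =>
    rw [locHom_mk, hF _ y.2.2, map_zero, sub_zero]
    exact natToInt_nonneg _

/-- The values in `ℤ` determine the image in the stalk, so `t` maps to `0`, a unit, and locality
applies. -/
theorem isAddUnit_of_natStalk_eq_zero (f : Spec (ULift.{u} ℕ) ⟶ X) {F : MonoidFace (ULift.{u} ℕ)}
    {t : X.stalk (Hom.pt f F)} (h : natStalk f F t = 0) : IsAddUnit t := by
  refine Hom.isLocal_onStalk f F t ?_
  have : Hom.onStalk f F t = 0 := natStalk_injective_left f F (by simpa using h)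
  rw [this]
  exact isAddUnit_zero

end LMS

end

noncomputable section

open CategoryTheory TopologicalSpace Opposite TensorProduct LMS LatticeCone MonoidFace

/-! ### Units of dual monoids and double duality of lattices -/

namespace LatticeCone

variable {N N' : Type u} [AddCommGroup N] [AddCommGroup N']

theorem IsSharp.bot_isFaceOf {σ : PointedCone ℝ (ℝ ⊗[ℤ] N)} (hσ : IsSharp σ) :
    (⊥ : PointedCone ℝ (ℝ ⊗[ℤ] N)).IsFaceOf σ where
  le := bot_le
  mem_of_smul_add_mem := by
    intro x y a hx hy ha h
    have h0 : a • x + y = 0 := h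
    have h1 : a • x = 0 := hσ (a • x) (σ.smul_mem ha.le hx) (by
      rwa [neg_eq_of_add_eq_zero_right h0])
    exact (smul_eq_zero.1 h1).resolve_left ha.ne'

theorem mem_dualMonoid_bot (m : N →ₗ[ℤ] ℤ) :
    m ∈ dualMonoid (⊥ : PointedCone ℝ (ℝ ⊗[ℤ] N)) := by
  rintro v rfl
  exact (map_zero (evalReal m)).ge

theorem isAddUnit_of_evalReal_eq_zero {σ : PointedCone ℝ (ℝ ⊗[ℤ] N)} {m : dualMonoid σ}
    (h : ∀ v ∈ σ, evalReal m.1 v = 0) : IsAddUnit m := by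
  refine .of_add_eq_zero (⟨-m.1, fun v hv => ?_⟩ : dualMonoid σ) (Subtype.ext (add_neg_cancel m.1))
  rw [evalReal_neg, h v hv, neg_zero]

theorem evalReal_eq_zero_of_isAddUnit {σ : PointedCone ℝ (ℝ ⊗[ℤ] N)} {m : dualMonoid σ}
    (h : IsAddUnit m) {v : ℝ ⊗[ℤ] N} (hv : v ∈ σ) : evalReal m.1 v = 0 := by
  obtain ⟨b, hb⟩ := h.exists_neg
  have h1 : evalReal (m.1 + b.1) v = 0 := by
    rw [show m.1 + b.1 = 0 from congrArg Subtype.val hb, evalReal_zero]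
  rw [evalReal_add] at h1
  have := m.2 v hv
  have := b.2 v hv
  linarith

variable [Module.Free ℤ N] [Module.Finite ℤ N]

/-- A lattice is its own double dual. -/
theorem exists_apply_eq (ψ : (N →ₗ[ℤ] ℤ) →+ ℤ) : ∃ n : N, ∀ m, ψ m = m n := by
  obtain ⟨n, hn⟩ := (Module.evalEquiv ℤ N).surjective ψ.toIntLinearMap
  exact ⟨n, fun m => (congrArg (fun f => f m) hn).symm⟩

theorem exists_comp_eq (ψ : (N →ₗ[ℤ] ℤ) →+ (N' →ₗ[ℤ] ℤ)) :
    ∃ φ : N' →ₗ[ℤ] N, ∀ m, ψ m = m ∘ₗ φ := by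
  refine ⟨(Module.evalEquiv ℤ N).symm.toLinearMap ∘ₗ
    (Module.Dual.transpose (R := ℤ) ψ.toIntLinearMap ∘ₗ Module.Dual.eval ℤ N'), fun m => ?_⟩
  ext n
  change _ = m ((Module.evalEquiv ℤ N).symm _)
  rw [Module.apply_evalEquiv_symm_apply]
  rfl

theorem eq_of_forall_apply_eq {a b : N} (h : ∀ m : N →ₗ[ℤ] ℤ, m a = m b) : a = b :=
  (Module.evalEquiv ℤ N).injective (LinearMap.ext h)

end LatticeCone

/-! ### The generic point of a fan, and morphisms into a fan -/

namespace ClassicalFan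

variable (S : ClassicalFan.{u}) {T : ClassicalFan.{u}}

/-- The zero cone. -/
def zeroPt : S.Pt := ⟨⊥, by
  obtain ⟨σ, hσ⟩ := S.cones_nonempty
  exact S.face_mem σ hσ ⊥ (S.sharp σ hσ).bot_isFaceOf⟩

variable {S}

theorem zeroPt_isFaceOf (σ : S.Pt) : S.zeroPt.1.IsFaceOf σ.1 := (S.sharp σ.1 σ.2).bot_isFaceOf

theorem zeroPt_specializes (σ : S.toLMSObj.Pt) : (S.zeroPt : S.toLMSObj.Pt) ⤳ σ :=
  specializes_iff.2 (zeroPt_isFaceOf σ)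

instance : Finite S.toLMSObj.Pt := S.cones_finite.to_subtype

/-- The zero cone is a face of every cone, so it lies in every non-empty open set. -/
instance : IrreducibleSpace S.toLMSObj.Pt where
  isPreirreducible_univ U V hU hV := by
    rintro ⟨σ, -, hσ⟩ ⟨τ, -, hτ⟩
    exact ⟨S.zeroPt, trivial, (zeroPt_specializes σ).mem_open hU hσ,
      (zeroPt_specializes τ).mem_open hV hτ⟩
  toNonempty := ⟨S.zeroPt⟩

theorem isToric_toLMSObj (S : ClassicalFan.{u}) : S.toLMSObj.IsToric := by
  refine isToric_iff.2 fun σ => ⟨_, _, chart σ, ?_, isOpenImmersion_chart σ, mem_range_chart σ⟩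
  refine isToricMonoid_of_injective (fun m n hn h => ?_) _ Subtype.val_injective (dualMonoid_fg σ)
    (mrange_subtype_saturated σ)
  exact (smul_eq_zero.1 h).resolve_left hn.ne'

section Pt

variable {A : LMS.{u}} (f : A ⟶ T.toLMSObj) (a : A.Pt)

/-- The image of a point under a morphism to a fan is determined by the functionals that become
units. -/
theorem pt_eq_of_isFaceOf (τ : T.Pt) (hτ : τ.1.IsFaceOf (show T.Pt from Hom.pt f a).1)
    (h : ∀ t : T.toLMSObj.stalk (Hom.pt f a),
      (∀ v ∈ τ.1, evalReal (stalkEquiv (Hom.pt f a) t).1 v = 0) → IsAddUnit (Hom.onStalk f a t)) :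
    Hom.pt f a = τ := by
  -- If `τ` is a proper face, some functional `m` of the dual monoid vanishes on `τ` but not on the
  -- whole cone. It becomes a unit in the stalk at `a`, so by locality it is already a unit, and
  -- units vanish on the whole cone.
  by_contra hne
  obtain ⟨m, hm, hm0, v, hv, hmv⟩ := (isRational (Hom.pt f a)).exists_mem_dualMonoid_of_isFaceOf hτ
    fun e => hne (Subtype.ext e.symm)
  obtain ⟨t, ht⟩ := (stalkEquiv (Hom.pt f a)).surjective ⟨m, hm⟩
  have hu := Hom.isLocal_onStalk f a t (h t (by rwa [ht]))
  refine hmv ?_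
  have := evalReal_eq_zero_of_isAddUnit (hu.map (stalkEquiv (Hom.pt f a))) hv
  rwa [ht] at this

theorem pt_eq_zeroPt (h : ∀ t : A.stalk a, IsAddUnit t) : Hom.pt f a = T.zeroPt :=
  pt_eq_of_isFaceOf f a _ (zeroPt_isFaceOf _) fun _ _ => h _

/-- The image point is the zero cone, so its stalk is all of `M`, and `e` inverts `stalkEquiv`
there. The equality of points is only propositional, and this form keeps the stalk at `Hom.pt f a`.
-/
theorem exists_stalkEquiv_eq (h : ∀ t : A.stalk a, IsAddUnit t) :
    ∃ e : (T.N →ₗ[ℤ] ℤ) →+ T.toLMSObj.stalk (Hom.pt f a),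
      ∀ t, e (stalkEquiv (Hom.pt f a) t).1 = t := by
  have hm : ∀ m : T.N →ₗ[ℤ] ℤ, m ∈ dualMonoid (show T.Pt from Hom.pt f a).1 := by
    rw [pt_eq_zeroPt f a h]
    exact mem_dualMonoid_bot
  exact ⟨(stalkEquiv (Hom.pt f a)).symm.toAddMonoidHom.comp
    ((AddMonoidHom.id _).codRestrict _ hm), fun t => (stalkEquiv (Hom.pt f a)).symm_apply_apply t⟩

end Pt

theorem isAddUnit_stalk_zeroPt (t : S.toLMSObj.stalk S.zeroPt) : IsAddUnit t := by
  obtain ⟨m, rfl⟩ := (stalkEquiv S.zeroPt).symm.surjective t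
  refine IsAddUnit.map _ (isAddUnit_of_evalReal_eq_zero ?_)
  rintro v rfl
  exact map_zero _

/-! ### Separatedness -/

/-- The generic point of `Spec ℕ` has a group as stalk, so it goes to the zero cone and gives a
homomorphism `M → ℤ`, which is evaluation at a lattice point `n`. The other stalk maps are
restrictions of it. -/
theorem exists_natStalk_eq (f : Spec (ULift.{u} ℕ) ⟶ S.toLMSObj) : ∃ n : S.N,
    ∀ F t, (natStalk f F t).down = (stalkEquiv (Hom.pt f F) t).1 n := by
  obtain ⟨e, he⟩ := exists_stalkEquiv_eq f natGeneric isAddUnit_of_natGeneric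
  obtain ⟨n, hn⟩ := LatticeCone.exists_apply_eq
    (AddEquiv.ulift.toAddMonoidHom.comp ((natStalk f natGeneric).comp e))
  refine ⟨n, fun F t => ?_⟩
  have h := (natGeneric_specializes F).map (Hom.continuous_pt f)
  rw [← natStalk_generalize f (natGeneric_specializes F) t]
  refine Eq.trans ?_ ((hn (stalkEquiv _ (S.toLMSObj.generalize h t)).1).trans
    (congrArg (fun m => m n) (stalkEquiv_generalize _ _)))
  exact congrArg (fun x => (natStalk f natGeneric x).down) (he _).symm

/-- Values at the closed point are non-negative, which puts `n` in the cone. If `n` were in a proper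
face, functionals vanishing on that face would have value `0`, and by locality the closed point
would go to the face instead. -/
theorem toReal_mem_interior {f : Spec (ULift.{u} ℕ) ⟶ S.toLMSObj} {n : S.N}
    {F : MonoidFace (ULift.{u} ℕ)} (hF : ∀ p ∈ F.toAddSubmonoid, p = 0)
    (hn : ∀ t, (natStalk f F t).down = (stalkEquiv (Hom.pt f F) t).1 n) :
    toReal n ∈ interior (show S.Pt from Hom.pt f F).1 := by
  refine ⟨?_, fun τ hτ hne hnτ => hne ?_⟩
  · rw [← (isRational (Hom.pt f F)).dualCone_dualMonoid, toReal_mem_dualCone]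
    intro m hm
    obtain ⟨t, ht⟩ := (stalkEquiv (Hom.pt f F)).surjective ⟨m, hm⟩
    have := natStalk_nonneg f hF t
    rwa [hn, ht] at this
  · have := pt_eq_of_isFaceOf f F ⟨τ, S.face_mem _ (show S.Pt from Hom.pt f F).2 _ hτ⟩ hτ
      fun t ht => IsAddUnit.map _ (isAddUnit_of_natStalk_eq_zero f (ULift.ext _ _ ?_))
    · exact (congrArg (fun σ : S.Pt => σ.1) this).symm
    · rw [hn]
      have := ht _ hnτ
      rw [evalReal_toReal] at this
      exact_mod_cast this

/-- The restriction to `Spec ℤ` determines the lattice point `n` of a morphism, and the images of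
the closed point under `f` and `g` are cones with `n` in their interiors, hence equal. -/
theorem isValuativelySeparated_toLMSObj (S : ClassicalFan.{u}) :
    S.toLMSObj.IsValuativelySeparated := by
  intro f g h
  obtain ⟨n, hn⟩ := exists_natStalk_eq f
  have hgf := pt_natGeneric_eq h
  have hn' : ∀ F t, (natStalk g F t).down = (stalkEquiv (Hom.pt g F) t).1 n := by
    intro F t
    rw [← natStalk_generalize g (natGeneric_specializes F) t,
      natStalk_natGeneric_eq h.symm (specializes_of_eq hgf), hn]
    exact congrArg (fun m => m n) ((stalkEquiv_generalize _ _).trans (stalkEquiv_generalize _ _))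
  refine eq_of_specMap_comp_eq h fun F => ?_
  rcases eq_natGeneric_or F with rfl | hF
  · exact hgf
  · exact Subtype.ext (S.eq_of_mem_interior n _ (show S.Pt from Hom.pt f F).2 _
      (show S.Pt from Hom.pt g F).2 (toReal_mem_interior hF (hn F)) (toReal_mem_interior hF (hn' F)))

/-! ### The functor is fully faithful -/

/-- On the stalk `M'` at the zero cone the morphism is `m ↦ m ∘ f`, and functionals separate the
points of a lattice. -/
theorem toLMSMap_injective {f g : S ⟶ T} (h : toLMSMap f = toLMSMap g) : f = g := by
  obtain ⟨e, he⟩ := exists_stalkEquiv_eq (toLMSMap f) S.zeroPt isAddUnit_stalk_zeroPt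
  refine Hom.ext (LinearMap.ext fun n => eq_of_forall_apply_eq fun m => ?_)
  have hm : m ∈ dualMonoid (leastCone f S.zeroPt).1 := by
    rw [show leastCone f S.zeroPt = T.zeroPt from
      pt_eq_zeroPt (toLMSMap f) S.zeroPt isAddUnit_stalk_zeroPt]
    exact mem_dualMonoid_bot m
  obtain ⟨t, ht⟩ := (stalkEquiv (leastCone f S.zeroPt)).surjective ⟨m, hm⟩
  have hpt : (leastCone g S.zeroPt : T.toLMSObj.Pt) ⤳ (leastCone f S.zeroPt : T.toLMSObj.Pt) :=
    specializes_of_eq (congrArg (fun k : S.toLMSObj ⟶ T.toLMSObj => LMS.Hom.pt k S.zeroPt) h.symm)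
  have h1 := onStalk_eq_of_eq h S.zeroPt hpt t
  have h2 := congrArg (fun x => (stalkEquiv S.zeroPt x).1 n) h1
  have h3 := congrArg (fun x => x.1 n) (stalkEquiv_onStalk_toLMSMap f S.zeroPt t)
  have h4 := congrArg (fun x => x.1 n)
    (stalkEquiv_onStalk_toLMSMap g S.zeroPt (T.toLMSObj.generalize hpt t))
  have h5 := h3.symm.trans (h2.trans h4)
  change (stalkEquiv _ t).1 (f.toLin n) = (stalkEquiv _ _).1 (g.toLin n) at h5
  rw [stalkEquiv_generalize, ht] at h5
  exact h5

/-- The map of lattices is the transpose of the stalk map at the zero cone. -/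
theorem toLMSMap_surjective (f : S.toLMSObj ⟶ T.toLMSObj) : ∃ g : S ⟶ T, toLMSMap g = f := by
  obtain ⟨e, he⟩ := exists_stalkEquiv_eq f S.zeroPt isAddUnit_stalk_zeroPt
  obtain ⟨φ, hφ⟩ := exists_comp_eq ((dualMonoid S.zeroPt.1).subtype.comp
    ((stalkEquiv S.zeroPt).toAddMonoidHom.comp ((LMS.Hom.onStalk f S.zeroPt).comp e)))
  -- Generalization maps are inclusions into `M` and `M'`, so every stalk map is a restriction of
  -- the one at the zero cone.
  have key : ∀ (σ : S.Pt) (t : T.toLMSObj.stalk (LMS.Hom.pt f σ)),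
      (stalkEquiv σ (LMS.Hom.onStalk f σ t)).1 = (stalkEquiv (LMS.Hom.pt f σ) t).1 ∘ₗ φ := by
    intro σ t
    have h := (zeroPt_specializes σ).map (LMS.Hom.continuous_pt f)
    rw [← stalkEquiv_generalize (zeroPt_specializes σ), ← stalkEquiv_generalize h, ← hφ]
    refine congrArg (fun x => (stalkEquiv S.zeroPt x).1) ?_
    exact (LMS.Hom.onStalk_generalize f (zeroPt_specializes σ) t).symm.trans
      (congrArg (LMS.Hom.onStalk f S.zeroPt) (he _).symm)
  have hcone : ∀ (σ : S.Pt), ∀ v ∈ σ.1, mapReal φ v ∈ (show T.Pt from LMS.Hom.pt f σ).1 := by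
    intro σ v hv
    rw [← (isRational (LMS.Hom.pt f σ)).dualCone_dualMonoid]
    intro m hm
    obtain ⟨t, ht⟩ := (stalkEquiv (LMS.Hom.pt f σ)).surjective ⟨m, hm⟩
    have h1 := (stalkEquiv σ (LMS.Hom.onStalk f σ t)).2 v hv
    rw [key, ht, evalReal_comp] at h1
    exact h1
  let g : S ⟶ T := ⟨φ, fun σ hσ => ⟨_, (show T.Pt from LMS.Hom.pt f ⟨σ, hσ⟩).2, hcone ⟨σ, hσ⟩⟩⟩
  -- The least cone is a face of the cone `f σ`. Functionals vanishing on it pull back to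
  -- functionals vanishing on `σ`, that is, to units, so locality leaves no room between the two.
  have hpt : ∀ σ : S.Pt, LMS.Hom.pt f σ = leastCone g σ := fun σ =>
    pt_eq_of_isFaceOf f σ _ (leastCone_isFaceOf g σ _ (hcone σ)) fun t ht => by
      have hu : IsAddUnit (stalkEquiv σ (LMS.Hom.onStalk f σ t)) :=
        isAddUnit_of_evalReal_eq_zero fun v hv => by
          rw [key, evalReal_comp]
          exact ht _ (map_mem_leastCone g σ v hv)
      have := hu.map (stalkEquiv σ).symm
      rwa [AddEquiv.symm_apply_apply] at this
  refine ⟨g, (hom_ext hpt fun σ t => (stalkEquiv σ).injective (Subtype.ext ?_)).symm⟩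
  refine (key σ t).trans (Eq.trans ?_ (congrArg Subtype.val (stalkEquiv_onStalk_toLMSMap g σ _)).symm)
  exact congrArg (· ∘ₗ φ) (stalkEquiv_generalize _ _).symm

end ClassicalFan

end

noncomputable section

open CategoryTheory TopologicalSpace Opposite TensorProduct LMS LatticeCone MonoidFace

/-- The group completion of a toric monoid is a lattice. -/
theorem IsToricMonoid.free_finite {P : Type u} [AddCommMonoid P] (hP : IsToricMonoid P) :
    Module.Free ℤ (Algebra.GrothendieckAddGroup P) ∧
      Module.Finite ℤ (Algebra.GrothendieckAddGroup P) := by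
  have := hP.1
  have : Module.Finite ℤ (Algebra.GrothendieckAddGroup P) :=
    Module.Finite.iff_addGroup_fg.2 (AddGroup.fg_iff_addMonoid_fg.2 inferInstance)
  have : IsAddTorsionFree (Algebra.GrothendieckAddGroup P) := by
    refine ⟨fun n hn x y h => sub_eq_zero.1 (hP.2.2.2 _ n (Nat.pos_of_ne_zero hn) ?_)⟩
    rw [smul_sub]
    exact sub_eq_zero.2 h
  exact ⟨inferInstance, inferInstance⟩

namespace LMS

variable {X : LMS.{u}}

/-! ### Generic points -/

/-- Indistinguishable points lie in a common chart, and spectra are T0 spaces. -/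
theorem IsFan.t0Space (hX : LMS.IsFan X) : T0Space X.Pt := by
  refine ⟨fun x y h => ?_⟩
  obtain ⟨P, _, j, hj, F, rfl⟩ := isFan_iff.1 hX x
  obtain ⟨G, rfl⟩ := (h.mem_open_iff hj.isOpenEmbedding.isOpen_range).1 ⟨F, rfl⟩
  exact congrArg _ ((Inseparable.eq (X := MonoidFace P)
    (hj.isOpenEmbedding.isInducing.inseparable_iff.1 h)))

/-- By irreducibility every non-empty open set meets the chart, and every non-empty open set of the
chart contains its top face. -/
theorem IsOpenImmersion.pt_top_specializes [IrreducibleSpace X.Pt] {P : Type u} [AddCommMonoid P]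
    {j : Spec P ⟶ X} (hj : IsOpenImmersion j) (x : X.Pt) :
    Hom.pt j (⊤ : MonoidFace P) ⤳ x := by
  refine specializes_iff_forall_open.2 fun U hU hx => ?_
  obtain ⟨_, ⟨F, rfl⟩, hF⟩ := nonempty_preirreducible_inter hj.isOpenEmbedding.isOpen_range hU
    ⟨_, (⊤ : MonoidFace P), rfl⟩ ⟨x, hx⟩
  exact ((MonoidFace.specializes_iff.2 (le_top (a := (show MonoidFace P from F)))).map
    (Hom.continuous_pt j)).mem_open hU hF

/-- The isomorphism of stalks of an open immersion. -/
def IsOpenImmersion.stalkEquiv {Y : LMS.{u}} {j : Y ⟶ X} (hj : IsOpenImmersion j) (y : Y.Pt) :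
    X.stalk (Hom.pt j y) ≃+ Y.stalk y :=
  AddEquiv.ofBijective (Hom.onStalk j y) (hj.bijective_onStalk y)

/-- The stalk at the generic point of a chart. -/
def IsOpenImmersion.genericEquiv {P : Type u} [AddCommMonoid P] {j : Spec P ⟶ X}
    (hj : IsOpenImmersion j) :
    X.stalk (Hom.pt j (⊤ : MonoidFace P)) ≃+ Algebra.GrothendieckAddGroup P :=
  (hj.stalkEquiv (⊤ : MonoidFace P)).trans (specStalk ⊤)

/-- The stalk of a toric fan at a generic point is the dual of a lattice. -/
theorem IsToric.exists_generic [IrreducibleSpace X.Pt] (hX : X.IsToric) :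
    ∃ η : X.Pt, (∀ x, η ⤳ x) ∧ ∃ (N : Type u) (_ : AddCommGroup N) (_ : Module.Free ℤ N)
      (_ : Module.Finite ℤ N), Nonempty (X.stalk η ≃+ (N →ₗ[ℤ] ℤ)) := by
  obtain ⟨x⟩ : Nonempty X.Pt := inferInstance
  obtain ⟨P, _, j, hP, hj, -⟩ := isToric_iff.1 hX x
  have := hP.free_finite.1
  have := hP.free_finite.2
  -- The stalk is the group completion of `P`. Taking `N` to be its dual, double duality presents
  -- the stalk as the dual of `N`.
  exact ⟨_, hj.pt_top_specializes, Algebra.GrothendieckAddGroup P →ₗ[ℤ] ℤ, inferInstance,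
    inferInstance, inferInstance,
    ⟨hj.genericEquiv.trans (Module.evalEquiv ℤ (Algebra.GrothendieckAddGroup P)).toAddEquiv⟩⟩

/-! ### Charts in a lattice -/

section Lattice

variable {η : X.Pt} (hη : ∀ x, η ⤳ x) {N : Type u} [AddCommGroup N] (e : X.stalk η ≃+ (N →ₗ[ℤ] ℤ))

/-- The stalks embedded in the dual lattice. -/
def latticeHom (x : X.Pt) : X.stalk x →+ (N →ₗ[ℤ] ℤ) :=
  e.toAddMonoidHom.comp (X.generalize (hη x))

theorem latticeHom_generalize {x y : X.Pt} (h : y ⤳ x) (t : X.stalk x) :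
    latticeHom hη e y (X.generalize h t) = latticeHom hη e x t :=
  congrArg e (generalize_generalize _ _ _)

/-- As `x` and `η` specialize to each other, the two generalization maps between their stalks are
mutually inverse. -/
theorem latticeHom_bijective {x : X.Pt} (h : x ⤳ η) :
    Function.Bijective (latticeHom hη e x) := by
  refine e.bijective.comp ⟨fun s t hst => ?_, fun t => ⟨X.generalize h t, ?_⟩⟩
  · have := congrArg (X.generalize h) hst
    rwa [generalize_generalize, generalize_generalize, generalize_refl, generalize_refl] at this
  · rw [generalize_generalize, generalize_refl]

/-- A homomorphism `ι` from `P` to the dual lattice describing a chart `j : Spec P ⟶ X`. -/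
structure IsLatticeChart {P : Type u} [AddCommMonoid P] (j : Spec P ⟶ X)
    (ι : P →+ (N →ₗ[ℤ] ℤ)) : Prop where
  isOpenImmersion : IsOpenImmersion j
  fg : AddMonoid.FG P
  injective : Function.Injective ι
  saturated : ∀ (m : N →ₗ[ℤ] ℤ) (n : ℕ), 0 < n →
    n • m ∈ AddMonoidHom.mrange ι → m ∈ AddMonoidHom.mrange ι
  exists_sub : ∀ m, ∃ p q, m = ι p - ι q
  latticeHom_eq : ∀ (F : MonoidFace P) (t : X.stalk (Hom.pt j F)),
    latticeHom hη e _ t = locHom ι F (specStalk F (Hom.onStalk j F t))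

/-- The stalk at the generic point of the chart is the group completion of `P` and is identified
with `M` through `η`; then `ι` is the map from `P` to its group completion. -/
theorem IsToric.exists_isLatticeChart (hX : X.IsToric) (x : X.Pt) :
    ∃ (P : Type u) (_ : AddCommMonoid P) (j : Spec P ⟶ X) (ι : P →+ (N →ₗ[ℤ] ℤ)),
      IsLatticeChart hη e j ι ∧ x ∈ Set.range (Hom.pt j) := by
  obtain ⟨P, _, j, hP, hj, hx⟩ := isToric_iff.1 hX x
  -- The range of `j` is open and `η` specializes to a point of it, so `η` lies in the range, and
  -- the top face specializes to every point there.
  have hjη : Hom.pt j (⊤ : MonoidFace P) ⤳ η := by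
    obtain ⟨G, hG⟩ := (hη _).mem_open hj.isOpenEmbedding.isOpen_range ⟨(⊤ : MonoidFace P), rfl⟩
    rw [← hG]
    exact (MonoidFace.specializes_iff.2 le_top).map (Hom.continuous_pt j)
  let L : Algebra.GrothendieckAddGroup P ≃+ (N →ₗ[ℤ] ℤ) :=
    hj.genericEquiv.symm.trans (AddEquiv.ofBijective _ (latticeHom_bijective hη e hjη))
  refine ⟨P, _, j, L.toAddMonoidHom.comp Algebra.GrothendieckAddGroup.of, ⟨hj, hP.1,
    L.injective.comp hP.2.1, fun m n hn => ?_, fun m => ?_, fun F t => ?_⟩, hx⟩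
  · rintro ⟨p, hp⟩
    obtain ⟨q, hq⟩ := hP.2.2.1 (L.symm m) n hn ⟨p, by
      rw [← map_nsmul, ← hp]
      exact (L.symm_apply_apply _).symm⟩
    exact ⟨q, by
      change L (Algebra.GrothendieckAddGroup.of q) = m
      rw [hq, L.apply_symm_apply]⟩
  · obtain ⟨x, rfl⟩ := L.surjective m
    induction x using AddLocalization.induction_on with
    | H y =>
      refine ⟨y.1, y.2, ?_⟩
      change L _ = L (AddLocalization.mk _ _) - L (AddLocalization.mk _ _)
      rw [eq_sub_iff_add_eq, ← map_add, AddLocalization.mk_add]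
      congr 1
      rw [AddLocalization.mk_eq_mk_iff, AddLocalization.r_iff_exists]
      exact ⟨0, by simp [add_comm]⟩
  · obtain ⟨⟨p, q⟩, hpq⟩ : ∃ y : _ × F.toAddSubmonoid, specStalk F (Hom.onStalk j F t) =
        AddLocalization.mk y.1 y.2 := by
      generalize specStalk F (Hom.onStalk j F t) = x
      induction x using AddLocalization.induction_on with
      | H y => exact ⟨y, rfl⟩
    have h : (⊤ : MonoidFace P) ⤳ F := MonoidFace.specializes_iff.2 le_top
    have h1 : hj.genericEquiv (X.generalize (h.map (Hom.continuous_pt j)) t) =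
        (AddLocalization.mk p ⟨q.1, MonoidFace.mem_top _⟩ : (⊤ : MonoidFace P).Loc) :=
      (congrArg (specStalk (⊤ : MonoidFace P)) (Hom.onStalk_generalize j h t)).trans
        (specStalk_generalize h hpq)
    rw [hpq, locHom_mk, ← latticeHom_generalize hη e (h.map (Hom.continuous_pt j)),
      ← (AddEquiv.symm_apply_eq _).2 h1.symm, eq_sub_iff_add_eq]
    change L (AddLocalization.mk _ _) + L (AddLocalization.mk _ _) = L (AddLocalization.mk _ _)
    rw [← map_add, AddLocalization.mk_add]
    congr 1
    rw [AddLocalization.mk_eq_mk_iff, AddLocalization.r_iff_exists]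
    exact ⟨0, by simp [add_comm]⟩

/-- The cone attached to a point. -/
def ptCone (x : X.Pt) : PointedCone ℝ (ℝ ⊗[ℤ] N) :=
  dualCone (AddMonoidHom.mrange (latticeHom hη e x) : Set (N →ₗ[ℤ] ℤ))

section Chart

variable {hη e} {P : Type u} [AddCommMonoid P] {j : Spec P ⟶ X} {ι : P →+ (N →ₗ[ℤ] ℤ)}

theorem IsLatticeChart.mrange_latticeHom (h : IsLatticeChart hη e j ι) (F : MonoidFace P) :
    AddMonoidHom.mrange (latticeHom hη e (Hom.pt j F)) = AddMonoidHom.mrange (locHom ι F) := by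
  ext m
  constructor
  · rintro ⟨t, rfl⟩
    exact ⟨_, (h.latticeHom_eq F t).symm⟩
  · rintro ⟨x, rfl⟩
    obtain ⟨t, rfl⟩ := ((h.isOpenImmersion.stalkEquiv F).trans (specStalk F)).surjective x
    exact ⟨t, h.latticeHom_eq F t⟩

theorem IsLatticeChart.ptCone_eq (h : IsLatticeChart hη e j ι) (F : MonoidFace P) :
    ptCone hη e (Hom.pt j F) = faceCone ι F := by
  rw [ptCone, h.mrange_latticeHom, faceCone]

theorem IsLatticeChart.latticeHom_injective (h : IsLatticeChart hη e j ι) (F : MonoidFace P) :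
    Function.Injective (latticeHom hη e (Hom.pt j F)) := by
  intro s t hst
  rw [h.latticeHom_eq, h.latticeHom_eq] at hst
  exact ((h.isOpenImmersion.stalkEquiv F).trans (specStalk F)).injective
    (locHom_injective ι h.injective F hst)

theorem IsLatticeChart.isSharp_faceCone [Module.Free ℤ N] (h : IsLatticeChart hη e j ι)
    (F : MonoidFace P) : IsSharp (faceCone ι F) := by
  refine IsSharp.mono (isSharp_dualCone fun m => ?_) (isFaceOf_faceCone h.injective F).le
  obtain ⟨p, q, rfl⟩ := h.exists_sub m
  exact ⟨_, ⟨p, rfl⟩, _, ⟨q, rfl⟩, rfl⟩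

variable [Module.Free ℤ N] [Module.Finite ℤ N]

theorem IsLatticeChart.isFaceOf_iff (h : IsLatticeChart hη e j ι) {F G : MonoidFace P} :
    (ptCone hη e (Hom.pt j G)).IsFaceOf (ptCone hη e (Hom.pt j F)) ↔ Hom.pt j G ⤳ Hom.pt j F := by
  rw [h.ptCone_eq, h.ptCone_eq, isFaceOf_faceCone_iff h.injective h.fg h.saturated]
  exact MonoidFace.specializes_iff.symm.trans
    h.isOpenImmersion.isOpenEmbedding.isInducing.specializes_iff.symm

theorem IsLatticeChart.exists_eq (h : IsLatticeChart hη e j ι) {F : MonoidFace P}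
    {τ : PointedCone ℝ (ℝ ⊗[ℤ] N)} (hτ : τ.IsFaceOf (ptCone hη e (Hom.pt j F))) :
    ∃ G, ptCone hη e (Hom.pt j G) = τ := by
  rw [h.ptCone_eq] at hτ
  obtain ⟨G, hG⟩ := exists_eq_faceCone h.fg (hτ.trans (isFaceOf_faceCone h.injective F))
  exact ⟨G, (h.ptCone_eq G).trans hG⟩

/-! ### One-parameter families -/

/-- The closed point of `Spec ℕ`. -/
def natClosed : MonoidFace (ULift.{u} ℕ) where
  toAddSubmonoid := ⊥
  mem_of_add_mem {p q} h := by
    have h' : p.down + q.down = 0 := congrArg ULift.down h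
    exact ⟨ULift.ext _ _ (Nat.add_eq_zero_iff.1 h').1, ULift.ext _ _ (Nat.add_eq_zero_iff.1 h').2⟩

/-- An interior lattice point of the cone of `x` gives a morphism from `Spec ℕ` taking the closed
point to `x`. -/
theorem IsLatticeChart.exists_nat_hom (h : IsLatticeChart hη e j ι) {F : MonoidFace P} {n : N}
    (hn : toReal n ∈ interior (ptCone hη e (Hom.pt j F))) :
    ∃ k : Spec (ULift.{u} ℕ) ⟶ X, Hom.pt k natClosed = Hom.pt j F ∧
      Hom.pt k natGeneric = Hom.pt j (⊤ : MonoidFace P) ∧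
      ∀ t, (natStalk k natGeneric t).down = latticeHom hη e (Hom.pt k natGeneric) t n := by
  rw [h.ptCone_eq] at hn
  have hnn : ∀ p, 0 ≤ ι p n := fun p =>
    toReal_mem_dualCone.1 ((isFaceOf_faceCone h.injective F).le hn.1) _ ⟨p, rfl⟩
  -- Evaluation at `n` is non-negative on `P`, so it gives `P → ℕ`, and the morphism wanted is the
  -- resulting `Spec ℕ ⟶ Spec P` followed by the chart.
  let ν : P →+ ULift.{u} ℕ :=
    { toFun p := ⟨(ι p n).toNat⟩
      map_zero' := ULift.ext _ _ (by simp)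
      map_add' p q := ULift.ext _ _ (by simp [Int.toNat_add (hnn p) (hnn q)]) }
  have hν : ∀ p, (natToInt (ν p)).down = ι p n := fun p => Int.toNat_of_nonneg (hnn p)
  -- The closed point goes to the face of all `p` that vanish at `n`. It contains `F` because `n`
  -- lies in the cone of `F`, and it is no larger because `n` is interior to that cone.
  have hclosed : natClosed.comap ν = F := by
    refine le_antisymm (fun p hp => ?_) fun p hp => ?_
    · have hp0 : ν p = 0 := hp
      refine mem_of_mem_interior_faceCone h.injective h.fg h.saturated hn ?_
      rw [← hν, hp0, map_zero]
      rfl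
    · have h1 : 0 ≤ locHom ι F (AddLocalization.mk 0 ⟨p, hp⟩) n :=
        toReal_mem_dualCone.1 hn.1 _ ⟨_, rfl⟩
      rw [locHom_mk, map_zero, zero_sub, LinearMap.neg_apply] at h1
      have h2 : ι p n = 0 := le_antisymm (by simpa using h1) (hnn p)
      exact (ULift.ext _ _ (by simp [ν, h2]) : ν p = 0)
  refine ⟨specMap ν ≫ j, congrArg (Hom.pt j) hclosed, rfl, fun t => ?_⟩
  refine Eq.trans ?_ (congrArg (fun m => m n) (h.latticeHom_eq (natGeneric.comap ν) t)).symm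
  refine (congrArg (fun x => (locHom natToInt natGeneric (specStalk natGeneric x)).down)
    (Hom.onStalk_comp (specMap ν) j natGeneric t)).trans ?_
  refine (congrArg (fun x => (locHom natToInt natGeneric x).down)
    (specStalk_onStalk_specMap ν natGeneric _)).trans ?_
  change (locHom natToInt natGeneric (locMap ν natGeneric (specStalk (natGeneric.comap ν)
    (Hom.onStalk j (natGeneric.comap ν) t)))).down = _
  generalize specStalk (natGeneric.comap ν) (Hom.onStalk j (natGeneric.comap ν) t) = x
  induction x using AddLocalization.induction_on with
  | H y =>
    rw [locMap_mk, locHom_mk, locHom_mk, LinearMap.sub_apply, ← hν, ← hν]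
    rfl

end Chart

variable {hη e} {x y : X.Pt}

theorem IsToric.latticeHom_injective (hX : X.IsToric) : Function.Injective (latticeHom hη e x) := by
  obtain ⟨P, _, j, ι, h, F, rfl⟩ := hX.exists_isLatticeChart hη e x
  exact h.latticeHom_injective F

theorem IsToric.isSharp_ptCone [Module.Free ℤ N] (hX : X.IsToric) : IsSharp (ptCone hη e x) := by
  obtain ⟨P, _, j, ι, h, F, rfl⟩ := hX.exists_isLatticeChart hη e x
  exact (h.ptCone_eq F).symm ▸ h.isSharp_faceCone F

variable [Module.Free ℤ N] [Module.Finite ℤ N]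

theorem IsToric.isRational_ptCone (hX : X.IsToric) : IsRational (ptCone hη e x) := by
  obtain ⟨P, _, j, ι, h, F, rfl⟩ := hX.exists_isLatticeChart hη e x
  exact (h.ptCone_eq F).symm ▸ isRational_faceCone h.injective h.fg F

theorem IsToric.dualMonoid_ptCone (hX : X.IsToric) :
    dualMonoid (ptCone hη e x) = AddMonoidHom.mrange (latticeHom hη e x) := by
  obtain ⟨P, _, j, ι, h, F, rfl⟩ := hX.exists_isLatticeChart hη e x
  exact (congrArg dualMonoid (h.ptCone_eq F)).trans
    ((dualMonoid_faceCone h.injective h.fg h.saturated F).trans (h.mrange_latticeHom F).symm)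

theorem IsToric.exists_ptCone_eq (hX : X.IsToric) {τ : PointedCone ℝ (ℝ ⊗[ℤ] N)}
    (hτ : τ.IsFaceOf (ptCone hη e x)) : ∃ y, y ⤳ x ∧ ptCone hη e y = τ := by
  obtain ⟨P, _, j, ι, h, F, rfl⟩ := hX.exists_isLatticeChart hη e x
  obtain ⟨G, rfl⟩ := h.exists_eq hτ
  exact ⟨_, h.isFaceOf_iff.1 hτ, rfl⟩

theorem IsToric.isFaceOf_ptCone (hX : X.IsToric) (hyx : y ⤳ x) : (ptCone hη e y).IsFaceOf (ptCone hη e x) := by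
  obtain ⟨P, _, j, ι, h, F, rfl⟩ := hX.exists_isLatticeChart hη e x
  obtain ⟨G, rfl⟩ := hyx.mem_open h.isOpenImmersion.isOpenEmbedding.isOpen_range ⟨F, rfl⟩
  exact h.isFaceOf_iff.2 hyx

/-- The cones of different points have no common interior lattice point if the fan is separated. -/
theorem IsToric.eq_of_mem_interior (hX : X.IsToric) [IrreducibleSpace X.Pt] (hs : X.IsValuativelySeparated) {n : N}
    (hx : toReal n ∈ interior (ptCone hη e x)) (hy : toReal n ∈ interior (ptCone hη e y)) :
    x = y := by
  have := hX.isFan.t0Space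
  obtain ⟨P, _, j, ι, h, F, rfl⟩ := hX.exists_isLatticeChart hη e x
  obtain ⟨P', _, j', ι', h', F', rfl⟩ := hX.exists_isLatticeChart hη e y
  obtain ⟨k, hk, hkη, hkn⟩ := h.exists_nat_hom hx
  obtain ⟨k', hk', hkη', hkn'⟩ := h'.exists_nat_hom hy
  -- Both generic points go to generic points of `X`, which coincide in a T0 space. On the generic
  -- stalk both morphisms are evaluation at `n`, so they agree on `Spec ℤ`, and separatedness
  -- identifies the images of the closed point.
  have hpt : Hom.pt k natGeneric = Hom.pt k' natGeneric := by
    rw [hkη, hkη']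
    exact ((h.isOpenImmersion.pt_top_specializes _).antisymm
      (h'.isOpenImmersion.pt_top_specializes _)).eq
  have := hs k k' (specMap_comp_eq hpt fun t => ULift.ext _ _ (by
    rw [hkn, hkn', latticeHom_generalize]))
  rw [← hk, ← hk', this]

/-- Every rational cone has an interior lattice point, so separatedness applies to two points with
the same cone. -/
theorem IsToric.ptCone_injective (hX : X.IsToric) [IrreducibleSpace X.Pt] (hs : X.IsValuativelySeparated) :
    Function.Injective (ptCone hη e) := by
  intro x y hxy
  obtain ⟨n, hn⟩ := (hX.isRational_ptCone (hη := hη) (e := e) (x := x)).exists_toReal_mem_interior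
  exact hX.eq_of_mem_interior hs hn (hxy ▸ hn)

/-- A face of the cone of `x` is the cone of some generalization `z` of `x` in a chart around `x`;
injectivity of `ptCone` then gives `z = y`, even if `y` was not known to lie in that chart. -/
theorem IsToric.ptCone_isFaceOf_iff (hX : X.IsToric) [IrreducibleSpace X.Pt] (hs : X.IsValuativelySeparated) :
    (ptCone hη e y).IsFaceOf (ptCone hη e x) ↔ y ⤳ x := by
  refine ⟨fun h => ?_, hX.isFaceOf_ptCone⟩
  obtain ⟨z, hz, hzy⟩ := hX.exists_ptCone_eq h
  rwa [← hX.ptCone_injective hs hzy]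

/-! ### Reconstruction of a toric fan from its cones -/

variable (hη e)

/-- The classical fan of a separated toric fan. -/
def IsToric.classicalFan (hX : X.IsToric) [Finite X.Pt] [IrreducibleSpace X.Pt] (hs : X.IsValuativelySeparated) :
    ClassicalFan.{u} where
  N := N
  cones := Set.range (ptCone hη e)
  cones_finite := Set.finite_range _
  cones_nonempty := ⟨_, η, rfl⟩
  rational := by
    rintro _ ⟨x, rfl⟩
    exact hX.isRational_ptCone
  sharp := by
    rintro _ ⟨x, rfl⟩
    exact hX.isSharp_ptCone
  face_mem := by
    rintro _ ⟨x, rfl⟩ τ hτ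
    obtain ⟨y, -, rfl⟩ := hX.exists_ptCone_eq hτ
    exact ⟨y, rfl⟩
  eq_of_mem_interior := by
    rintro n _ ⟨x, rfl⟩ _ ⟨y, rfl⟩ hx hy
    rw [hX.eq_of_mem_interior hs hx hy]

/-- A finite irreducible separated toric fan comes from a classical fan. -/
theorem IsToric.nonempty_classicalFan_iso (hX : X.IsToric) [Finite X.Pt] [IrreducibleSpace X.Pt]
    (hs : X.IsValuativelySeparated) :
    Nonempty ((hX.classicalFan hη e hs).toLMSObj ≅ X) := by
  let S := hX.classicalFan hη e hs
  let φ : S.Pt ≃ X.Pt := (Equiv.ofInjective (ptCone hη e) (hX.ptCone_injective hs)).symm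
  have hφ : ∀ σ : S.Pt, ptCone hη e (φ σ) = σ.1 := fun σ => congrArg Subtype.val
    ((Equiv.ofInjective (ptCone hη e) (hX.ptCone_injective hs)).apply_symm_apply σ)
  have hspec : ∀ σ τ : S.Pt, τ.1.IsFaceOf σ.1 ↔ φ τ ⤳ φ σ := fun σ τ => by
    rw [← hX.ptCone_isFaceOf_iff hs (hη := hη) (e := e), hφ, hφ]
    rfl
  have hcont : Continuous φ := ⟨fun U hU σ hσ τ h => ((hspec σ τ).1 h).mem_open hU hσ⟩
  have hopen : IsOpenMap φ := fun V hV => by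
    -- In the finite space `X` a set is open as soon as it is stable under generalization.
    rw [isOpen_iff_forall_specializes]
    rintro x _ hx ⟨σ, hσ, rfl⟩
    obtain ⟨τ, rfl⟩ := φ.surjective x
    exact ⟨τ, hV σ hσ τ ((hspec σ τ).2 hx), rfl⟩
  have hdual : ∀ σ : S.Pt, (dualMonoid σ.1 : AddSubmonoid (N →ₗ[ℤ] ℤ)) =
      AddMonoidHom.mrange (latticeHom hη e (φ σ)) := fun σ =>
    (congrArg dualMonoid (hφ σ)).symm.trans hX.dualMonoid_ptCone
  have hmem : ∀ (σ : S.Pt) (t : X.stalk (φ σ)), latticeHom hη e (φ σ) t ∈ dualMonoid σ.1 :=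
    fun σ t => (hdual σ).ge ⟨t, rfl⟩
  -- The embedding of each stalk in the dual lattice has the dual monoid of its cone as image, so it
  -- is an isomorphism of stalks. Compatibility with generalization makes these maps a morphism of
  -- sheaves.
  let f : ∀ σ : S.Pt, X.stalk (φ σ) →+ dualMonoid σ.1 := fun σ =>
    (latticeHom hη e (φ σ)).codRestrict _ (hmem σ)
  have hf : ∀ σ, Function.Bijective (f σ) := by
    refine fun σ => ⟨fun s t h => hX.latticeHom_injective (congrArg Subtype.val h), ?_⟩
    rintro ⟨m, hm⟩
    obtain ⟨t, ht⟩ := (hdual σ).le hm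
    exact ⟨t, Subtype.ext ht⟩
  let k : S.toLMSObj ⟶ X := AddLocalPredicate.homOfStalks S.isGermDetermined_compatible
    ⟨φ, hcont⟩ f (fun σ => isLocal_of_bijective (hf σ)) fun U s σ τ h => by
      have hτσ := (hspec σ.1 τ.1).1 h
      exact (congrArg (latticeHom hη e (φ τ.1)) (generalize_germ hτσ U σ.2 s)).symm.trans
        (latticeHom_generalize hη e hτσ _)
  have hk : IsOpenImmersion k := by
    refine .of_bijective (.of_continuous_injective_isOpenMap hcont φ.injective hopen) fun σ => ?_
    have h1 : ∀ t, S.stalkEquiv σ (Hom.onStalk k σ t) = f σ t :=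
      AddLocalPredicate.stalkEquiv_onStalk_homOfStalks S.isGermDetermined_compatible _ _ _ _ σ
    have h2 : ⇑(Hom.onStalk k σ) = (S.stalkEquiv σ).symm ∘ f σ :=
      funext fun t => (AddEquiv.eq_symm_apply _).2 (h1 t)
    rw [h2]
    exact (S.stalkEquiv σ).symm.bijective.comp (hf σ)
  exact hk.nonempty_iso φ.surjective

end Lattice

end LMS

/-! ### The theorem -/

theorem mainTheorem9 :
    ∃ h : ∀ S : ClassicalFan.{u}, LMS.IsFan (ClassicalFan.toLMS.obj S),
      (LMS.IsFan.lift ClassicalFan.toLMS h).Full ∧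
      (LMS.IsFan.lift ClassicalFan.toLMS h).Faithful ∧
      ∀ X : AbstractFan.{u},
        (LMS.IsFan.lift ClassicalFan.toLMS h).essImage X ↔
          (X.obj.IsToric ∧ Finite X.obj.Pt ∧ IrreducibleSpace X.obj.Pt ∧
            X.obj.IsValuativelySeparated) := by
  have : ClassicalFan.toLMS.{u}.Full := ⟨ClassicalFan.toLMSMap_surjective⟩
  have : ClassicalFan.toLMS.{u}.Faithful := ⟨ClassicalFan.toLMSMap_injective⟩
  have h : ∀ S, LMS.IsFan (ClassicalFan.toLMS.obj S) := fun S =>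
    (ClassicalFan.isToric_toLMSObj S).isFan
  refine ⟨h, inferInstanceAs (ObjectProperty.lift LMS.IsFan ClassicalFan.toLMS h).Full,
    inferInstanceAs (ObjectProperty.lift LMS.IsFan ClassicalFan.toLMS h).Faithful,
    fun X => ⟨?_, ?_⟩⟩
  · rintro ⟨S, ⟨i⟩⟩
    let e : S.toLMSObj ≅ X.obj := LMS.IsFan.ι.mapIso i
    exact ⟨(ClassicalFan.isToric_toLMSObj S).of_iso e, .of_equiv _ (homeomorphOfIso e).toEquiv,
      (homeomorphOfIso e).surjective.irreducibleSpace (homeomorphOfIso e).continuous,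
      (ClassicalFan.isValuativelySeparated_toLMSObj S).of_iso e⟩
  · rintro ⟨hX, _, _, hs⟩
    obtain ⟨η, hη, N, _, _, _, ⟨e⟩⟩ := hX.exists_generic
    obtain ⟨i⟩ := hX.nonempty_classicalFan_iso hη e hs
    exact ⟨hX.classicalFan hη e hs, ⟨ObjectProperty.isoMk _ i⟩⟩

end
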